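/- Consider the problem of minimizing a submodular function with a $k$-sparse minimizer: $V$ is a ground set with $n\ge 1$ elements, $f:2^V\to\mathbb R$ satisfies $f(S\cup\{i\})-f(S)\ge f(T\cup\{i\})-f(T)$ for all $S\subseteq T\subseteq V$ and $i\in V\setminus T$, and some minimizer of $f$ has at most $k$ elements, where $k\ge 1$. Write $|f|=\max_{S\subseteq V}|f(S)|$ and $f^*=\min_{S\subseteq V}f(S)$. An algorithm (a real RAM, i.e. with unit-cost arithmetic and comparisons) is given $n$, $k$ and $\epsilon>0$, and it accesses $f$ only through an evaluation oracle, in rounds of parallel queries; each query costs time $\mathsf{EO}\ge 0$, and the parallel depth is the number of rounds. There is a deterministic parallel algorithm, the same for all $n,k,f,\epsilon$, that always halts and returns a set $S\subseteq V$ with $f(S)\le f^*+\epsilon$. With $L=\log(2+|f|/\epsilon)$ (which is $\Theta(\log(|f|/\epsilon))$ for $\epsilon\le |f|/2$), its parallel depth is $$\widetilde O\bigl(k^7 L\bigr),$$ its total runtime is $$\widetilde O\bigl(n^2k^7L\cdot\mathsf{EO}+\mathrm{poly}(n)\,L\bigr),$$ and it submits at most $\mathrm{poly}(n,L)$ queries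 in each round. Here $\widetilde O$ hides a universal constant and a factor polylogarithmic in $n$ (a fixed power of $\log(n+1)$), and the polynomials are universal. -/

import Mathlib

namespace SparseSFM

/-! ### Set functions on a ground set with `n` elements -/

/-- Submodularity as diminishing marginal differences. -/
def Submodular {n : ℕ} (f : Finset (Fin n) → ℝ) : Prop :=
  ∀ S T : Finset (Fin n), S ⊆ T → ∀ i, i ∉ T →
    f (insert i T) - f T ≤ f (insert i S) - f S

/-- `|f| = max_S |f S|`. -/
noncomputable def absMax {n : ℕ} (f : Finset (Fin n) → ℝ) : ℝ :=
  Finset.univ.sup' Finset.univ_nonempty fun S => |f S|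

/-- `f^* = min_S f S`. -/
noncomputable def minValue {n : ℕ} (f : Finset (Fin n) → ℝ) : ℝ :=
  Finset.univ.inf' Finset.univ_nonempty f

/-- Some minimizer of `f` has at most `k` elements. -/
def HasSparseMinimizer {n : ℕ} (f : Finset (Fin n) → ℝ) (k : ℕ) : Prop :=
  ∃ S : Finset (Fin n), S.card ≤ k ∧ f S = minValue f

/-- `S` is an additive `ε`-approximate minimizer of `f`. -/
def IsApproxMinimizer {n : ℕ} (f : Finset (Fin n) → ℝ) (ε : ℝ) (S : Finset (Fin n)) : Prop :=
  f S ≤ minValue f + ε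

/-! ### The machine: a real RAM with a parallel evaluation oracle

The memory consists of arrays of natural numbers and arrays of real numbers.  Arrays are named
by natural numbers that are fixed in the program text, and a cell is addressed by a computed index.
Natural numbers (indices and counters) can be added, subtracted (truncated at `0`) and compared;
real numbers can be added, subtracted, multiplied, divided and compared.  Every operation has
unit cost.  There is no rounding, no transcendental function and no randomness, the only constants
in a program are natural numbers, and the set function is accessed only by rounds of queries. -/

/-- The contents of the memory: array name, then index, then value. -/
structure State where
  nat : ℕ → ℕ → ℕ
  real : ℕ → ℕ → ℝ

/-- Expressions with natural number values. -/
inductive NExp where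
  | lit (c : ℕ)
  | get (a : ℕ) (i : NExp)
  | add (e₁ e₂ : NExp)
  | sub (e₁ e₂ : NExp)

/-- Expressions with real values. -/
inductive RExp where
  | cast (e : NExp)
  | get (a : ℕ) (i : NExp)
  | add (e₁ e₂ : RExp)
  | sub (e₁ e₂ : RExp)
  | mul (e₁ e₂ : RExp)
  | div (e₁ e₂ : RExp)

/-- Tests. -/
inductive BExp where
  | natLt (e₁ e₂ : NExp)
  | realLt (e₁ e₂ : RExp)
  | not (b : BExp)
  | and (b₁ b₂ : BExp)

/-- Programs.  `query m Q A` is one round of parallel oracle queries: it submits `m` sets, which are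
described by the 0/1 rows of the array `Q`, and stores the `m` answers in the array `A`. -/
inductive Program where
  | skip
  | setNat (a : ℕ) (i e : NExp)
  | setReal (a : ℕ) (i : NExp) (e : RExp)
  | seq (p q : Program)
  | cond (b : BExp) (p q : Program)
  | loop (b : BExp) (p : Program)
  | query (m : NExp) (Q A : ℕ)

def NExp.eval (s : State) : NExp → ℕ
  | lit c => c
  | get a i => s.nat a (i.eval s)
  | add e₁ e₂ => e₁.eval s + e₂.eval s
  | sub e₁ e₂ => e₁.eval s - e₂.eval s

/-- The number of operations in an expression, each one of unit cost. -/
def NExp.cost : NExp → ℕ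
  | lit _ => 1
  | get _ i => i.cost + 1
  | add e₁ e₂ => e₁.cost + e₂.cost + 1
  | sub e₁ e₂ => e₁.cost + e₂.cost + 1

noncomputable def RExp.eval (s : State) : RExp → ℝ
  | cast e => (e.eval s : ℝ)
  | get a i => s.real a (i.eval s)
  | add e₁ e₂ => e₁.eval s + e₂.eval s
  | sub e₁ e₂ => e₁.eval s - e₂.eval s
  | mul e₁ e₂ => e₁.eval s * e₂.eval s
  | div e₁ e₂ => e₁.eval s / e₂.eval s

def RExp.cost : RExp → ℕ
  | cast e => e.cost + 1
  | get _ i => i.cost + 1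
  | add e₁ e₂ => e₁.cost + e₂.cost + 1
  | sub e₁ e₂ => e₁.cost + e₂.cost + 1
  | mul e₁ e₂ => e₁.cost + e₂.cost + 1
  | div e₁ e₂ => e₁.cost + e₂.cost + 1

def BExp.Holds (s : State) : BExp → Prop
  | natLt e₁ e₂ => e₁.eval s < e₂.eval s
  | realLt e₁ e₂ => e₁.eval s < e₂.eval s
  | not b => ¬ b.Holds s
  | and b₁ b₂ => b₁.Holds s ∧ b₂.Holds s

def BExp.cost : BExp → ℕ
  | natLt e₁ e₂ => e₁.cost + e₂.cost + 1
  | realLt e₁ e₂ => e₁.cost + e₂.cost + 1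
  | not b => b.cost + 1
  | and b₁ b₂ => b₁.cost + b₂.cost + 1

/-- Write `v` into cell `i` of the natural number array `a`. -/
def State.writeNat (s : State) (a i v : ℕ) : State :=
  { s with nat := Function.update s.nat a (Function.update (s.nat a) i v) }

/-- Write `v` into cell `i` of the real array `a`. -/
noncomputable def State.writeReal (s : State) (a i : ℕ) (v : ℝ) : State :=
  { s with real := Function.update s.real a (Function.update (s.real a) i v) }

/-- The set that is described by row `i` of the natural number array `Q`, read as a matrix with
`n` columns: it consists of the `v` whose entry is nonzero. -/
def State.row (s : State) (n Q i : ℕ) : Finset (Fin n) :=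
  Finset.univ.filter fun v => s.nat Q (i * n + v) ≠ 0

/-- The memory after a round of `m` queries. -/
noncomputable def State.answer {n : ℕ} (s : State) (f : Finset (Fin n) → ℝ) (m Q A : ℕ) : State :=
  { s with real := Function.update s.real A fun i => if i < m then f (s.row n Q i) else s.real A i }

/-- The resources used by a run: the number of machine steps other than oracle calls, and the
numbers of queries in the successive rounds. -/
structure Cost where
  steps : ℕ
  rounds : List ℕ

/-- Local work of `t` steps, without any query. -/
def Cost.work (t : ℕ) : Cost := ⟨t, []⟩

/-- The cost of one run followed by another one. -/
def Cost.append (c d : Cost) : Cost := ⟨c.steps + d.steps, c.rounds ++ d.rounds⟩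

/-- Parallel depth: the number of rounds of queries. -/
def Cost.depth (c : Cost) : ℕ := c.rounds.length

/-- The total number of oracle queries. -/
def Cost.queries (c : Cost) : ℕ := c.rounds.sum

/-- Total (sequential) running time, when one evaluation of `f` takes time `EO`. -/
def Cost.time (c : Cost) (EO : ℝ) : ℝ := c.queries * EO + c.steps

/-- `Exec f p s c s'`: run from memory `s` with evaluation oracle `f`, the program `p` halts
with memory `s'` and has used the resources `c`.  A round of `m` queries is charged `m` oracle
calls, and `m * (n + 1)` steps for reading the `m` sets and writing the `m` answers. -/
inductive Exec {n : ℕ} (f : Finset (Fin n) → ℝ) : Program → State → Cost → State → Prop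
  | skip (s : State) : Exec f .skip s (.work 1) s
  | setNat (s : State) (a : ℕ) (i e : NExp) :
      Exec f (.setNat a i e) s (.work (i.cost + e.cost + 1))
        (s.writeNat a (i.eval s) (e.eval s))
  | setReal (s : State) (a : ℕ) (i : NExp) (e : RExp) :
      Exec f (.setReal a i e) s (.work (i.cost + e.cost + 1))
        (s.writeReal a (i.eval s) (e.eval s))
  | seq {p q : Program} {s s₁ s₂ : State} {c d : Cost} :
      Exec f p s c s₁ → Exec f q s₁ d s₂ → Exec f (.seq p q) s (c.append d) s₂
  | condTrue {b : BExp} {p q : Program} {s s₁ : State} {c : Cost} :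
      b.Holds s → Exec f p s c s₁ →
        Exec f (.cond b p q) s ((Cost.work (b.cost + 1)).append c) s₁
  | condFalse {b : BExp} {p q : Program} {s s₁ : State} {c : Cost} :
      ¬ b.Holds s → Exec f q s c s₁ →
        Exec f (.cond b p q) s ((Cost.work (b.cost + 1)).append c) s₁
  | loopStop {b : BExp} {p : Program} {s : State} :
      ¬ b.Holds s → Exec f (.loop b p) s (.work (b.cost + 1)) s
  | loopStep {b : BExp} {p : Program} {s s₁ s₂ : State} {c d : Cost} :
      b.Holds s → Exec f p s c s₁ → Exec f (.loop b p) s₁ d s₂ →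
        Exec f (.loop b p) s ((Cost.work (b.cost + 1)).append (c.append d)) s₂
  | query (s : State) (m : NExp) (Q A : ℕ) :
      Exec f (.query m Q A) s ⟨m.cost + 1 + m.eval s * (n + 1), [m.eval s]⟩
        (s.answer f (m.eval s) Q A)

/-- Programs are deterministic: a run has at most one outcome and one cost. -/
theorem Exec.deterministic {n : ℕ} {f : Finset (Fin n) → ℝ} {p : Program} {s s₁ s₂ : State}
    {c₁ c₂ : Cost} (h₁ : Exec f p s c₁ s₁) (h₂ : Exec f p s c₂ s₂) : c₁ = c₂ ∧ s₁ = s₂ := by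
  induction h₁ generalizing c₂ s₂ with
  | skip | setNat | setReal | query => cases h₂; exact ⟨rfl, rfl⟩
  | seq _ _ ih₁ ih₂ =>
    cases h₂ with
    | seq a b =>
      obtain ⟨rfl, rfl⟩ := ih₁ a
      obtain ⟨rfl, rfl⟩ := ih₂ b
      exact ⟨rfl, rfl⟩
  | condTrue hb _ ih =>
    cases h₂ with
    | condTrue _ a => obtain ⟨rfl, rfl⟩ := ih a; exact ⟨rfl, rfl⟩
    | condFalse hb' _ => exact absurd hb hb'
  | condFalse hb _ ih =>
    cases h₂ with
    | condTrue hb' _ => exact absurd hb' hb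
    | condFalse _ a => obtain ⟨rfl, rfl⟩ := ih a; exact ⟨rfl, rfl⟩
  | loopStop hb =>
    cases h₂ with
    | loopStop _ => exact ⟨rfl, rfl⟩
    | loopStep hb' _ _ => exact absurd hb' hb
  | loopStep hb _ _ ih₁ ih₂ =>
    cases h₂ with
    | loopStop hb' => exact absurd hb hb'
    | loopStep _ a b =>
      obtain ⟨rfl, rfl⟩ := ih₁ a
      obtain ⟨rfl, rfl⟩ := ih₂ b
      exact ⟨rfl, rfl⟩

/-- The initial memory: natural number array `0` starts with `n, k`, real array `0` starts with `ε`,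
and everything else is zero. -/
noncomputable def input (n k : ℕ) (ε : ℝ) : State where
  nat a i := if a = 0 ∧ i = 0 then n else if a = 0 ∧ i = 1 then k else 0
  real a i := if a = 0 ∧ i = 0 then ε else 0

/-- The set returned by a run: it is read off from the first `n` cells of the natural number
array `1`. -/
def output (n : ℕ) (s : State) : Finset (Fin n) := s.row n 1 0

end SparseSFM

/-!
Let `S` be a minimizer with at most `K = min n k` elements; the algorithm never knows it.  The
algorithm maintains a scale `φ`, a set `C 0 ⊆ S`, and for each element `v` a set `C (v + 1)` that
contains `v` and is contained in `S` whenever `v` is, together with a set of dead elements outside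
`S`.  All these sets, apart from those of dead elements, have values at most `φ` above the minimum
(`Inv`).  As soon as `φ ≤ ε`, the set `C 0` is the answer.  The initial scale is `O(n |f|)` by
`le_minValue`, and a phase halves it (`Inv.next`), so that there are `O(log n · log (2 + |f| / ε))`
phases.

In a phase the sets `C (v + 1)` at its start, called `base v`, serve as implications: a set may
contain no dead element, and an alive `v` only together with `base v`.  The sets that obey these rules above a given `C`
form a ring family, and the function `ringExt`, which replaces a set by its largest such subset
`core` and charges `φ` for each element that is lost, is again submodular, is bounded below by the
minimum of `f`, and agrees with `f` at `C` and at `S`.  Its marginal values are at most `φ`, however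
large those of `f` are (`Feasible.le_add_card`); this is what makes the number of steps
in a phase independent of `|f|` and, up to a logarithm, of `n`.

Starting from `C`, multiplicative weights is run on the Lovász subgradients of `ringExt`.  The
weights are only capped at `1` and not normalized, and `regret_le` bounds the regret against every
comparator with at most `K + 1` elements.  The subgradients are truncated below at `-3Kφ`, which
does no harm on `S` (`Valid.sum_step_le`).  After `O(K ^ 6 log n)` steps, either some accumulated
entry is so negative that its element must lie in `S` if `C` does (`Valid.mem_of_total_lt`, with
`S` and that element as the comparator), and its base set is added to `C`; or no entry is, and then
`C` is nearly optimal (`Valid.le_of_forall_total`).  As `S` has at most `K` elements, `K + 1` rounds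
of this kind lead to the second case (`Valid.rounds`), which gives `O(K ^ 7 log n)` rounds of
queries in a phase.  All `n + 1` sets `C p` are treated in parallel, each with `2n` queries in a
step.  For `p = v + 1` with `v ∉ S` nothing is guaranteed, and if the resulting value is too large,
then `v` is declared dead.

The algorithm is written out as a program, `sparseMinimizer`.  It is verified with the rules for
`Runs`, which also count rounds of queries and, through `Program.bound`, steps: every loop inside a
phase makes polynomially many iterations in `n`, so a phase costs polynomially many steps.
-/

namespace SparseSFM

variable {n : ℕ}

/-! ### Submodular functions and the Lovász subgradient -/

theorem Submodular.union_add_inter_le {f : Finset (Fin n) → ℝ} (hf : Submodular f)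
    (A B : Finset (Fin n)) : f (A ∪ B) + f (A ∩ B) ≤ f A + f B := by
  have key : ∀ D S T : Finset (Fin n), S ⊆ T → Disjoint D T →
      f (D ∪ T) - f T ≤ f (D ∪ S) - f S := by
    intro D
    induction D using Finset.induction_on with
    | empty => intro S T _ _; simp
    | insert a D ha ih =>
      intro S T hST hD
      rw [Finset.disjoint_insert_left] at hD
      have h₁ := ih S T hST hD.2
      have h₂ := hf (D ∪ S) (D ∪ T) (Finset.union_subset_union_right hST) a
        (by simp [ha, hD.1])
      rw [Finset.insert_union, Finset.insert_union]
      linarith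
  have h := key (B \ A) (A ∩ B) A Finset.inter_subset_left Finset.sdiff_disjoint
  rw [Finset.sdiff_union_self_eq_union, Finset.union_comm B A] at h
  have : B \ A ∪ A ∩ B = B := by
    ext v; simp only [Finset.mem_union, Finset.mem_sdiff, Finset.mem_inter]; tauto
  rw [this] at h
  linarith

theorem minValue_le (f : Finset (Fin n) → ℝ) (S : Finset (Fin n)) : minValue f ≤ f S :=
  Finset.inf'_le _ (Finset.mem_univ S)

theorem abs_le_absMax (f : Finset (Fin n) → ℝ) (S : Finset (Fin n)) : |f S| ≤ absMax f :=
  Finset.le_sup' (fun S => |f S|) (Finset.mem_univ S)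

/-- Elements are processed in order of decreasing weight `x`, with ties broken by the index.
`before x q 0` consists of the elements strictly before `q`, and `before x q 1` contains `q` too. -/
noncomputable def before (x : Fin n → ℝ) (q : Fin n) (b : ℕ) : Finset (Fin n) :=
  Finset.univ.filter fun v => x q < x v ∨ (¬ x v < x q ∧ (v : ℕ) < q + b)

/-- The sort key of the order used in `before`. -/
def sortKey (x : Fin n → ℝ) (q : Fin n) : ℝ ×ₗ Fin n := toLex (-x q, q)

theorem sortKey_injective (x : Fin n → ℝ) : Function.Injective (sortKey x) := by
  intro a b h
  have := congrArg (fun p => (ofLex p).2) h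
  simpa [sortKey] using this

theorem mem_before_zero {x : Fin n → ℝ} {q v : Fin n} :
    v ∈ before x q 0 ↔ sortKey x v < sortKey x q := by
  simp only [before, Finset.mem_filter, Finset.mem_univ, true_and, sortKey,
    Prod.Lex.toLex_lt_toLex, neg_lt_neg_iff, add_zero, neg_inj, Fin.lt_def]
  constructor
  · rintro (h | ⟨h, h'⟩)
    · exact Or.inl h
    · rcases lt_or_eq_of_le (not_lt.1 h) with h'' | h''
      · exact Or.inl h''
      · exact Or.inr ⟨h''.symm, h'⟩
  · rintro (h | ⟨h, h'⟩)
    · exact Or.inl h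
    · exact Or.inr ⟨by rw [h]; exact lt_irrefl _, h'⟩

theorem before_one (x : Fin n → ℝ) (q : Fin n) : before x q 1 = insert q (before x q 0) := by
  ext v
  simp only [before, Finset.mem_filter, Finset.mem_univ, true_and, Finset.mem_insert, Fin.ext_iff]
  constructor
  · rintro (h | ⟨h, h'⟩)
    · exact Or.inr (Or.inl h)
    · by_cases hv : (v : ℕ) = q
      · exact Or.inl hv
      · exact Or.inr (Or.inr ⟨h, by omega⟩)
  · rintro (h | h | ⟨h, h'⟩)
    · refine Or.inr ⟨?_, by omega⟩
      rw [Fin.ext h]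
      exact lt_irrefl _
    · exact Or.inl h
    · exact Or.inr ⟨h, by omega⟩

theorem notMem_before_zero (x : Fin n → ℝ) (q : Fin n) : q ∉ before x q 0 := by
  rw [mem_before_zero]; exact lt_irrefl _

/-- The marginal vector of the order by decreasing `x`, paired with `x`, is the Lovász extension
up to the constant `h ∅`, hence an average of values of `h`. -/
theorem sum_mul_marginal_ge (h : Finset (Fin n) → ℝ) (x : Fin n → ℝ) (hx₀ : ∀ q, 0 ≤ x q)
    (hx₁ : ∀ q, x q ≤ 1) (m : ℝ) (hm : ∀ S, m ≤ h S) :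
    m - h ∅ ≤ ∑ q, x q * (h (before x q 1) - h (before x q 0)) := by
  have key : ∀ s : Finset (Fin n), (∀ v w, w ∈ s → sortKey x v < sortKey x w → v ∈ s) →
      ∀ c : ℝ, c ≤ 1 → (∀ q ∈ s, c ≤ x q) →
      c * (h s - m) + (m - h ∅) ≤ ∑ q ∈ s, x q * (h (before x q 1) - h (before x q 0)) := by
    intro s
    induction s using Finset.induction_on_max_value (sortKey x) with
    | empty =>
      intro _ c hc _
      have := mul_nonneg (sub_nonneg.2 hc) (sub_nonneg.2 (hm ∅))
      simp only [Finset.sum_empty]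
      linarith
    | insert a s ha hmax ih =>
      intro hs c hc hcx
      have hb : before x a 0 = s := by
        ext v
        rw [mem_before_zero]
        constructor
        · intro hv
          rcases Finset.mem_insert.1 (hs v a (Finset.mem_insert_self _ _) hv) with rfl | h'
          · exact absurd hv (lt_irrefl _)
          · exact h'
        · intro hv
          exact lt_of_le_of_ne (hmax v hv) fun e => ha (sortKey_injective x e ▸ hv)
      have hxa : ∀ q ∈ s, x a ≤ x q := by
        intro q hq
        rw [← hb] at hq
        simp only [before, Finset.mem_filter, Finset.mem_univ, true_and] at hq
        rcases hq with h' | h'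
        · exact h'.le
        · exact not_lt.1 h'.1
      have h₁ := ih (fun v w hw hvw => by
        rcases Finset.mem_insert.1 (hs v w (Finset.mem_insert_of_mem hw) hvw) with rfl | h'
        · exact absurd hvw (not_lt.2 (hmax w hw))
        · exact h') (x a) (hx₁ a) hxa
      rw [Finset.sum_insert ha, before_one, hb]
      have h₂ := mul_le_mul_of_nonneg_right (hcx a (Finset.mem_insert_self _ _))
        (sub_nonneg.2 (hm (insert a s)))
      nlinarith
  have := key Finset.univ (fun v _ _ _ => Finset.mem_univ v) 0 zero_le_one (fun q _ => hx₀ q)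
  linarith

/-- The marginal vector of an order lies in the base polytope of a submodular function. -/
theorem sum_marginal_le (h : Finset (Fin n) → ℝ)
    (hsub : ∀ A B, h (A ∪ B) + h (A ∩ B) ≤ h A + h B) (x : Fin n → ℝ) (S : Finset (Fin n)) :
    ∑ q ∈ S, (h (before x q 1) - h (before x q 0)) ≤ h S - h ∅ := by
  induction S using Finset.induction_on_max_value (sortKey x) with
  | empty => simp
  | insert a s ha hmax ih =>
    have hs : s ⊆ before x a 0 := fun v hv =>
      mem_before_zero.2 (lt_of_le_of_ne (hmax v hv) fun e => ha (sortKey_injective x e ▸ hv))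
    have h₁ := hsub (insert a s) (before x a 0)
    have e₁ : insert a s ∪ before x a 0 = before x a 1 := by
      rw [before_one, Finset.insert_union, Finset.union_eq_right.2 hs]
    have e₂ : insert a s ∩ before x a 0 = s := by
      rw [Finset.insert_inter_of_notMem (notMem_before_zero x a), Finset.inter_eq_left.2 hs]
    rw [e₁, e₂] at h₁
    rw [Finset.sum_insert ha]
    linarith

/-! ### Ring families and the truncated extension -/

/-- `R` contains `C`, and each element of `R` outside `C` is alive and comes with the set that it
is known to force. -/
def Feasible (A : Fin n → Finset (Fin n)) (dead C R : Finset (Fin n)) : Prop :=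
  C ⊆ R ∧ ∀ v ∈ R, v ∉ C → v ∉ dead ∧ A v ⊆ R

/-- The largest feasible subset of `S ∪ C`. -/
noncomputable def core (A : Fin n → Finset (Fin n)) (dead C S : Finset (Fin n)) :
    Finset (Fin n) := by
  classical
  exact (Finset.univ.filter fun R => Feasible A dead C R ∧ R ⊆ S ∪ C).biUnion id

section Core

variable {A : Fin n → Finset (Fin n)} {dead C : Finset (Fin n)}

theorem Feasible.self : Feasible A dead C C :=
  ⟨subset_rfl, fun _ h h' => absurd h h'⟩

theorem Feasible.union {R R' : Finset (Fin n)} (h : Feasible A dead C R)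
    (h' : Feasible A dead C R') : Feasible A dead C (R ∪ R') := by
  refine ⟨h.1.trans Finset.subset_union_left, fun v hv hvC => ?_⟩
  rcases Finset.mem_union.1 hv with hv | hv
  · exact ⟨(h.2 v hv hvC).1, (h.2 v hv hvC).2.trans Finset.subset_union_left⟩
  · exact ⟨(h'.2 v hv hvC).1, (h'.2 v hv hvC).2.trans Finset.subset_union_right⟩

theorem Feasible.inter {R R' : Finset (Fin n)} (h : Feasible A dead C R)
    (h' : Feasible A dead C R') : Feasible A dead C (R ∩ R') := by
  refine ⟨Finset.subset_inter h.1 h'.1, fun v hv hvC => ?_⟩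
  rw [Finset.mem_inter] at hv
  exact ⟨(h.2 v hv.1 hvC).1, Finset.subset_inter (h.2 v hv.1 hvC).2 (h'.2 v hv.2 hvC).2⟩

theorem subset_core {S R : Finset (Fin n)} (h : Feasible A dead C R) (hR : R ⊆ S ∪ C) :
    R ⊆ core A dead C S := by
  intro v hv
  simp only [core, Finset.mem_biUnion, Finset.mem_filter, Finset.mem_univ, true_and, id]
  exact ⟨R, ⟨h, hR⟩, hv⟩

theorem core_subset (S : Finset (Fin n)) : core A dead C S ⊆ S ∪ C := by
  intro v hv
  simp only [core, Finset.mem_biUnion, Finset.mem_filter, Finset.mem_univ, true_and, id] at hv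
  obtain ⟨R, hR, hv⟩ := hv
  exact hR.2 hv

theorem core_feasible (S : Finset (Fin n)) : Feasible A dead C (core A dead C S) := by
  refine ⟨subset_core .self Finset.subset_union_right, fun v hv hvC => ?_⟩
  simp only [core, Finset.mem_biUnion, Finset.mem_filter, Finset.mem_univ, true_and, id] at hv
  obtain ⟨R, hR, hv⟩ := hv
  exact ⟨(hR.1.2 v hv hvC).1, (hR.1.2 v hv hvC).2.trans (subset_core hR.1 hR.2)⟩

theorem core_mono {S S' : Finset (Fin n)} (h : S ⊆ S') : core A dead C S ⊆ core A dead C S' :=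
  subset_core (core_feasible S) ((core_subset S).trans (Finset.union_subset_union_left h))

theorem core_empty : core A dead C ∅ = C :=
  Finset.Subset.antisymm (by simpa using core_subset (A := A) (dead := dead) (C := C) ∅)
    (core_feasible ∅).1

variable {f : Finset (Fin n) → ℝ} {φ : ℝ}

/-- Adding elements to reach a feasible set costs at most `φ` for each of them, although a single
marginal value of `f` may be much larger. -/
theorem Feasible.le_add_card (hf : Submodular f) (hA : ∀ v, v ∈ A v)
    (hφ : ∀ v, v ∉ dead → f (A v) ≤ minValue f + φ) (hφ₀ : 0 ≤ φ) {R R' : Finset (Fin n)}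
    (hC : C ⊆ R) (hR' : Feasible A dead C R') (hRR' : R ⊆ R') :
    f R' ≤ f R + φ * (R'.card - R.card) := by
  obtain ⟨d, hd⟩ : ∃ d, (R' \ R).card = d := ⟨_, rfl⟩
  induction d using Nat.strong_induction_on generalizing R with
  | _ d ih =>
    by_cases he : R' ⊆ R
    · rw [Finset.Subset.antisymm hRR' he]; simp
    · obtain ⟨v, hv, hvR⟩ := Finset.not_subset.1 he
      have hv' := hR'.2 v hv fun h => hvR (hC h)
      have hsub : R ∪ A v ⊆ R' := Finset.union_subset hRR' hv'.2
      have hlt : (R' \ (R ∪ A v)).card < d := by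
        rw [← hd]
        apply Finset.card_lt_card
        refine ⟨Finset.sdiff_subset_sdiff subset_rfl Finset.subset_union_left, fun h => ?_⟩
        have := h (Finset.mem_sdiff.2 ⟨hv, hvR⟩)
        simp [hA v] at this
      have h₁ := ih _ hlt (hC.trans Finset.subset_union_left) hsub rfl
      have h₂ := hf.union_add_inter_le R (A v)
      have h₃ := minValue_le f (R ∩ A v)
      have h₄ := hφ v hv'.1
      have h₅ : R.card + 1 ≤ (R ∪ A v).card := by
        rw [← Finset.card_insert_of_notMem hvR]
        exact Finset.card_le_card (Finset.insert_subset
          (Finset.mem_union_right _ (hA v)) Finset.subset_union_left)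
      have h₆ : (R.card : ℝ) + 1 ≤ (R ∪ A v).card := by exact_mod_cast h₅
      nlinarith

/-- The truncation of `f (C ∪ ·)` along the ring family of feasible sets: an element that cannot
be used costs `φ`. -/
noncomputable def ringExt (f : Finset (Fin n) → ℝ) (φ : ℝ) (A : Fin n → Finset (Fin n))
    (dead C S : Finset (Fin n)) : ℝ :=
  f (core A dead C S) + φ * ((S ∪ C).card - (core A dead C S).card)

theorem ringExt_le (hf : Submodular f) (hA : ∀ v, v ∈ A v)
    (hφ : ∀ v, v ∉ dead → f (A v) ≤ minValue f + φ) (hφ₀ : 0 ≤ φ) {S R : Finset (Fin n)}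
    (hR : Feasible A dead C R) (hRS : R ⊆ S ∪ C) :
    ringExt f φ A dead C S ≤ f R + φ * ((S ∪ C).card - R.card) := by
  have := Feasible.le_add_card hf hA hφ hφ₀ hR.1 (core_feasible S) (subset_core hR hRS)
  unfold ringExt
  nlinarith

theorem minValue_le_ringExt (hφ₀ : 0 ≤ φ) (S : Finset (Fin n)) :
    minValue f ≤ ringExt f φ A dead C S := by
  have h₁ := minValue_le f (core A dead C S)
  have h₂ : ((core A dead C S).card : ℝ) ≤ (S ∪ C).card := by
    exact_mod_cast Finset.card_le_card (core_subset S)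
  have := mul_nonneg hφ₀ (sub_nonneg.2 h₂)
  unfold ringExt
  linarith

theorem ringExt_empty : ringExt f φ A dead C ∅ = f C := by
  simp [ringExt, core_empty]

theorem ringExt_submodular (hf : Submodular f) (hA : ∀ v, v ∈ A v)
    (hφ : ∀ v, v ∉ dead → f (A v) ≤ minValue f + φ) (hφ₀ : 0 ≤ φ) (S S' : Finset (Fin n)) :
    ringExt f φ A dead C (S ∪ S') + ringExt f φ A dead C (S ∩ S') ≤
      ringExt f φ A dead C S + ringExt f φ A dead C S' := by
  have hS := core_subset (A := A) (dead := dead) (C := C) S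
  have hS' := core_subset (A := A) (dead := dead) (C := C) S'
  have e₁ : (S ∪ S') ∪ C = (S ∪ C) ∪ (S' ∪ C) := by
    ext v; simp only [Finset.mem_union]; tauto
  have e₂ : (S ∩ S') ∪ C = (S ∪ C) ∩ (S' ∪ C) := by
    ext v; simp only [Finset.mem_union, Finset.mem_inter]; tauto
  have h₁ := ringExt_le hf hA hφ hφ₀ (S := S ∪ S') ((core_feasible S).union (core_feasible S'))
    (by rw [e₁]; exact Finset.union_subset_union hS hS')
  have h₂ := ringExt_le hf hA hφ hφ₀ (S := S ∩ S') ((core_feasible S).inter (core_feasible S'))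
    (by rw [e₂]; exact Finset.inter_subset_inter hS hS')
  have h₃ := hf.union_add_inter_le (core A dead C S) (core A dead C S')
  have c₁ : (((S ∪ C) ∪ (S' ∪ C)).card : ℝ) + ((S ∪ C) ∩ (S' ∪ C)).card =
      (S ∪ C).card + (S' ∪ C).card := by exact_mod_cast Finset.card_union_add_card_inter _ _
  have c₂ : ((core A dead C S ∪ core A dead C S').card : ℝ) +
      (core A dead C S ∩ core A dead C S').card =
      (core A dead C S).card + (core A dead C S').card := by
    exact_mod_cast Finset.card_union_add_card_inter _ _
  rw [e₁] at h₁
  rw [e₂] at h₂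
  have c₃ := congrArg (φ * ·) c₁
  have c₄ := congrArg (φ * ·) c₂
  simp only [mul_add] at c₃ c₄
  unfold ringExt at *
  linarith

end Core

/-! ### Multiplicative weights -/

/-- Multiplicative weights without normalization: the weights are only capped at `1`.  The regret
against the indicator of `u` is controlled by the potential `∑ x - ∑_{q ∈ u} log x`, and no bound
on the total weight is needed. -/
theorem regret_le (x z : ℕ → Fin n → ℝ) (u : Finset (Fin n)) (c : ℝ) (hc : c ≤ 1 / 2)
    (hstep : ∀ t q, x (t + 1) q = min 1 (x t q * (1 - z t q))) (hx₀ : ∀ q, 0 ≤ x 0 q)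
    (hu : ∀ q ∈ u, 0 < x 0 q) (hz : ∀ t, (∀ q, 0 ≤ x t q) → ∀ q, |z t q| ≤ c) (T : ℕ) :
    ((∀ q, 0 ≤ x T q) ∧ ∀ q ∈ u, 0 < x T q) ∧
    ∑ t ∈ Finset.range T, ∑ q, x t q * z t q ≤
      (∑ q, x 0 q - ∑ q ∈ u, Real.log (x 0 q)) - (∑ q, x T q - ∑ q ∈ u, Real.log (x T q)) +
        ∑ q ∈ u, ∑ t ∈ Finset.range T, z t q + u.card * (T * (2 * c ^ 2)) := by
  induction T with
  | zero => exact ⟨⟨hx₀, hu⟩, by simp⟩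
  | succ T ih =>
    obtain ⟨⟨h₀, h₁⟩, ih⟩ := ih
    have hzT := hz T h₀
    have hz2 : ∀ q, z T q ≤ 1 / 2 := fun q => (abs_le.1 (hzT q)).2.trans hc
    have hpos : ∀ q, (0 : ℝ) < 1 - z T q := fun q => by linarith [hz2 q]
    refine ⟨⟨fun q => ?_, fun q hq => ?_⟩, ?_⟩
    · rw [hstep]; exact le_min zero_le_one (mul_nonneg (h₀ q) (hpos q).le)
    · rw [hstep]; exact lt_min zero_lt_one (mul_pos (h₁ q hq) (hpos q))
    · -- `y - log y` and `y` both do not increase when `y` is capped at `1`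
      have hq : ∀ q, x (T + 1) q - (if q ∈ u then Real.log (x (T + 1) q) else 0) ≤
          x T q - (if q ∈ u then Real.log (x T q) else 0) - x T q * z T q +
            (if q ∈ u then z T q + 2 * c ^ 2 else 0) := by
        intro q
        rw [hstep]
        split_ifs with hqu
        · set y := x T q * (1 - z T q) with hy
          have hy0 : 0 < y := mul_pos (h₁ q hqu) (hpos q)
          have hcap : min 1 y - Real.log (min 1 y) ≤ y - Real.log y := by
            rcases le_total 1 y with h | h
            · rw [min_eq_left h, Real.log_one]
              linarith [Real.log_le_sub_one_of_pos hy0]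
            · rw [min_eq_right h]
          have hlog : Real.log y = Real.log (x T q) + Real.log (1 - z T q) :=
            Real.log_mul (h₁ q hqu).ne' (hpos q).ne'
          have hl : - (z T q + 2 * c ^ 2) ≤ Real.log (1 - z T q) := by
            have h2 : z T q ^ 2 ≤ c ^ 2 := sq_le_sq' (abs_le.1 (hzT q)).1 (abs_le.1 (hzT q)).2
            have h3 := Real.one_sub_inv_le_log_of_pos (hpos q)
            have h4 : (1 - z T q)⁻¹ ≤ 1 + z T q + 2 * z T q ^ 2 := by
              rw [inv_le_iff_one_le_mul₀ (hpos q)]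
              nlinarith [mul_nonneg (sq_nonneg (z T q)) (sub_nonneg.2 (hz2 q))]
            linarith
          linarith [mul_sub (x T q) 1 (z T q)]
        · have : min 1 (x T q * (1 - z T q)) ≤ x T q * (1 - z T q) := min_le_right _ _
          linarith [mul_sub (x T q) 1 (z T q)]
      have hsum := Finset.sum_le_sum fun q (_ : q ∈ Finset.univ) => hq q
      simp only [Finset.sum_add_distrib, Finset.sum_sub_distrib, Finset.sum_ite_mem,
        Finset.univ_inter, Finset.sum_const, nsmul_eq_mul] at hsum
      rw [Finset.sum_range_succ]
      simp only [Finset.sum_range_succ, Finset.sum_add_distrib]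
      push_cast
      linarith

/-- The data that stay fixed during one phase: the function, the scale `φ`, the sparsity `K`, for
each element `v` the set `base v` that is known to be contained in a fixed sparse minimizer if `v`
is, and the set of the elements that are known not to be in that minimizer. -/
structure Phase (n : ℕ) where
  f : Finset (Fin n) → ℝ
  φ : ℝ
  K : ℕ
  base : Fin n → Finset (Fin n)
  dead : Finset (Fin n)

namespace Phase

variable (P : Phase n) (C : Finset (Fin n))

/-- The entry at `q` of the Lovász subgradient at `x` of the truncated extension of
`f (C ∪ ·)`. -/
noncomputable def grad (x : Fin n → ℝ) (q : Fin n) : ℝ :=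
  P.f (core P.base P.dead C (before x q 1)) - P.f (core P.base P.dead C (before x q 0)) +
    P.φ * (1 - ((core P.base P.dead C (before x q 1)).card -
      (core P.base P.dead C (before x q 0)).card))

/-- The subgradient entry, truncated below at `-3Kφ` and multiplied by the step size
`1 / (288 K ^ 4 φ)`. -/
noncomputable def step (x : Fin n → ℝ) (q : Fin n) : ℝ :=
  max (P.grad C x q) (-(3 * P.K * P.φ)) / (288 * P.K ^ 4 * P.φ)

/-- The iterates of multiplicative weights for the function `f (C ∪ ·)`.  The weights of the
elements of `C` stay `0`. -/
noncomputable def weight : ℕ → Fin n → ℝ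
  | 0 => fun q => if q ∈ C then 0 else 1 / n
  | t + 1 => fun q => min 1 (weight t q * (1 - P.step C (weight t) q))

/-- The sum of the first `T` scaled subgradients. -/
noncomputable def total (T : ℕ) (q : Fin n) : ℝ :=
  ∑ t ∈ Finset.range T, P.step C (P.weight C t) q

/-- The facts about a phase that the analysis uses, for a fixed minimizer `S`. -/
structure Valid (S : Finset (Fin n)) : Prop where
  submodular : Submodular P.f
  pos : 0 < P.φ
  one_le : 1 ≤ P.K
  card_le : S.card ≤ P.K
  min : P.f S = minValue P.f
  mem_base : ∀ v, v ∈ P.base v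
  base_le : ∀ v, v ∉ P.dead → P.f (P.base v) ≤ minValue P.f + P.φ
  forced : ∀ v ∈ S, v ∉ P.dead ∧ P.base v ⊆ S

variable {P C} {S : Finset (Fin n)}

theorem Valid.feasible (h : P.Valid S) (hC : C ⊆ S) : Feasible P.base P.dead C S :=
  ⟨hC, fun v hv _ => h.forced v hv⟩

theorem Valid.grad_le (h : P.Valid S) (x : Fin n → ℝ) (q : Fin n) : P.grad C x q ≤ P.φ := by
  have hsub : before x q 0 ⊆ before x q 1 := by rw [before_one]; exact Finset.subset_insert _ _
  have := Feasible.le_add_card h.submodular h.mem_base h.base_le h.pos.le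
    (core_feasible (C := C) (before x q 0)).1 (core_feasible (before x q 1)) (core_mono hsub)
  unfold grad
  linarith

theorem Valid.abs_step_le (h : P.Valid S) (x : Fin n → ℝ) (q : Fin n) :
    |P.step C x q| ≤ 1 / (96 * P.K ^ 3) := by
  have hK : (1 : ℝ) ≤ P.K := by exact_mod_cast h.one_le
  have hφ := h.pos
  have hg := h.grad_le (C := C) x q
  have hden : (0 : ℝ) < 288 * P.K ^ 4 * P.φ := by positivity
  have e : 1 / (96 * (P.K : ℝ) ^ 3) = 3 * P.K * P.φ / (288 * P.K ^ 4 * P.φ) := by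
    field_simp; norm_num
  rw [step, abs_div, abs_of_pos hden, e]
  refine div_le_div_of_nonneg_right (abs_le.2 ⟨le_max_right _ _, max_le ?_ ?_⟩) hden.le <;>
    nlinarith

/-- Outside `C`, the entries of `grad` are marginal values of `ringExt`. -/
theorem grad_eq (x : Fin n → ℝ) {q : Fin n} (hq : q ∉ C) :
    P.grad C x q = ringExt P.f P.φ P.base P.dead C (before x q 1) -
      ringExt P.f P.φ P.base P.dead C (before x q 0) := by
  have : ((before x q 1 ∪ C).card : ℝ) = (before x q 0 ∪ C).card + 1 := by
    rw [before_one, Finset.insert_union, Finset.card_insert_of_notMem]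
    · push_cast; rfl
    · simp [hq, notMem_before_zero]
  unfold grad ringExt
  rw [this]
  ring

/-- The Lovász extension is an average of values, hence at least the minimum, and truncation only
increases the entries. -/
theorem Valid.le_sum_mul_step (h : P.Valid S) (x : Fin n → ℝ) (hx₀ : ∀ q, 0 ≤ x q)
    (hx₁ : ∀ q, x q ≤ 1) (hxC : ∀ q ∈ C, x q = 0) :
    (minValue P.f - P.f C) / (288 * P.K ^ 4 * P.φ) ≤ ∑ q, x q * P.step C x q := by
  have hφ := h.pos
  have := sum_mul_marginal_ge (ringExt P.f P.φ P.base P.dead C) x hx₀ hx₁ (minValue P.f)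
    (minValue_le_ringExt h.pos.le)
  rw [ringExt_empty] at this
  have hden : (0 : ℝ) ≤ 288 * P.K ^ 4 * P.φ := by positivity
  simp only [step, mul_div_assoc']
  rw [← Finset.sum_div]
  refine div_le_div_of_nonneg_right (this.trans (Finset.sum_le_sum fun q _ => ?_)) hden
  by_cases hq : q ∈ C
  · simp [hxC q hq]
  · rw [← grad_eq x hq]
    exact mul_le_mul_of_nonneg_left (le_max_left _ _) (hx₀ q)

/-- On the minimizer the truncation of the subgradient does no harm: if an entry is
truncated, the remaining ones contribute at most `Kφ`. -/
theorem Valid.sum_step_le (h : P.Valid S) (hC : C ⊆ S)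
    (hfC : P.f C ≤ minValue P.f + (P.K + 1) * P.φ) (x : Fin n → ℝ) :
    ∑ q ∈ S \ C, P.step C x q ≤ (minValue P.f - P.f C) / (288 * P.K ^ 4 * P.φ) := by
  have hφ := h.pos
  have hK : (1 : ℝ) ≤ P.K := by exact_mod_cast h.one_le
  have hden : (0 : ℝ) ≤ 288 * P.K ^ 4 * P.φ := by positivity
  simp only [step]
  rw [← Finset.sum_div]
  refine div_le_div_of_nonneg_right ?_ hden
  have hle : ∀ U ⊆ S \ C, ∑ q ∈ U, P.grad C x q ≤
      ringExt P.f P.φ P.base P.dead C U - P.f C := by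
    intro U hU
    have := sum_marginal_le _
      (ringExt_submodular (C := C) h.submodular h.mem_base h.base_le hφ.le) x U
    rw [ringExt_empty] at this
    rwa [Finset.sum_congr rfl fun q hq => grad_eq x (Finset.mem_sdiff.1 (hU hq)).2]
  set N := (S \ C).filter fun q => P.grad C x q < -(3 * P.K * P.φ) with hN
  have hsplit := Finset.sum_filter_add_sum_filter_not (S \ C)
    (fun q => P.grad C x q < -(3 * P.K * P.φ)) fun q => max (P.grad C x q) (-(3 * P.K * P.φ))
  rw [← hsplit, ← hN]
  set U := (S \ C).filter fun q => ¬ P.grad C x q < -(3 * P.K * P.φ) with hU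
  have h₁ : ∑ q ∈ N, max (P.grad C x q) (-(3 * P.K * P.φ)) = N.card * (-(3 * P.K * P.φ)) := by
    rw [Finset.sum_congr rfl fun q hq => max_eq_right (Finset.mem_filter.1 hq).2.le]
    simp
  have h₂ : ∑ q ∈ U, max (P.grad C x q) (-(3 * P.K * P.φ)) = ∑ q ∈ U, P.grad C x q :=
    Finset.sum_congr rfl fun q hq => max_eq_left (not_lt.1 (Finset.mem_filter.1 hq).2)
  rw [h₁, h₂]
  have h₃ := hle U (Finset.filter_subset _ _)
  rcases Finset.eq_empty_or_nonempty N with he | hne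
  · have hUS : U = S \ C := by
      rw [hU, Finset.filter_eq_self]
      intro q hq hq'
      have : q ∈ N := Finset.mem_filter.2 ⟨hq, hq'⟩
      simp [he] at this
    have h₄ := ringExt_le (f := P.f) (S := S \ C) h.submodular h.mem_base h.base_le hφ.le
      (h.feasible hC) (by simp)
    rw [Finset.sdiff_union_of_subset hC, h.min] at h₄
    rw [hUS] at h₃
    rw [he, hUS, Finset.card_empty, Nat.cast_zero, zero_mul]
    linarith
  · have hc : (1 : ℝ) ≤ N.card := by exact_mod_cast hne.card_pos
    have h₄ := ringExt_le (f := P.f) (S := U) (C := C) h.submodular h.mem_base h.base_le hφ.le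
      .self Finset.subset_union_right
    have h₅ : ((U ∪ C).card : ℝ) ≤ U.card + C.card := by exact_mod_cast Finset.card_union_le _ _
    have h₆ : (U.card : ℝ) ≤ P.K := by
      exact_mod_cast (Finset.card_le_card
        ((Finset.filter_subset _ _).trans Finset.sdiff_subset)).trans h.card_le
    have h₇ : P.φ * ((U ∪ C).card - C.card) ≤ P.φ * P.K :=
      mul_le_mul_of_nonneg_left (by linarith) hφ.le
    have h₈ : (3 * P.K * P.φ) ≤ N.card * (3 * P.K * P.φ) :=
      le_mul_of_one_le_left (by positivity) hc
    nlinarith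

/-- The number of steps of multiplicative weights.  With step size `1 / (288 K ^ 4 φ)` the scaled
entries are at most `1 / (96 K ^ 3)`, so that over this number of steps the quadratic term of the
regret adds up to `3 Λ / 2` for each element of the comparator, comparable to the initial term
`log n`; and an average subgradient sum of `-φ / 4` accumulates to `-6 K ^ 2 Λ`. -/
def steps (K Λ : ℕ) : ℕ := 6912 * K ^ 6 * Λ

variable {Λ : ℕ}

/-- The regret bound for comparators with at most `K + 1` elements. -/
theorem Valid.le_sum_total (h : P.Valid S) (hn : 1 ≤ n) (hΛ : Real.log n + 1 ≤ Λ)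
    {u : Finset (Fin n)} (hu : u.card ≤ P.K + 1) (huC : ∀ q ∈ u, q ∉ C) :
    steps P.K Λ * ((minValue P.f - P.f C) / (288 * P.K ^ 4 * P.φ)) - 6 * P.K * Λ ≤
      ∑ q ∈ u, P.total C (steps P.K Λ) q := by
  have hK : (1 : ℝ) ≤ P.K := by exact_mod_cast h.one_le
  have hn' : (1 : ℝ) ≤ n := by exact_mod_cast hn
  have hu' : (u.card : ℝ) ≤ P.K + 1 := by exact_mod_cast hu
  set T := steps P.K Λ with hT
  have hlogn : 0 ≤ Real.log n := Real.log_nonneg hn'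
  have hc : 1 / (96 * (P.K : ℝ) ^ 3) ≤ 1 / 2 := by
    apply one_div_le_one_div_of_le two_pos
    have := one_le_pow₀ hK (n := 3)
    linarith
  have hx₀ : ∀ q, 0 ≤ P.weight C 0 q := by
    intro q; simp only [weight]; split_ifs <;> positivity
  have hx₁ : ∀ t q, P.weight C t q ≤ 1 := by
    intro t q
    cases t with
    | zero =>
      simp only [weight]
      split_ifs
      · exact zero_le_one
      · exact (div_le_one (by linarith)).2 hn'
    | succ t => exact min_le_left _ _
  have hxC : ∀ t, ∀ q ∈ C, P.weight C t q = 0 := by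
    intro t
    induction t with
    | zero => intro q hq; simp [weight, hq]
    | succ t ih => intro q hq; simp [weight, ih q hq]
  have hreg := regret_le (P.weight C) (fun t => P.step C (P.weight C t)) u _ hc
    (fun t q => rfl) hx₀ (fun q hq => by simp only [weight, huC q hq, if_false]; positivity)
    (fun t _ q => h.abs_step_le _ q)
  have h₁ : (T : ℝ) * ((minValue P.f - P.f C) / (288 * P.K ^ 4 * P.φ)) ≤
      ∑ t ∈ Finset.range T, ∑ q, P.weight C t q * P.step C (P.weight C t) q := by
    rw [← nsmul_eq_mul, ← Finset.card_range T, ← Finset.sum_const, Finset.card_range]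
    exact Finset.sum_le_sum fun t _ =>
      h.le_sum_mul_step _ (hreg t).1.1 (hx₁ t) (hxC t)
  have h₂ := (hreg T).2
  have h₃ : ∑ q, P.weight C 0 q ≤ 1 := by
    have : ∀ q ∈ Finset.univ, P.weight C 0 q ≤ 1 / n := by
      intro q _; simp only [weight]; split_ifs
      · positivity
      · exact le_rfl
    refine (Finset.sum_le_card_nsmul _ _ _ this).trans ?_
    rw [Finset.card_univ, Fintype.card_fin, nsmul_eq_mul]
    field_simp
    exact le_rfl
  have h₄ : ∑ q ∈ u, Real.log (P.weight C 0 q) = -(u.card * Real.log n) := by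
    rw [Finset.sum_congr rfl fun q hq => by
      rw [show P.weight C 0 q = 1 / n by simp [weight, huC q hq], one_div, Real.log_inv]]
    simp
  have h₅ : 0 ≤ ∑ q, P.weight C T q - ∑ q ∈ u, Real.log (P.weight C T q) := by
    have a₁ : ∑ q ∈ u, Real.log (P.weight C T q) ≤ 0 := Finset.sum_nonpos fun q hq =>
      Real.log_nonpos ((hreg T).1.1 q) (hx₁ T q)
    have a₂ : 0 ≤ ∑ q, P.weight C T q := Finset.sum_nonneg fun q _ => (hreg T).1.1 q
    linarith
  have h₆ : (T : ℝ) * (2 * (1 / (96 * (P.K : ℝ) ^ 3)) ^ 2) = 3 / 2 * Λ := by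
    rw [hT, steps]; push_cast; field_simp; ring
  rw [h₆, h₄] at h₂
  have h₇ : (u.card : ℝ) * (Real.log n + 3 / 2 * Λ) ≤ 2 * P.K * (5 / 2 * Λ - 1) := by
    have : (0 : ℝ) ≤ Λ := Nat.cast_nonneg _
    refine mul_le_mul (by linarith) (by linarith) (by positivity) (by positivity)
  have h₈ : (1 : ℝ) ≤ P.K * Λ := by nlinarith
  simp only [total]
  nlinarith

/-- On the minimizer, the totals add up to at most what one step yields, times their number. -/
theorem Valid.sum_total_le (h : P.Valid S) (hC : C ⊆ S)
    (hfC : P.f C ≤ minValue P.f + (P.K + 1) * P.φ) (T : ℕ) :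
    ∑ q ∈ S \ C, P.total C T q ≤
      T * ((minValue P.f - P.f C) / (288 * P.K ^ 4 * P.φ)) := by
  simp only [total]
  rw [Finset.sum_comm]
  refine (Finset.sum_le_card_nsmul _ _ _ fun t _ => h.sum_step_le hC hfC _).trans_eq ?_
  simp

/-- An element with a very negative total belongs to the minimizer. -/
theorem Valid.mem_of_total_lt (h : P.Valid S) (hn : 1 ≤ n) (hΛ : Real.log n + 1 ≤ Λ)
    (hC : C ⊆ S) (hfC : P.f C ≤ minValue P.f + (P.K + 1) * P.φ) {q : Fin n} (hq : q ∉ C)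
    (hlt : P.total C (steps P.K Λ) q < -(6 * P.K * Λ)) : q ∈ S := by
  by_contra hqS
  have hq' : q ∉ S \ C := fun h' => hqS (Finset.mem_sdiff.1 h').1
  have h₁ := h.le_sum_total (C := C) (u := insert q (S \ C)) hn hΛ
    (by
      rw [Finset.card_insert_of_notMem hq']
      have := (Finset.card_le_card (Finset.sdiff_subset (s := S) (t := C))).trans h.card_le
      omega)
    (by
      intro v hv
      rcases Finset.mem_insert.1 hv with rfl | hv
      · exact hq
      · exact (Finset.mem_sdiff.1 hv).2)
  rw [Finset.sum_insert hq'] at h₁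
  have h₂ := h.sum_total_le hC hfC (steps P.K Λ)
  linarith

/-- If no total is very negative, then `C` is almost optimal. -/
theorem Valid.le_of_forall_total (h : P.Valid S) (hΛ : 0 < Λ)
    (hC : C ⊆ S) (hfC : P.f C ≤ minValue P.f + (P.K + 1) * P.φ)
    (hge : ∀ q, q ∉ C → -(6 * P.K * Λ) ≤ P.total C (steps P.K Λ) q) :
    P.f C ≤ minValue P.f + P.φ / 4 := by
  have hφ := h.pos
  have hK : (1 : ℝ) ≤ P.K := by exact_mod_cast h.one_le
  have hΛ' : (0 : ℝ) < Λ := by exact_mod_cast hΛ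
  have h₁ := h.sum_total_le hC hfC (steps P.K Λ)
  have h₂ := Finset.card_nsmul_le_sum (S \ C) _ _ fun q hq => hge q (Finset.mem_sdiff.1 hq).2
  have h₃ : ((S \ C).card : ℝ) ≤ P.K := by
    exact_mod_cast (Finset.card_le_card Finset.sdiff_subset).trans h.card_le
  rw [nsmul_eq_mul] at h₂
  have h₄ : ((S \ C).card : ℝ) * (6 * P.K * Λ) ≤ P.K * (6 * P.K * Λ) :=
    mul_le_mul_of_nonneg_right h₃ (by positivity)
  have e : (steps P.K Λ : ℝ) * ((minValue P.f - P.f C) / (288 * P.K ^ 4 * P.φ)) =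
      24 * P.K ^ 2 * Λ * ((minValue P.f - P.f C) / P.φ) := by
    rw [steps]; push_cast; field_simp; ring
  rw [e] at h₁
  have h₅ : (0 : ℝ) < 24 * P.K ^ 2 * Λ := by positivity
  have h₆ : -(1 / 4) ≤ (minValue P.f - P.f C) / P.φ := by
    by_contra hcon
    have := mul_lt_mul_of_pos_left (not_le.1 hcon) h₅
    nlinarith
  rw [le_div_iff₀ hφ] at h₆
  linarith

/-- One round: either no total is very negative and `C` is kept, or the base set of an element
with a very negative total is added. -/
def Round (P : Phase n) (Λ : ℕ) (C C' : Finset (Fin n)) : Prop :=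
  (C' = C ∧ ∀ q, q ∉ C → -(6 * P.K * Λ) ≤ P.total C (steps P.K Λ) q) ∨
    ∃ q, q ∉ C ∧ P.total C (steps P.K Λ) q < -(6 * P.K * Λ) ∧ C' = C ∪ P.base q

/-- `r` successive rounds. -/
def Rounds (P : Phase n) (Λ : ℕ) : ℕ → Finset (Fin n) → Finset (Fin n) → Prop
  | 0, C, C' => C' = C
  | r + 1, C, C' => ∃ D, Rounds P Λ r C D ∧ Round P Λ D C'

/-- After `K + 1` rounds, a set that started inside the minimizer is still inside and almost
optimal: it cannot have grown in every round, and once it is kept it is kept forever. -/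
theorem Valid.rounds (h : P.Valid S) (hn : 1 ≤ n) (hΛ : Real.log n + 1 ≤ Λ)
    (hC : C ⊆ S) (hfC : P.f C ≤ minValue P.f + P.φ) {C' : Finset (Fin n)}
    (hr : P.Rounds Λ (P.K + 1) C C') : C' ⊆ S ∧ P.f C' ≤ minValue P.f + P.φ / 4 := by
  have hφ := h.pos
  have hΛ0 : 0 < Λ := by
    have := Real.log_nonneg (show (1 : ℝ) ≤ n by exact_mod_cast hn)
    have : (0 : ℝ) < Λ := by linarith
    exact_mod_cast this
  have key : ∀ r ≤ P.K + 1, ∀ C', P.Rounds Λ r C C' → C' ⊆ S ∧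
      (((∀ q, q ∉ C' → -(6 * P.K * Λ : ℝ) ≤ P.total C' (steps P.K Λ) q) ∧
          P.f C' ≤ minValue P.f + P.φ / 4) ∨
        (r ≤ C'.card ∧ P.f C' ≤ minValue P.f + (r + 1) * P.φ)) := by
    intro r
    induction r with
    | zero =>
      rintro _ C' rfl
      exact ⟨hC, Or.inr ⟨Nat.zero_le _, by simpa using hfC⟩⟩
    | succ r ih =>
      rintro hrK C' ⟨D, hD, hround⟩
      obtain ⟨hDS, hcase⟩ := ih (by omega) D hD
      have hr' : (r : ℝ) ≤ P.K := by exact_mod_cast (by omega : r ≤ P.K)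
      have hK0 : (0 : ℝ) ≤ P.K := Nat.cast_nonneg _
      have hfD : P.f D ≤ minValue P.f + (P.K + 1) * P.φ := by
        rcases hcase with ⟨_, h'⟩ | ⟨_, h'⟩ <;> nlinarith
      rcases hround with ⟨rfl, hkeep⟩ | ⟨q, hqD, hlt, rfl⟩
      · exact ⟨hDS, Or.inl ⟨hkeep, h.le_of_forall_total hΛ0 hDS hfD hkeep⟩⟩
      · have hqS := h.mem_of_total_lt hn hΛ hDS hfD hqD hlt
        obtain ⟨hqd, hqb⟩ := h.forced q hqS
        refine ⟨Finset.union_subset hDS hqb, Or.inr ?_⟩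
        rcases hcase with ⟨hk, _⟩ | ⟨hcard, hval⟩
        · exact absurd hlt (not_lt.2 (hk q hqD))
        · constructor
          · have : (insert q D).card ≤ (D ∪ P.base q).card := Finset.card_le_card
              (Finset.insert_subset (Finset.mem_union_right _ (h.mem_base q))
                Finset.subset_union_left)
            rw [Finset.card_insert_of_notMem hqD] at this
            omega
          · have h₁ := h.submodular.union_add_inter_le D (P.base q)
            have h₂ := minValue_le P.f (D ∩ P.base q)
            have h₃ := h.base_le q hqd
            push_cast
            linarith
  obtain ⟨hS, ⟨_, h'⟩ | ⟨hcard, _⟩⟩ := key _ le_rfl _ hr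
  · exact ⟨hS, h'⟩
  · have := (Finset.card_le_card hS).trans h.card_le
    omega

end Phase

/-! ### A program logic for the machine -/

/-- Does the program contain an assignment to the natural number array `a`? -/
def Program.writesNat : Program → ℕ → Bool
  | .skip, _ => false
  | .setNat b _ _, a => a == b
  | .setReal _ _ _, _ => false
  | .seq p q, a => p.writesNat a || q.writesNat a
  | .cond _ p q, a => p.writesNat a || q.writesNat a
  | .loop _ p, a => p.writesNat a
  | .query _ _ _, _ => false

/-- Does the program contain an assignment to the real array `a`? -/
def Program.writesReal : Program → ℕ → Bool
  | .skip, _ => false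
  | .setNat _ _ _, _ => false
  | .setReal b _ _, a => a == b
  | .seq p q, a => p.writesReal a || q.writesReal a
  | .cond _ p q, a => p.writesReal a || q.writesReal a
  | .loop _ p, a => p.writesReal a
  | .query _ _ b, a => a == b

/-- The arrays that `P` does not write agree in `s` and `s'`. -/
def Frame (P : Program) (s s' : State) : Prop :=
  (∀ a, P.writesNat a = false → s'.nat a = s.nat a) ∧
    ∀ a, P.writesReal a = false → s'.real a = s.real a

theorem Frame.refl (P : Program) (s : State) : Frame P s s := ⟨fun _ _ => rfl, fun _ _ => rfl⟩

theorem Frame.trans {P : Program} {s s' s'' : State} (h : Frame P s s') (h' : Frame P s' s'') :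
    Frame P s s'' :=
  ⟨fun a ha => (h'.1 a ha).trans (h.1 a ha), fun a ha => (h'.2 a ha).trans (h.2 a ha)⟩

theorem Frame.of_le {P Q : Program} {s s' : State} (h : Frame P s s')
    (h₁ : ∀ a, Q.writesNat a = false → P.writesNat a = false)
    (h₂ : ∀ a, Q.writesReal a = false → P.writesReal a = false) : Frame Q s s' :=
  ⟨fun a ha => h.1 a (h₁ a ha), fun a ha => h.2 a (h₂ a ha)⟩

theorem Exec.frame {f : Finset (Fin n) → ℝ} {P : Program} {s s' : State} {c : Cost}
    (h : Exec f P s c s') : Frame P s s' := by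
  induction h with
  | skip s => exact .refl _ _
  | setNat s a i e =>
    refine ⟨fun b hb => ?_, fun b hb => rfl⟩
    simp only [Program.writesNat, beq_eq_false_iff_ne] at hb
    exact Function.update_of_ne hb _ _
  | setReal s a i e =>
    refine ⟨fun b hb => rfl, fun b hb => ?_⟩
    simp only [Program.writesReal, beq_eq_false_iff_ne] at hb
    exact Function.update_of_ne hb _ _
  | seq _ _ ih₁ ih₂ =>
    refine Frame.trans (ih₁.of_le ?_ ?_) (ih₂.of_le ?_ ?_) <;> intro a ha <;>
      simp only [Program.writesNat, Program.writesReal, Bool.or_eq_false_iff] at ha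
    exacts [ha.1, ha.1, ha.2, ha.2]
  | condTrue _ _ ih =>
    refine ih.of_le ?_ ?_ <;> intro a ha <;>
      simp only [Program.writesNat, Program.writesReal, Bool.or_eq_false_iff] at ha
    exacts [ha.1, ha.1]
  | condFalse _ _ ih =>
    refine ih.of_le ?_ ?_ <;> intro a ha <;>
      simp only [Program.writesNat, Program.writesReal, Bool.or_eq_false_iff] at ha
    exacts [ha.2, ha.2]
  | loopStop _ => exact .refl _ _
  | loopStep _ _ _ ih₁ ih₂ => exact (ih₁.of_le (fun _ h => h) fun _ h => h).trans ih₂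
  | query s m Q A =>
    refine ⟨fun b hb => rfl, fun b hb => ?_⟩
    simp only [Program.writesReal, beq_eq_false_iff_ne] at hb
    exact Function.update_of_ne hb _ _

/-- A bound on the number of steps of a run in which every loop makes at most `N` iterations, and
in which the number of queries in a round and `n + 1` are at most `N`. -/
def Program.bound (N : ℕ) : Program → ℕ
  | .skip => 1
  | .setNat _ i e => i.cost + e.cost + 1
  | .setReal _ i e => i.cost + e.cost + 1
  | .seq p q => p.bound N + q.bound N
  | .cond b p q => b.cost + 1 + p.bound N + q.bound N
  | .loop b p => N * (b.cost + 1 + p.bound N) + (b.cost + 1)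
  | .query m _ _ => m.cost + 1 + N * N

/-- The step bound is polynomial in `N`, with a degree that depends only on the program. -/
theorem Program.exists_bound_le (P : Program) :
    ∃ c d : ℕ, ∀ N, 1 ≤ N → P.bound N ≤ c * N ^ d := by
  have up : ∀ {N c d e x : ℕ}, 1 ≤ N → x ≤ c * N ^ d → d ≤ e → x ≤ c * N ^ e :=
    fun hN hx hde => hx.trans (Nat.mul_le_mul_left _ (Nat.pow_le_pow_right hN hde))
  induction P with
  | skip => exact ⟨1, 0, fun N _ => by simp [bound]⟩
  | setNat a i e => exact ⟨i.cost + e.cost + 1, 0, fun N _ => by simp [bound]⟩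
  | setReal a i e => exact ⟨i.cost + e.cost + 1, 0, fun N _ => by simp [bound]⟩
  | seq p q hp hq =>
    obtain ⟨c, d, hp⟩ := hp
    obtain ⟨c', d', hq⟩ := hq
    refine ⟨c + c', max d d', fun N hN => ?_⟩
    rw [bound, add_mul]
    exact add_le_add (up hN (hp N hN) (le_max_left _ _)) (up hN (hq N hN) (le_max_right _ _))
  | cond b p q hp hq =>
    obtain ⟨c, d, hp⟩ := hp
    obtain ⟨c', d', hq⟩ := hq
    refine ⟨b.cost + 1 + c + c', max d d', fun N hN => ?_⟩
    rw [bound, add_mul, add_mul]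
    exact add_le_add (add_le_add (Nat.le_mul_of_pos_right _ (pow_pos hN _))
      (up hN (hp N hN) (le_max_left _ _))) (up hN (hq N hN) (le_max_right _ _))
  | loop b p hp =>
    obtain ⟨c, d, hp⟩ := hp
    refine ⟨2 * (b.cost + 1) + c, d + 1, fun N hN => ?_⟩
    have h₁ : b.cost + 1 ≤ (b.cost + 1) * N ^ d := Nat.le_mul_of_pos_right _ (pow_pos hN _)
    have h₂ : b.cost + 1 ≤ (b.cost + 1) * N ^ (d + 1) :=
      Nat.le_mul_of_pos_right _ (pow_pos hN _)
    calc bound N (.loop b p) = N * (b.cost + 1 + p.bound N) + (b.cost + 1) := rfl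
      _ ≤ N * ((b.cost + 1) * N ^ d + c * N ^ d) + (b.cost + 1) * N ^ (d + 1) :=
        add_le_add (Nat.mul_le_mul_left _ (add_le_add h₁ (hp N hN))) h₂
      _ = (2 * (b.cost + 1) + c) * N ^ (d + 1) := by ring
  | query m Q A =>
    refine ⟨m.cost + 1 + 1, 2, fun N hN => ?_⟩
    rw [bound, add_mul, one_mul, sq]
    exact Nat.add_le_add_right (Nat.le_mul_of_pos_right _ (Nat.mul_pos hN hN)) _

/-- `Runs f N P s r Post`: from memory `s` the program `P` halts in a memory that satisfies
`Post`, with at most `P.bound N` steps and at most `r` rounds, each one of at most `2n(n + 1)`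
queries. -/
def Runs (f : Finset (Fin n) → ℝ) (N : ℕ) (P : Program) (s : State) (r : ℕ)
    (Post : State → Prop) : Prop :=
  ∃ c s', Exec f P s c s' ∧ Post s' ∧ c.steps ≤ P.bound N ∧ c.rounds.length ≤ r ∧
    ∀ m ∈ c.rounds, m ≤ 2 * n * (n + 1)

/-- `i` runs from `0` upwards as long as `b` holds. -/
def Program.for (i : ℕ) (b : BExp) (p : Program) : Program :=
  .seq (.setNat i (.lit 0) (.lit 0))
    (.loop b (.seq p (.setNat i (.lit 0) (.add (.get i (.lit 0)) (.lit 1)))))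

section Rules

variable {f : Finset (Fin n) → ℝ} {N : ℕ} {s : State} {r : ℕ} {Post : State → Prop}

/-- The postcondition may be strengthened by the frame condition. -/
theorem Runs.frame {P : Program} (h : Runs f N P s r Post) :
    Runs f N P s r fun s' => Post s' ∧ Frame P s s' := by
  obtain ⟨c, s', hE, hp, h⟩ := h
  exact ⟨c, s', hE, ⟨hp, hE.frame⟩, h⟩

theorem Runs.mono {P : Program} {r' : ℕ} {Post' : State → Prop} (h : Runs f N P s r Post)
    (hr : r ≤ r') (hp : ∀ s', Post s' → Post' s') : Runs f N P s r' Post' := by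
  obtain ⟨c, s', hE, hp', h₁, h₂, h₃⟩ := h
  exact ⟨c, s', hE, hp _ hp', h₁, h₂.trans hr, h₃⟩

/-- Weaken the postcondition, with the frame at hand. -/
theorem Runs.imp {P : Program} {Post' : State → Prop} (h : Runs f N P s r Post)
    (hp : ∀ s', Frame P s s' → Post s' → Post' s') : Runs f N P s r Post' :=
  h.frame.mono le_rfl fun s' h' => hp s' h'.2 h'.1

theorem Runs.skip (h : Post s) : Runs f N .skip s 0 Post :=
  ⟨_, _, .skip s, h, le_rfl, le_rfl, by simp [Cost.work]⟩

theorem Runs.setNat {a : ℕ} {i e : NExp} (h : Post (s.writeNat a (i.eval s) (e.eval s))) :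
    Runs f N (.setNat a i e) s 0 Post :=
  ⟨_, _, .setNat s a i e, h, le_rfl, le_rfl, by simp [Cost.work]⟩

theorem Runs.setReal {a : ℕ} {i : NExp} {e : RExp}
    (h : Post (s.writeReal a (i.eval s) (e.eval s))) : Runs f N (.setReal a i e) s 0 Post :=
  ⟨_, _, .setReal s a i e, h, le_rfl, le_rfl, by simp [Cost.work]⟩

theorem Runs.query {m : NExp} {Q A : ℕ} (hm : m.eval s ≤ 2 * n * (n + 1))
    (hn : 2 * n * (n + 1) ≤ N) (hn' : n + 1 ≤ N) (h : Post (s.answer f (m.eval s) Q A)) :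
    Runs f N (.query m Q A) s 1 Post :=
  ⟨_, _, .query s m Q A, h, Nat.add_le_add_left (Nat.mul_le_mul (hm.trans hn) hn') _, le_rfl,
    by simpa using hm⟩

theorem Runs.seq {p q : Program} {r₁ r₂ : ℕ}
    (h : Runs f N p s r₁ fun s' => Runs f N q s' r₂ Post) :
    Runs f N (.seq p q) s (r₁ + r₂) Post := by
  obtain ⟨c, s', hE, ⟨d, s'', hE', hp, h₁', h₂', h₃'⟩, h₁, h₂, h₃⟩ := h
  refine ⟨_, _, .seq hE hE', hp, add_le_add h₁ h₁', ?_, ?_⟩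
  · simpa [Cost.append] using add_le_add h₂ h₂'
  · intro m hm
    rcases List.mem_append.1 hm with hm | hm
    exacts [h₃ m hm, h₃' m hm]

/-- Sequencing after a program without queries. -/
theorem Runs.seq₀ {p q : Program} (h : Runs f N p s 0 fun s' => Runs f N q s' r Post) :
    Runs f N (.seq p q) s r Post :=
  (Runs.seq h).mono (by omega) fun _ h => h

theorem Runs.cond {b : BExp} {p q : Program} (h₁ : b.Holds s → Runs f N p s r Post)
    (h₂ : ¬ b.Holds s → Runs f N q s r Post) : Runs f N (.cond b p q) s r Post := by
  by_cases hb : b.Holds s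
  · obtain ⟨c, s', hE, hp, h₁, h₂, h₃⟩ := h₁ hb
    refine ⟨_, _, .condTrue hb hE, hp, ?_, ?_, ?_⟩
    · simp only [Cost.append, Cost.work, Program.bound]; omega
    · simpa [Cost.append, Cost.work] using h₂
    · simpa [Cost.append, Cost.work] using h₃
  · obtain ⟨c, s', hE, hp, h₁, h₂, h₃⟩ := h₂ hb
    refine ⟨_, _, .condFalse hb hE, hp, ?_, ?_, ?_⟩
    · simp only [Cost.append, Cost.work, Program.bound]; omega
    · simpa [Cost.append, Cost.work] using h₂
    · simpa [Cost.append, Cost.work] using h₃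

/-- A loop with an explicit number `M` of iterations, which need not be bounded by `N`. -/
theorem exec_loop {b : BExp} {p : Program} (I : ℕ → State → Prop) {M : ℕ} (h₀ : I 0 s)
    (hb : ∀ j s, j ≤ M → I j s → (b.Holds s ↔ j < M))
    (hp : ∀ j s, j < M → I j s → Runs f N p s r (I (j + 1))) :
    ∃ c s', Exec f (.loop b p) s c s' ∧ I M s' ∧
      c.steps ≤ M * (b.cost + 1 + p.bound N) + (b.cost + 1) ∧ c.rounds.length ≤ M * r ∧
      ∀ m ∈ c.rounds, m ≤ 2 * n * (n + 1) := by
  have key : ∀ d j s, j + d = M → I j s → ∃ c s', Exec f (.loop b p) s c s' ∧ I M s' ∧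
      c.steps ≤ d * (b.cost + 1 + p.bound N) + (b.cost + 1) ∧ c.rounds.length ≤ d * r ∧
      ∀ m ∈ c.rounds, m ≤ 2 * n * (n + 1) := by
    intro d
    induction d with
    | zero =>
      intro j s hj hI
      obtain rfl : j = M := by omega
      exact ⟨_, _, .loopStop (fun h => lt_irrefl _ ((hb j s le_rfl hI).1 h)), hI,
        by simp [Cost.work], by simp [Cost.work], by simp [Cost.work]⟩
    | succ d ih =>
      intro j s hj hI
      obtain ⟨c, s', hE, hp', h₁, h₂, h₃⟩ := hp j s (by omega) hI
      obtain ⟨c', s'', hE', hI', h₁', h₂', h₃'⟩ := ih (j + 1) s' (by omega) hp'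
      refine ⟨_, _, .loopStep ((hb j s (by omega) hI).2 (by omega)) hE hE', hI', ?_, ?_, ?_⟩
      · simp only [Cost.append, Cost.work, add_mul, one_mul] at h₁' ⊢
        omega
      · simp only [Cost.append, Cost.work, List.nil_append, List.length_append, add_mul, one_mul]
        omega
      · intro m hm
        simp only [Cost.append, Cost.work, List.nil_append, List.mem_append] at hm
        rcases hm with hm | hm
        exacts [h₃ m hm, h₃' m hm]
  exact key M 0 s (by omega) h₀

theorem Runs.loop {b : BExp} {p : Program} (I : ℕ → State → Prop) {M : ℕ} (hM : M ≤ N)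
    (h₀ : I 0 s) (hb : ∀ j s, j ≤ M → I j s → (b.Holds s ↔ j < M))
    (hp : ∀ j s, j < M → I j s → Runs f N p s r (I (j + 1))) :
    Runs f N (.loop b p) s (M * r) (I M) := by
  obtain ⟨c, s', hE, hI, h₁, h₂⟩ := exec_loop I h₀ hb hp
  exact ⟨c, s', hE, hI, h₁.trans (Nat.add_le_add_right (Nat.mul_le_mul_right _ hM) _), h₂⟩

/-- The rule for counting loops.  The invariant may not depend on the counter, and the body may use
that the arrays that are not written have not changed since the start of the loop. -/
theorem Runs.for {i : ℕ} {b : BExp} {p : Program} (I : ℕ → State → Prop) {M : ℕ} (hM : M ≤ N)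
    (hi : p.writesNat i = false) (hI : ∀ j s c, I j s → I j (s.writeNat i 0 c)) (h₀ : I 0 s)
    (hb : ∀ j s', Frame (.for i b p) s s' → s'.nat i 0 = j → (b.Holds s' ↔ j < M))
    (hp : ∀ j s', j < M → Frame (.for i b p) s s' → s'.nat i 0 = j → I j s' →
      Runs f N p s' r (I (j + 1))) :
    Runs f N (.for i b p) s (M * r) (I M) := by
  have hf : ∀ s' c, Frame (.for i b p) s s' → Frame (.for i b p) s (s'.writeNat i 0 c) := by
    refine fun s' c h => ⟨fun a ha => ?_, h.2⟩
    rw [← h.1 a ha]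
    refine Function.update_of_ne ?_ _ _
    rintro rfl
    simp [Program.for, Program.writesNat] at ha
  have hi' : ∀ (s : State) c, (s.writeNat i 0 c).nat i 0 = c := by
    intro s c; simp [State.writeNat]
  refine Runs.seq₀ (Runs.setNat ?_)
  refine (Runs.loop (fun j s' => Frame (.for i b p) s s' ∧ s'.nat i 0 = j ∧ I j s') hM
    ⟨hf _ _ (.refl _ _), hi' _ _, hI _ _ _ h₀⟩ (fun j s' _ h => hb j s' h.1 h.2.1) ?_).mono le_rfl
    fun s' h => h.2.2
  rintro j s' hj ⟨h₁, h₂, h₃⟩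
  have := (hp j s' hj h₁ h₂ h₃).imp (Post' := fun s'' => Runs f N
    (.setNat i (.lit 0) (.add (.get i (.lit 0)) (.lit 1))) s'' 0
      fun s' => Frame (.for i b p) s s' ∧ s'.nat i 0 = j + 1 ∧ I (j + 1) s') (by
    intro s'' hfr hI'
    have e : s''.nat i 0 = j := by rw [hfr.1 i hi, h₂]
    refine Runs.setNat ?_
    simp only [NExp.eval, e]
    refine ⟨hf _ _ (h₁.trans (hfr.of_le (fun a ha => ?_) fun a ha => ?_)), hi' _ _, hI _ _ _ hI'⟩ <;>
      simp only [Program.for, Program.writesNat, Program.writesReal, Bool.or_eq_false_iff] at ha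
    · exact ha.2.1
    · exact ha.2.1)
  exact Runs.seq this

theorem Runs.for₀ {i : ℕ} {b : BExp} {p : Program} (I : ℕ → State → Prop) {M : ℕ} (hM : M ≤ N)
    (hi : p.writesNat i = false) (hI : ∀ j s c, I j s → I j (s.writeNat i 0 c)) (h₀ : I 0 s)
    (hb : ∀ j s', Frame (.for i b p) s s' → s'.nat i 0 = j → (b.Holds s' ↔ j < M))
    (hp : ∀ j s', j < M → Frame (.for i b p) s s' → s'.nat i 0 = j → I j s' →
      Runs f N p s' 0 (I (j + 1))) :
    Runs f N (.for i b p) s 0 (I M) :=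
  Runs.for (r := 0) I hM hi hI h₀ hb hp

/-- A loop that fills the cells `o, …, o + M - 1` of a natural number array. -/
theorem Runs.fillNat {i a : ℕ} {b : BExp} {p : Program} {M : ℕ} (o : ℕ) (g : ℕ → ℕ) (hM : M ≤ N)
    (hi : p.writesNat i = false) (hia : a ≠ i)
    (hb : ∀ j s', Frame (.for i b p) s s' → s'.nat i 0 = j → (b.Holds s' ↔ j < M))
    (hp : ∀ j s', j < M → Frame (.for i b p) s s' → s'.nat i 0 = j →
      s'.nat a (o + j) = s.nat a (o + j) →
      Runs f N p s' 0 fun s'' => s''.nat a = Function.update (s'.nat a) (o + j) (g j)) :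
    Runs f N (.for i b p) s 0 fun s' =>
      ∀ c, s'.nat a c = if o ≤ c ∧ c < o + M then g (c - o) else s.nat a c := by
  refine Runs.for₀ (fun j s' => ∀ c, s'.nat a c = if o ≤ c ∧ c < o + j then g (c - o) else
    s.nat a c) hM hi ?_ ?_ hb ?_
  · intro j s' c h d
    rw [← h d]
    simp [State.writeNat, Function.update_of_ne hia]
  · intro c
    rw [if_neg (by omega)]
  · intro j s' hj hf hij h
    refine (hp j s' hj hf hij (by rw [h, if_neg (by omega)])).mono le_rfl fun s'' h' c => ?_
    rw [h', Function.update_apply, h]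
    by_cases hc : c = o + j
    · subst hc
      rw [if_pos rfl, if_pos (by omega)]
      congr 1; omega
    · rw [if_neg hc]
      by_cases hc' : o ≤ c ∧ c < o + j
      · rw [if_pos hc', if_pos (by omega)]
      · rw [if_neg hc', if_neg (by omega)]

/-- A loop that fills the first `M` cells of a real array. -/
theorem Runs.fillReal {i a : ℕ} {b : BExp} {p : Program} {M : ℕ} (g : ℕ → ℝ) (hM : M ≤ N)
    (hi : p.writesNat i = false)
    (hb : ∀ j s', Frame (.for i b p) s s' → s'.nat i 0 = j → (b.Holds s' ↔ j < M))
    (hp : ∀ j s', j < M → Frame (.for i b p) s s' → s'.nat i 0 = j →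
      s'.real a j = s.real a j →
      Runs f N p s' 0 fun s'' => s''.real a = Function.update (s'.real a) j (g j)) :
    Runs f N (.for i b p) s 0 fun s' => ∀ c < M, s'.real a c = g c := by
  refine (Runs.for₀ (fun j s' => ∀ c, s'.real a c = if c < j then g c else
    s.real a c) hM hi ?_ ?_ hb ?_).mono le_rfl fun s' h c hc => by rw [h, if_pos hc]
  · exact fun j s' c h d => h d
  · intro c
    rw [if_neg (by omega)]
  · intro j s' hj hf hij h
    refine (hp j s' hj hf hij (by rw [h, if_neg (by omega)])).mono le_rfl fun s'' h' c => ?_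
    rw [h', Function.update_apply, h]
    by_cases hc : c = j
    · subst hc
      rw [if_pos rfl, if_pos (by omega)]
    · rw [if_neg hc]
      by_cases hc' : c < j
      · rw [if_pos hc', if_pos (by omega)]
      · rw [if_neg hc', if_neg (by omega)]

end Rules

theorem mem_row {s : State} {a i : ℕ} {v : Fin n} :
    v ∈ s.row n a i ↔ s.nat a (i * n + v) ≠ 0 := by simp [State.row]

theorem row_congr {s s' : State} {a : ℕ} (h : s'.nat a = s.nat a) (i : ℕ) :
    s'.row n a i = s.row n a i := by simp [State.row, h]

/-! ### The program -/

/-! The arrays of natural numbers. -/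

/-- `n` and `k`. -/
abbrev aInp : ℕ := 0
/-- The current sets, one row for each element `v` (row `v + 1`) and row `0`, the output. -/
abbrev aCur : ℕ := 1
/-- The sets at the start of the phase. -/
abbrev aBase : ℕ := 2
/-- The indicator of the dead elements. -/
abbrev aDead : ℕ := 3
/-- The multiples of `n`, since the machine cannot multiply natural numbers. -/
abbrev aMul : ℕ := 4
/-- The rows that are submitted in a round of queries. -/
abbrev aQry : ℕ := 5
/-- The bound `K = min n k` for the size of the minimizer. -/
abbrev aK : ℕ := 6
/-- An upper bound of `log n + 1`. -/
abbrev aLam : ℕ := 7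
abbrev aPow : ℕ := 8
abbrev aFound : ℕ := 9
/-- The names from `iR` to `iW` are those of loop counters: for rounds, steps, the indices `p`, `q`,
`b` of a query, passes, and elements or pairs. -/
abbrev iR : ℕ := 10
abbrev iT : ℕ := 11
abbrev iP : ℕ := 12
abbrev iQ : ℕ := 13
abbrev iB : ℕ := 14
abbrev iIt : ℕ := 15
abbrev iV : ℕ := 16
abbrev iW : ℕ := 17
/-- The row under construction. -/
abbrev aTmp : ℕ := 18

/-! The arrays of real numbers. -/

abbrev aEps : ℕ := 0
abbrev aPhi : ℕ := 1
/-- The weights, one row for each set; `aTot` and `aStep` have the same shape. -/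
abbrev aWt : ℕ := 2
abbrev aTot : ℕ := 3
/-- The numbers of elements of the rows of `aQry`. -/
abbrev aCnt : ℕ := 4
abbrev aAns : ℕ := 5
abbrev aStep : ℕ := 6
/-- The largest absolute value of the initial answers. -/
abbrev aMax : ℕ := 7

/-- Cell `0` of an array, used as a variable. -/
abbrev NExp.var (a : ℕ) : NExp := .get a (.lit 0)

/-- The index of the entry in row `i` and column `v` of a matrix with `n` columns. -/
abbrev NExp.idx (i v : NExp) : NExp := .add (.get aMul i) v

abbrev NExp.size : NExp := .get aInp (.lit 0)

abbrev RExp.lit (c : ℕ) : RExp := .cast (.lit c)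

abbrev RExp.var (a : ℕ) : RExp := .get a (.lit 0)

abbrev BExp.or (b₁ b₂ : BExp) : BExp := .not (.and (.not b₁) (.not b₂))

abbrev BExp.pos (e : NExp) : BExp := .natLt (.lit 0) e

/-- The index `p * n + q`. -/
abbrev NExp.pq : NExp := .idx (.var iP) (.var iQ)

/-- The row of `aQry` for `p`, `q`, `b`. -/
abbrev NExp.rowIdx : NExp := .add (.add .pq .pq) (.var iB)

/-- The number `n (n + 1)` of the pairs `p`, `q`. -/
abbrev NExp.pairs : NExp := .get aMul (.add .size (.lit 1))

/-- Put the union of `C_p` and of the elements that are alive and in `before x q b` into `aTmp`. -/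
def initRow : Program :=
  .for iV (.natLt (.var iV) .size)
    (.cond
      (.or (.pos (.get aCur (.idx (.var iP) (.var iV))))
        (.and (.not (.pos (.get aDead (.var iV))))
          (.or (.realLt (.get aWt .pq) (.get aWt (.idx (.var iP) (.var iV))))
            (.and (.not (.realLt (.get aWt (.idx (.var iP) (.var iV))) (.get aWt .pq)))
              (.natLt (.var iV) (.add (.var iQ) (.var iB)))))))
      (.setNat aTmp (.var iV) (.lit 1)) (.setNat aTmp (.var iV) (.lit 0)))

/-- Remove `iV` from `aTmp` if it forces an element that is not there. -/
def pruneElement : Program :=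
  .for iW (.natLt (.var iW) .size)
    (.cond
      (.and (.pos (.get aTmp (.var iV)))
        (.and (.not (.pos (.get aCur (.idx (.var iP) (.var iV)))))
          (.and (.pos (.get aBase (.idx (.add (.var iV) (.lit 1)) (.var iW))))
            (.not (.pos (.get aTmp (.var iW)))))))
      (.setNat aTmp (.var iV) (.lit 0)) .skip)

/-- One pass over all elements.  Unless `aTmp` is already closed, a pass removes an element. -/
def prunePass : Program := .for iV (.natLt (.var iV) .size) pruneElement

/-- Shrink `aTmp` to its largest feasible subset. -/
def pruneRow : Program := .for iIt (.natLt (.var iIt) .size) prunePass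

/-- Copy `aTmp` to its row of the query matrix. -/
def storeRow : Program :=
  .for iV (.natLt (.var iV) .size)
    (.setNat aQry (.idx .rowIdx (.var iV)) (.get aTmp (.var iV)))

/-- Store the cardinality of `aTmp`, as a real number. -/
def countRow : Program :=
  .seq (.setReal aCnt .rowIdx (.lit 0))
    (.for iV (.natLt (.var iV) .size)
      (.setReal aCnt .rowIdx (.add (.get aCnt .rowIdx) (.cast (.get aTmp (.var iV))))))

/-- Compute the set to be queried for `p`, `q`, `b`. -/
def buildRow : Program := .seq initRow (.seq pruneRow (.seq storeRow countRow))

/-- Compute all sets of a round of queries. -/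
def buildRows : Program :=
  .for iP (.natLt (.var iP) (.add .size (.lit 1)))
    (.for iQ (.natLt (.var iQ) .size) (.for iB (.natLt (.var iB) (.lit 2)) buildRow))

/-- Twice the index `iV`, as a row of `aQry`. -/
abbrev NExp.rowV : NExp := .add (.var iV) (.var iV)

abbrev RExp.sq (e : RExp) : RExp := .mul e e

/-- The subgradient entry computed from the answers. -/
abbrev RExp.rawGrad : RExp :=
  .add (.sub (.get aAns (.add .rowV (.lit 1))) (.get aAns .rowV))
    (.mul (.var aPhi) (.sub (.lit 1)
      (.sub (.get aCnt (.add .rowV (.lit 1))) (.get aCnt .rowV))))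

/-- The truncation level `3Kφ`. -/
abbrev RExp.level : RExp := .mul (.mul (.lit 3) (.cast (.var aK))) (.var aPhi)

/-- The factor `288 K ^ 4 φ`. -/
abbrev RExp.scale : RExp :=
  .mul (.mul (.lit 288) (.sq (.sq (.cast (.var aK))))) (.var aPhi)

def computeSteps : Program :=
  .for iV (.natLt (.var iV) .pairs)
    (.cond (.realLt .rawGrad (.sub (.lit 0) .level))
      (.setReal aStep (.var iV) (.div (.sub (.lit 0) .level) .scale))
      (.setReal aStep (.var iV) (.div .rawGrad .scale)))

def updateTotals : Program :=
  .for iV (.natLt (.var iV) .pairs)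
    (.setReal aTot (.var iV) (.add (.get aTot (.var iV)) (.get aStep (.var iV))))

abbrev RExp.newWeight : RExp :=
  .mul (.get aWt (.var iV)) (.sub (.lit 1) (.get aStep (.var iV)))

def updateWeights : Program :=
  .for iV (.natLt (.var iV) .pairs)
    (.cond (.realLt (.lit 1) .newWeight) (.setReal aWt (.var iV) (.lit 1))
      (.setReal aWt (.var iV) .newWeight))

/-- One step of multiplicative weights, for all `p` in parallel. -/
def weightStep : Program :=
  .seq buildRows (.seq (.query (.add .pairs .pairs) aQry aAns)
    (.seq computeSteps (.seq updateTotals updateWeights)))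

/-- The initial weights: `0` on row `p` of `aCur`, whose entries may exceed `1`, and `1 / n`
elsewhere. -/
def initWeights : Program :=
  .for iV (.natLt (.var iV) .pairs)
    (.setReal aWt (.var iV) (.div (.cast (.sub (.lit 1) (.get aCur (.var iV)))) (.cast .size)))

def initTotals : Program :=
  .for iV (.natLt (.var iV) .pairs) (.setReal aTot (.var iV) (.lit 0))

/-- The real number `6912 K ^ 6 Λ`. -/
abbrev RExp.steps : RExp :=
  .mul (.mul (.lit 6912) (.sq (.mul (.sq (.cast (.var aK))) (.cast (.var aK)))))
    (.cast (.var aLam))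

def weightLoop : Program := .for iT (.realLt (.cast (.var iT)) .steps) weightStep

/-- Add row `q + 1` of `aBase` to row `p` of `aCur`. -/
def addBase : Program :=
  .for iV (.natLt (.var iV) .size)
    (.setNat aCur (.idx (.var iP) (.var iV))
      (.add (.get aCur (.idx (.var iP) (.var iV)))
        (.get aBase (.idx (.add (.var iQ) (.lit 1)) (.var iV)))))

/-- Enlarge the row `p` of `aCur` by at most one row of `aBase`. -/
def growRow : Program :=
  .seq (.setNat aFound (.lit 0) (.lit 0))
    (.for iQ (.natLt (.var iQ) .size)
      (.cond
        (.and (.not (.pos (.var aFound)))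
          (.and (.not (.pos (.get aCur .pq)))
            (.realLt (.get aTot .pq)
              (.sub (.lit 0) (.mul (.mul (.lit 6) (.cast (.var aK))) (.cast (.var aLam)))))))
        (.seq (.setNat aFound (.lit 0) (.lit 1)) addBase) .skip))

def growRows : Program := .for iP (.natLt (.var iP) (.add .size (.lit 1))) growRow

/-- One round: multiplicative weights from scratch, and an enlargement of the sets. -/
def roundProgram : Program :=
  .seq initWeights (.seq initTotals (.seq weightLoop growRows))

def copyBase : Program :=
  .for iV (.natLt (.var iV) .pairs) (.setNat aBase (.var iV) (.get aCur (.var iV)))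

/-- Declare the elements dead whose sets have values more than `φ / 4` above that of row `0`. -/
def kill : Program :=
  .for iV (.natLt (.var iV) .size)
    (.cond (.realLt (.add (.var aAns) (.div (.var aPhi) (.lit 4)))
        (.get aAns (.add (.var iV) (.lit 1))))
      (.setNat aDead (.var iV) (.lit 1)) .skip)

/-- One phase.  The final queries compare row `0` with the other rows. -/
def phaseProgram : Program :=
  .seq copyBase (.seq (.for iR (.natLt (.var iR) (.add (.var aK) (.lit 1))) roundProgram)
    (.seq (.query (.add .size (.lit 1)) aCur aAns)
      (.seq kill (.setReal aPhi (.lit 0) (.div (.var aPhi) (.lit 2))))))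

/-- `K = min n k`. -/
def initK : Program :=
  .cond (.natLt .size (.get aInp (.lit 1))) (.setNat aK (.lit 0) .size)
    (.setNat aK (.lit 0) (.get aInp (.lit 1)))

/-- `Λ = 1 + ⌈log₂ n⌉`, by repeated doubling. -/
def initLam : Program :=
  .seq (.setNat aPow (.lit 0) (.lit 1)) (.seq (.setNat aLam (.lit 0) (.lit 1))
    (.loop (.natLt (.var aPow) .size)
      (.seq (.setNat aPow (.lit 0) (.add (.var aPow) (.var aPow)))
        (.setNat aLam (.lit 0) (.add (.var aLam) (.lit 1))))))

/-- The multiples of `n`.  The test is made in the reals, where multiplication is available. -/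
def initMul : Program :=
  .for iV (.realLt (.cast (.var iV))
      (.mul (.mul (.lit 2) (.cast .size)) (.cast (.add .size (.lit 1)))))
    (.setNat aMul (.add (.var iV) (.lit 1)) (.add (.get aMul (.var iV)) .size))

/-- Row `0` becomes the empty set, row `v + 1` the set `{v}`, and row `n + 1` the ground set. -/
def initCur : Program :=
  .for iP (.natLt (.var iP) (.add .size (.lit 2)))
    (.for iV (.natLt (.var iV) .size)
      (.setNat aCur (.idx (.var iP) (.var iV))
        (.add
          (.sub (.lit 1) (.add (.sub (.var iP) (.add (.var iV) (.lit 1)))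
            (.sub (.add (.var iV) (.lit 1)) (.var iP))))
          (.sub (.lit 1) (.sub (.add .size (.lit 1)) (.var iP))))))

/-- The largest absolute value of an answer. -/
def initMax : Program :=
  .for iV (.natLt (.var iV) (.add .size (.lit 2)))
    (.seq
      (.cond (.realLt (.var aMax) (.get aAns (.var iV)))
        (.setReal aMax (.lit 0) (.get aAns (.var iV))) .skip)
      (.cond (.realLt (.var aMax) (.sub (.lit 0) (.get aAns (.var iV))))
        (.setReal aMax (.lit 0) (.sub (.lit 0) (.get aAns (.var iV)))) .skip))

/-- The initialization.  The initial scale is `(2 n + 2)` times the largest absolute value that has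
been observed. -/
def initProgram : Program :=
  .seq initK (.seq initLam (.seq initMul (.seq initCur
    (.seq (.query (.add .size (.lit 2)) aCur aAns) (.seq initMax
      (.setReal aPhi (.lit 0)
        (.mul (.add (.mul (.lit 2) (.cast .size)) (.lit 2)) (.var aMax))))))))

/-- The whole algorithm: phases are run until the scale is at most `ε`. -/
def sparseMinimizer : Program :=
  .seq initProgram (.loop (.realLt (.var aEps) (.var aPhi)) phaseProgram)

/-! ### Building the rows of a query -/

attribute [simp] NExp.eval RExp.eval BExp.Holds

theorem mem_before {x : Fin n → ℝ} {q v : Fin n} {b : ℕ} :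
    v ∈ before x q b ↔ x q < x v ∨ (¬ x v < x q ∧ (v : ℕ) < q + b) := by
  simp [before]

theorem writeNat_self (s : State) (a i v : ℕ) :
    (s.writeNat a i v).nat a = Function.update (s.nat a) i v :=
  Function.update_self _ _ _

theorem writeReal_self (s : State) (a i : ℕ) (v : ℝ) :
    (s.writeReal a i v).real a = Function.update (s.real a) i v :=
  Function.update_self _ _ _

/-- Facts about the memory that hold from the end of the initialization on. -/
structure Static (n : ℕ) (s : State) : Prop where
  inp : s.nat aInp 0 = n
  mul : ∀ i ≤ 2 * n * (n + 1), s.nat aMul i = i * n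

theorem Static.congr {s s' : State} (h : Static n s) (h₁ : s'.nat aInp = s.nat aInp)
    (h₂ : s'.nat aMul = s.nat aMul) : Static n s' :=
  ⟨by rw [h₁, h.inp], fun i hi => by rw [h₂, h.mul i hi]⟩

theorem Static.frame {P : Program} {s s' : State} (h : Static n s) (hf : Frame P s s')
    (h₁ : P.writesNat aInp = false) (h₂ : P.writesNat aMul = false) : Static n s' :=
  h.congr (hf.1 _ h₁) (hf.1 _ h₂)

theorem Static.mul_of_le {s : State} (h : Static n s) (hn : 1 ≤ n) {i : ℕ} (hi : i ≤ n + 1) :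
    s.nat aMul i = i * n := h.mul i (by nlinarith)

/-- The array `aTmp` is the indicator of `Y`. -/
def IsTmp (s : State) (Y : Finset (Fin n)) : Prop :=
  ∀ v : Fin n, s.nat aTmp v = if v ∈ Y then 1 else 0

/-- The row `p` of the weight matrix. -/
def wt (n : ℕ) (s : State) (p : ℕ) (v : Fin n) : ℝ := s.real aWt (p * n + v)

section Program

variable {f : Finset (Fin n) → ℝ} {N : ℕ} {s : State}

theorem initRow_runs (hs : Static n s) (hn : 1 ≤ n) (hN : n ≤ N) (hp : s.nat iP 0 ≤ n) (q : Fin n)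
    (hq : s.nat iQ 0 = q) :
    Runs f N initRow s 0 fun s' => ∃ Y : Finset (Fin n), IsTmp s' Y ∧ ∀ v, v ∈ Y ↔
      v ∈ s.row n aCur (s.nat iP 0) ∨ v ∉ s.row n aDead 0 ∧
        v ∈ before (wt n s (s.nat iP 0)) q (s.nat iB 0) := by
  classical
  set Y : Finset (Fin n) := Finset.univ.filter fun v =>
      v ∈ s.row n aCur (s.nat iP 0) ∨ v ∉ s.row n aDead 0 ∧
        v ∈ before (wt n s (s.nat iP 0)) q (s.nat iB 0) with hY
  refine (Runs.fillNat (a := aTmp) 0 (fun j => if ∃ h : j < n, (⟨j, h⟩ : Fin n) ∈ Y then 1 else 0)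
    hN rfl (by decide) ?_ ?_).mono le_rfl ?_
  · intro j s' hf hj
    have := hs.frame hf rfl rfl
    simp [hj, this.inp]
  · intro j s' hj hf hjv _
    have hs' := hs.frame hf rfl rfl
    have e₁ : s'.nat iP = s.nat iP := hf.1 _ rfl
    have e₂ : s'.nat iQ = s.nat iQ := hf.1 _ rfl
    have e₃ : s'.nat iB = s.nat iB := hf.1 _ rfl
    have e₄ : s'.nat aCur = s.nat aCur := hf.1 _ rfl
    have e₅ : s'.nat aDead = s.nat aDead := hf.1 _ rfl
    have e₆ : s'.real aWt = s.real aWt := hf.2 _ rfl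
    have e₇ := hs'.mul_of_le hn (hp.trans (Nat.le_succ n))
    have hb : (BExp.or (.pos (.get aCur (.idx (.var iP) (.var iV))))
        (.and (.not (.pos (.get aDead (.var iV))))
          (.or (.realLt (.get aWt .pq) (.get aWt (.idx (.var iP) (.var iV))))
            (.and (.not (.realLt (.get aWt (.idx (.var iP) (.var iV))) (.get aWt .pq)))
              (.natLt (.var iV) (.add (.var iQ) (.var iB))))))).Holds s' ↔
        (⟨j, hj⟩ : Fin n) ∈ Y := by
      simp only [hY, BExp.Holds, NExp.eval, RExp.eval, e₁, e₂, e₃, e₄, e₅, e₆, e₇, hjv, hq,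
        Finset.mem_filter, Finset.mem_univ, true_and, mem_row, mem_before, wt, zero_mul, zero_add,
        Nat.pos_iff_ne_zero]
      tauto
    refine Runs.cond (fun h => Runs.setNat ?_) fun h => Runs.setNat ?_
    · rw [writeNat_self, if_pos ⟨hj, hb.1 h⟩]
      simp [hjv]
    · rw [writeNat_self, if_neg fun ⟨_, h'⟩ => h (hb.2 h')]
      simp [hjv]
  · intro s' h
    refine ⟨Y, fun v => ?_, fun v => by simp [hY]⟩
    rw [h, if_pos ⟨Nat.zero_le _, by have := v.2; omega⟩]
    simp

/-- What removing elements preserves: the elements of `C` and of every closed subset of `Y` are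
kept. -/
def Prunes (A : Fin n → Finset (Fin n)) (C Y R : Finset (Fin n)) : Prop :=
  R ⊆ Y ∧ C ⊆ R ∧ ∀ R', R' ⊆ Y → (∀ v ∈ R', v ∉ C → A v ⊆ R') → R' ⊆ R

theorem IsTmp.pos_iff {s : State} {Y : Finset (Fin n)} (h : IsTmp s Y) {j : ℕ} (hj : j < n) :
    0 < s.nat aTmp j ↔ (⟨j, hj⟩ : Fin n) ∈ Y := by
  have := h ⟨j, hj⟩
  simp only at this
  rw [this]
  split_ifs with h' <;> simp [h']

theorem pruneElement_runs (hs : Static n s) (hn : 1 ≤ n) (hN : n ≤ N) (hp : s.nat iP 0 ≤ n)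
    (v : Fin n) (hv : s.nat iV 0 = v) {A : Fin n → Finset (Fin n)}
    (hA : ∀ v : Fin n, A v = s.row n aBase (v + 1)) {C Y R₀ : Finset (Fin n)}
    (hC : C = s.row n aCur (s.nat iP 0)) {R : Finset (Fin n)} (hR : IsTmp s R)
    (hY : Prunes A C Y R) (hRR : R ⊆ R₀) :
    Runs f N pruneElement s 0 fun s' => ∃ R', IsTmp s' R' ∧ Prunes A C Y R' ∧ R' ⊆ R ∧
      (v ∈ R' → v ∉ C → A v ⊆ R₀) := by
  refine (Runs.for₀ (fun j s' => ∃ R', IsTmp s' R' ∧ Prunes A C Y R' ∧ R' ⊆ R ∧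
      ∀ w : Fin n, (w : ℕ) < j → v ∈ R' → v ∉ C → w ∈ A v → w ∈ R₀) hN rfl
      ?_ ⟨R, hR, hY, subset_rfl, fun w hw => absurd hw (Nat.not_lt_zero _)⟩
      ?_ ?_).mono le_rfl ?_
  · exact fun j s c h => h
  · intro j s' hf hj
    have := hs.frame hf rfl rfl
    simp [hj, this.inp]
  · rintro j s' hj hf hjw ⟨R', hR', hY', hsub, hall⟩
    have hs' := hs.frame hf rfl rfl
    have e₁ : s'.nat iP = s.nat iP := hf.1 _ rfl
    have e₂ : s'.nat iV = s.nat iV := hf.1 _ rfl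
    have e₃ : s'.nat aBase = s.nat aBase := hf.1 _ rfl
    have e₄ : s'.nat aCur = s.nat aCur := hf.1 _ rfl
    have e₅ := hs'.mul_of_le hn (hp.trans (Nat.le_succ n))
    have e₆ := hs'.mul_of_le hn (i := v + 1) (by omega)
    have hb : (BExp.and (.pos (.get aTmp (.var iV)))
        (.and (.not (.pos (.get aCur (.idx (.var iP) (.var iV)))))
          (.and (.pos (.get aBase (.idx (.add (.var iV) (.lit 1)) (.var iW))))
            (.not (.pos (.get aTmp (.var iW))))))).Holds s' ↔
        v ∈ R' ∧ v ∉ C ∧ (⟨j, hj⟩ : Fin n) ∈ A v ∧ (⟨j, hj⟩ : Fin n) ∉ R' := by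
      simp only [BExp.Holds, NExp.eval, e₁, e₂, e₃, e₄, e₅, e₆, hjw, hv, hA, hC, mem_row,
        hR'.pos_iff hj, hR'.pos_iff v.2]
      simp only [Nat.pos_iff_ne_zero]
    refine Runs.cond (fun h => Runs.setNat ?_) fun h => Runs.skip ?_
    · obtain ⟨h₁, h₂, h₃, h₄⟩ := hb.1 h
      refine ⟨R'.erase v, fun u => ?_, ⟨(Finset.erase_subset _ _).trans hY'.1, ?_, ?_⟩,
        (Finset.erase_subset _ _).trans hsub, fun w _ hvR => absurd hvR (Finset.notMem_erase _ _)⟩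
      · simp only [writeNat_self, NExp.eval, e₂, hv, Function.update_apply, Fin.val_inj,
          Finset.mem_erase, hR' u]
        by_cases huv : u = v <;> simp [huv]
      · exact fun u hu => Finset.mem_erase.2 ⟨fun e => h₂ (e ▸ hu), hY'.2.1 hu⟩
      · refine fun R'' hR'' hcl u hu => Finset.mem_erase.2 ⟨?_, hY'.2.2 R'' hR'' hcl hu⟩
        rintro rfl
        exact h₄ (hY'.2.2 R'' hR'' hcl (hcl _ hu h₂ h₃))
    · refine ⟨R', hR', hY', hsub, fun w hw hvR hvC hwA => ?_⟩
      rcases Nat.lt_succ_iff_lt_or_eq.1 hw with hw | hw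
      · exact hall w hw hvR hvC hwA
      · by_contra hwR
        refine h (hb.2 ⟨hvR, hvC, ?_, ?_⟩)
        · simpa [← hw] using hwA
        · simpa [← hw] using fun h' => hwR (hRR (hsub h'))
  · rintro s' ⟨R', h₁, h₂, h₃, h₄⟩
    exact ⟨R', h₁, h₂, h₃, fun a b w hw => h₄ w w.2 a b hw⟩

theorem prunePass_runs (hs : Static n s) (hn : 1 ≤ n) (hN : n ≤ N) (hp : s.nat iP 0 ≤ n)
    {A : Fin n → Finset (Fin n)}
    (hA : ∀ v : Fin n, A v = s.row n aBase (v + 1)) {C Y : Finset (Fin n)}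
    (hC : C = s.row n aCur (s.nat iP 0)) {R : Finset (Fin n)} (hR : IsTmp s R)
    (hY : Prunes A C Y R) :
    Runs f N prunePass s 0 fun s' => ∃ R', IsTmp s' R' ∧ Prunes A C Y R' ∧ R' ⊆ R ∧
      ∀ v ∈ R', v ∉ C → A v ⊆ R := by
  refine (Runs.for₀ (fun j s' => ∃ R', IsTmp s' R' ∧ Prunes A C Y R' ∧ R' ⊆ R ∧
      ∀ v : Fin n, (v : ℕ) < j → v ∈ R' → v ∉ C → A v ⊆ R) hN rfl
      ?_ ⟨R, hR, hY, subset_rfl, fun w hw => absurd hw (Nat.not_lt_zero _)⟩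
      ?_ ?_).mono le_rfl ?_
  · exact fun j s c h => h
  · intro j s' hf hj
    have := hs.frame hf rfl rfl
    simp [hj, this.inp]
  · rintro j s' hj hf hjv ⟨R', hR', hY', hsub, hall⟩
    have e₁ : s'.nat iP = s.nat iP := hf.1 _ rfl
    refine (pruneElement_runs (hs.frame hf rfl rfl) hn hN (e₁ ▸ hp) ⟨j, hj⟩ hjv
      (fun v => (hA v).trans (row_congr (hf.1 aBase rfl) _).symm)
      (by rw [hC, e₁, row_congr (hf.1 aCur rfl)]) hR' hY' hsub).mono le_rfl ?_
    rintro s'' ⟨R'', h₁, h₂, h₃, h₄⟩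
    refine ⟨R'', h₁, h₂, h₃.trans hsub, fun v hv hvR hvC => ?_⟩
    rcases Nat.lt_succ_iff_lt_or_eq.1 hv with hv | hv
    · exact hall v hv (h₃ hvR) hvC
    · subst hv; exact h₄ hvR hvC
  · rintro s' ⟨R', h₁, h₂, h₃, h₄⟩
    exact ⟨R', h₁, h₂, h₃, fun v => h₄ v v.2⟩

theorem pruneRow_runs (hs : Static n s) (hn : 1 ≤ n) (hN : n ≤ N) (hp : s.nat iP 0 ≤ n)
    {A : Fin n → Finset (Fin n)}
    (hA : ∀ v : Fin n, A v = s.row n aBase (v + 1)) {C Y : Finset (Fin n)}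
    (hC : C = s.row n aCur (s.nat iP 0)) (hY : IsTmp s Y) (hCY : C ⊆ Y) :
    Runs f N pruneRow s 0 fun s' => ∃ R, IsTmp s' R ∧ Prunes A C Y R ∧
      ∀ v ∈ R, v ∉ C → A v ⊆ R := by
  refine (Runs.for₀ (fun j s' => ∃ R, IsTmp s' R ∧ Prunes A C Y R ∧
      ((∀ v ∈ R, v ∉ C → A v ⊆ R) ∨ R.card + j ≤ n)) hN rfl
      ?_ ⟨Y, hY, ⟨subset_rfl, hCY, fun _ h _ => h⟩, Or.inr ?_⟩
      ?_ ?_).mono le_rfl ?_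
  · exact fun j s c h => h
  · simpa using Finset.card_le_univ Y
  · intro j s' hf hj
    have := hs.frame hf rfl rfl
    simp [hj, this.inp]
  · rintro j s' hj hf hjv ⟨R, hR, hYR, hor⟩
    have e₁ : s'.nat iP = s.nat iP := hf.1 _ rfl
    refine (prunePass_runs (hs.frame hf rfl rfl) hn hN (e₁ ▸ hp)
      (fun v => (hA v).trans (row_congr (hf.1 aBase rfl) _).symm)
      (by rw [hC, e₁, row_congr (hf.1 aCur rfl)]) hR hYR).mono le_rfl ?_
    rintro s'' ⟨R', h₁, h₂, h₃, h₄⟩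
    refine ⟨R', h₁, h₂, ?_⟩
    by_cases he : R' = R
    · exact Or.inl (by rw [he] at h₄ ⊢; exact h₄)
    · rcases hor with hcl | hcard
      · exact absurd (h₃.antisymm (h₂.2.2 R hYR.1 hcl)) he
      · have := Finset.card_lt_card (h₃.ssubset_of_ne he)
        exact Or.inr (by omega)
  · rintro s' ⟨R, h₁, h₂, h₃ | h₃⟩
    · exact ⟨R, h₁, h₂, h₃⟩
    · have : R = ∅ := Finset.card_eq_zero.1 (by omega)
      exact ⟨R, h₁, h₂, by simp [this]⟩

/-- The closed subset found by pruning is the core. -/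
theorem Prunes.eq_core {A : Fin n → Finset (Fin n)} {dead C S Y R : Finset (Fin n)}
    (h : Prunes A C Y R) (hcl : ∀ v ∈ R, v ∉ C → A v ⊆ R)
    (hY : ∀ v, v ∈ Y ↔ v ∈ C ∨ v ∉ dead ∧ v ∈ S) : R = core A dead C S := by
  apply Finset.Subset.antisymm
  · refine subset_core ⟨h.2.1, fun v hv hvC => ⟨?_, hcl v hv hvC⟩⟩ fun v hv => ?_
    · rcases (hY v).1 (h.1 hv) with h' | h'
      exacts [absurd h' hvC, h'.1]
    · rcases (hY v).1 (h.1 hv) with h' | h'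
      exacts [Finset.mem_union_right _ h', Finset.mem_union_left _ h'.2]
  · have hc := core_feasible (A := A) (dead := dead) (C := C) S
    refine h.2.2 _ (fun v hv => (hY v).2 ?_) fun v hv hvC => (hc.2 v hv hvC).2
    by_cases hvC : v ∈ C
    · exact Or.inl hvC
    · rcases Finset.mem_union.1 (core_subset S hv) with h' | h'
      · exact Or.inr ⟨(hc.2 v hv hvC).1, h'⟩
      · exact absurd h' hvC

theorem index_inj {i j v w : ℕ} (hv : v < n) (hw : w < n) (h : i * n + v = j * n + w) :
    i = j ∧ v = w := by
  have hn : 0 < n := by omega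
  have h₁ : (v + n * i) / n = i := by
    rw [Nat.add_mul_div_left _ _ hn, Nat.div_eq_of_lt hv, zero_add]
  have h₂ : (w + n * j) / n = j := by
    rw [Nat.add_mul_div_left _ _ hn, Nat.div_eq_of_lt hw, zero_add]
  have : i = j := by
    rw [← h₁, ← h₂]
    congr 1
    rw [add_comm, mul_comm, h, add_comm, mul_comm]
  subst this
  exact ⟨rfl, by omega⟩

theorem row_of_fill {s s' : State} {a i : ℕ} {g : ℕ → ℕ}
    (h : ∀ c, s'.nat a c = if i * n ≤ c ∧ c < i * n + n then g (c - i * n) else s.nat a c) :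
    (∀ v : Fin n, v ∈ s'.row n a i ↔ g v ≠ 0) ∧
      ∀ i', i' ≠ i → s'.row n a i' = s.row n a i' := by
  constructor
  · intro v
    rw [mem_row, h, if_pos ⟨Nat.le_add_right _ _, Nat.add_lt_add_left v.2 _⟩,
      Nat.add_sub_cancel_left]
  · intro i' hi'
    ext v
    rw [mem_row, mem_row, h, if_neg]
    rintro ⟨h₁, h₂⟩
    obtain ⟨w, hw⟩ := Nat.exists_eq_add_of_le h₁
    exact hi' (index_inj v.2 (by omega) hw).1

theorem pair_lt {p q : ℕ} (hp : p ≤ n) (hq : q < n) : p * n + q < (n + 1) * n := by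
  have := Nat.mul_le_mul_right n hp
  rw [add_mul, one_mul]
  omega

/-- The row of the query matrix for `p`, `q`, `b`. -/
abbrev rowNum (n p q b : ℕ) : ℕ := p * n + q + (p * n + q) + b

theorem rowNum_lt {p q b : ℕ} (hp : p ≤ n) (hq : q < n) (hb : b < 2) :
    rowNum n p q b < 2 * n * (n + 1) := by
  have := pair_lt hp hq
  have e : 2 * n * (n + 1) = 2 * ((n + 1) * n) := by ring
  rw [e, rowNum]
  omega

theorem storeRow_runs (hs : Static n s) (hn : 1 ≤ n) (hN : n ≤ N) (hp : s.nat iP 0 ≤ n)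
    (hq : s.nat iQ 0 < n) (hb : s.nat iB 0 < 2) {R : Finset (Fin n)} (hR : IsTmp s R) :
    Runs f N storeRow s 0 fun s' =>
      s'.row n aQry (rowNum n (s.nat iP 0) (s.nat iQ 0) (s.nat iB 0)) = R ∧
      ∀ i, i ≠ rowNum n (s.nat iP 0) (s.nat iQ 0) (s.nat iB 0) →
        s'.row n aQry i = s.row n aQry i := by
  refine (Runs.fillNat (a := aQry) (rowNum n (s.nat iP 0) (s.nat iQ 0) (s.nat iB 0) * n)
    (s.nat aTmp) hN rfl (by decide) ?_ ?_).mono le_rfl ?_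
  · intro j s' hf hj
    have := hs.frame hf rfl rfl
    simp [hj, this.inp]
  · intro j s' hj hf hjv _
    have hs' := hs.frame hf rfl rfl
    have e₁ : s'.nat iP = s.nat iP := hf.1 _ rfl
    have e₂ : s'.nat iQ = s.nat iQ := hf.1 _ rfl
    have e₃ : s'.nat iB = s.nat iB := hf.1 _ rfl
    have e₄ : s'.nat aTmp = s.nat aTmp := hf.1 _ rfl
    refine Runs.setNat ?_
    simp only [writeNat_self, NExp.eval, e₁, e₂, e₃, e₄, hjv,
      hs'.mul_of_le hn (hp.trans (Nat.le_succ n)), hs'.mul _ (rowNum_lt hp hq hb).le]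
  · intro s' h
    obtain ⟨h₁, h₂⟩ := row_of_fill h
    refine ⟨?_, h₂⟩
    ext v
    rw [h₁, hR v]
    simp

theorem countRow_runs (hs : Static n s) (hn : 1 ≤ n) (hN : n ≤ N) (hp : s.nat iP 0 ≤ n)
    {R : Finset (Fin n)} (hR : IsTmp s R) :
    Runs f N countRow s 0 fun s' =>
      s'.real aCnt (rowNum n (s.nat iP 0) (s.nat iQ 0) (s.nat iB 0)) = R.card ∧
      ∀ i, i ≠ rowNum n (s.nat iP 0) (s.nat iQ 0) (s.nat iB 0) →
        s'.real aCnt i = s.real aCnt i := by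
  set ρ := rowNum n (s.nat iP 0) (s.nat iQ 0) (s.nat iB 0) with hρ
  have hmul := hs.mul_of_le hn (hp.trans (Nat.le_succ n))
  refine Runs.seq₀ (Runs.setReal ?_)
  refine (Runs.for₀ (fun j s' => s'.real aCnt ρ = ∑ i ∈ Finset.range j, (s.nat aTmp i : ℝ) ∧
    ∀ i, i ≠ ρ → s'.real aCnt i = s.real aCnt i) hN rfl ?_ ?_ ?_ ?_).mono le_rfl ?_
  · exact fun j s c h => h
  · simp only [writeReal_self, NExp.eval, RExp.eval, hmul]
    exact ⟨by simp [hρ], fun i hi => Function.update_of_ne hi _ _⟩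
  · intro j s' hf hj
    have : s'.nat aInp = s.nat aInp := hf.1 _ rfl
    simp [hj, this, hs.inp]
  · rintro j s' hj hf hjv ⟨h₁, h₂⟩
    have e₁ : s'.nat iP = s.nat iP := hf.1 _ rfl
    have e₂ : s'.nat iQ = s.nat iQ := hf.1 _ rfl
    have e₃ : s'.nat iB = s.nat iB := hf.1 _ rfl
    have e₄ : s'.nat aTmp = s.nat aTmp := hf.1 _ rfl
    have e₅ : s'.nat aMul = s.nat aMul := hf.1 _ rfl
    refine Runs.setReal ?_
    simp only [writeReal_self, NExp.eval, RExp.eval, e₁, e₂, e₃, e₄, e₅, hjv, hmul]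
    refine ⟨?_, fun i hi => ?_⟩
    · rw [Finset.sum_range_succ, ← h₁, hρ, Function.update_self]
    · rw [Function.update_of_ne hi, h₂ i hi]
  · rintro s' ⟨h₁, h₂⟩
    refine ⟨?_, h₂⟩
    rw [h₁, Finset.sum_range]
    rw [Finset.sum_congr rfl fun v _ => by rw [hR v]]
    simp

/-- The phase that is described by the memory; the base set of `v` is row `v + 1` of `aBase`. -/
noncomputable def phaseOf (f : Finset (Fin n) → ℝ) (s : State) : Phase n where
  f := f
  φ := s.real aPhi 0
  K := s.nat aK 0
  base v := s.row n aBase (v + 1)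
  dead := s.row n aDead 0

theorem phaseOf_congr {s' : State} (h₁ : s'.real aPhi = s.real aPhi) (h₂ : s'.nat aK = s.nat aK)
    (h₃ : s'.nat aBase = s.nat aBase) (h₄ : s'.nat aDead = s.nat aDead) :
    phaseOf f s' = phaseOf f s := by
  simp [phaseOf, h₁, h₂, row_congr h₃, row_congr h₄]

/-- The set to be queried in row `p`, `q`, `b`. -/
noncomputable def target (f : Finset (Fin n) → ℝ) (s : State) (p : ℕ) (q : Fin n) (b : ℕ) :
    Finset (Fin n) :=
  core (phaseOf f s).base (phaseOf f s).dead (s.row n aCur p) (before (wt n s p) q b)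

theorem target_frame {P : Program} {s' : State} (hf : Frame P s s')
    (h₁ : P.writesNat aBase = false) (h₂ : P.writesNat aDead = false)
    (h₃ : P.writesNat aCur = false) (h₄ : P.writesReal aWt = false) (p : ℕ) (q : Fin n) (b : ℕ) :
    target f s' p q b = target f s p q b := by
  have : wt n s' p = wt n s p := by ext v; simp [wt, hf.2 _ h₄]
  simp [target, phaseOf, row_congr (hf.1 _ h₁), row_congr (hf.1 _ h₂), row_congr (hf.1 _ h₃), this]

/-- The row for `p`, `q`, `b` has been built. -/
def Built (n : ℕ) (s : State) (ρ : ℕ) (R : Finset (Fin n)) : Prop :=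
  s.row n aQry ρ = R ∧ s.real aCnt ρ = R.card

theorem buildRow_runs (hs : Static n s) (hn : 1 ≤ n) (hN : n ≤ N) (hp : s.nat iP 0 ≤ n) (q : Fin n)
    (hq : s.nat iQ 0 = q) (hb : s.nat iB 0 < 2) :
    Runs f N buildRow s 0 fun s' =>
      Built n s' (rowNum n (s.nat iP 0) q (s.nat iB 0))
        (target f s (s.nat iP 0) q (s.nat iB 0)) ∧
      ∀ i, i ≠ rowNum n (s.nat iP 0) q (s.nat iB 0) → ∀ R, Built n s i R → Built n s' i R := by
  refine Runs.seq₀ ((initRow_runs hs hn hN hp q hq).imp ?_)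
  rintro s₁ hf₁ ⟨Y, hY, hmem⟩
  have hs₁ := hs.frame hf₁ rfl rfl
  have p₁ : s₁.nat iP = s.nat iP := hf₁.1 _ rfl
  refine Runs.seq₀ ((pruneRow_runs hs₁ hn hN (p₁ ▸ hp) (A := (phaseOf f s).base)
    (C := s.row n aCur (s.nat iP 0))
    (fun v => (row_congr (hf₁.1 aBase rfl) _).symm) (by rw [p₁, row_congr (hf₁.1 aCur rfl)])
    hY (fun v hv => (hmem v).2 (Or.inl hv))).imp ?_)
  rintro s₂ hf₂ ⟨R, hR, hPr, hcl⟩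
  have hs₂ := hs₁.frame hf₂ rfl rfl
  have p₂ : s₂.nat iP = s.nat iP := (hf₂.1 _ rfl).trans p₁
  have q₂ : s₂.nat iQ = s.nat iQ := (hf₂.1 _ rfl).trans (hf₁.1 _ rfl)
  have b₂ : s₂.nat iB = s.nat iB := (hf₂.1 _ rfl).trans (hf₁.1 _ rfl)
  have hRt : R = target f s (s.nat iP 0) q (s.nat iB 0) := hPr.eq_core hcl hmem
  refine Runs.seq₀ ((storeRow_runs hs₂ hn hN (p₂ ▸ hp) (by rw [q₂, hq]; exact q.2) (b₂ ▸ hb) hR).imp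
    ?_)
  rintro s₃ hf₃ ⟨h₁, h₂⟩
  rw [p₂, q₂, b₂, hq] at h₁ h₂
  have p₃ : s₃.nat iP = s.nat iP := (hf₃.1 _ rfl).trans p₂
  have q₃ : s₃.nat iQ = s.nat iQ := (hf₃.1 _ rfl).trans q₂
  have b₃ : s₃.nat iB = s.nat iB := (hf₃.1 _ rfl).trans b₂
  have hR₃ : IsTmp s₃ R := fun v => by rw [hf₃.1 aTmp rfl]; exact hR v
  refine (countRow_runs (hs₂.frame hf₃ rfl rfl) hn hN (p₃ ▸ hp) hR₃).imp ?_
  rintro s₄ hf₄ ⟨h₃, h₄⟩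
  rw [p₃, q₃, b₃, hq] at h₃ h₄
  have hQ : s₄.nat aQry = s₃.nat aQry := hf₄.1 _ rfl
  have hQ₂ : s₂.nat aQry = s.nat aQry := (hf₂.1 _ rfl).trans (hf₁.1 _ rfl)
  have hC₃ : s₃.real aCnt = s.real aCnt :=
    (hf₃.2 _ rfl).trans ((hf₂.2 _ rfl).trans (hf₁.2 _ rfl))
  refine ⟨⟨?_, ?_⟩, fun i hi R' hR' => ⟨?_, ?_⟩⟩
  · rw [row_congr hQ, h₁, hRt]
  · rw [h₃, hRt]
  · rw [row_congr hQ, h₂ i hi, row_congr hQ₂, hR'.1]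
  · rw [h₄ i hi, hC₃, hR'.2]

/-- All rows with a number below `m` have been built, for the data in `s₀`. -/
def BuiltBelow (f : Finset (Fin n) → ℝ) (s₀ : State) (m : ℕ) (s : State) : Prop :=
  ∀ (p : ℕ) (q : Fin n) (b : ℕ), b < 2 → rowNum n p q b < m →
    Built n s (rowNum n p q b) (target f s₀ p q b)

theorem rowNum_inj {p p' : ℕ} {q q' : Fin n} {b b' : ℕ} (hb : b < 2) (hb' : b' < 2)
    (h : rowNum n p q b = rowNum n p' q' b') : p = p' ∧ q = q' ∧ b = b' := by
  unfold rowNum at h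
  obtain ⟨h₁, h₂⟩ := index_inj (i := p) (j := p') q.2 q'.2 (by omega)
  exact ⟨h₁, Fin.ext h₂, by omega⟩

theorem buildRows_runs (hs : Static n s) (hn : 1 ≤ n) (hN : n + 1 ≤ N) :
    Runs f N buildRows s 0 (BuiltBelow f s (2 * ((n + 1) * n))) := by
  have hN' : n ≤ N := by omega
  refine Runs.for₀ (fun j s' => BuiltBelow f s (2 * (j * n)) s') hN rfl ?_ ?_ ?_ ?_
  · exact fun j s c h => h
  · intro p q b _ h
    omega
  · intro j s' hf hj
    have := hs.frame hf rfl rfl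
    simp [hj, this.inp]
  intro p s₁ hp hf₁ hp₁ hI₁
  have hs₁ := hs.frame hf₁ rfl rfl
  refine (Runs.for₀ (fun j s' => BuiltBelow f s (2 * (p * n + j)) s') hN' rfl ?_ hI₁ ?_ ?_).mono
    le_rfl ?_
  · exact fun j s c h => h
  · intro j s' hf hj
    have := hs₁.frame hf rfl rfl
    simp [hj, this.inp]
  · intro q s₂ hq hf₂ hq₂ hI₂
    have hs₂ := hs₁.frame hf₂ rfl rfl
    refine (Runs.for₀ (fun j s' => BuiltBelow f s (2 * (p * n + q) + j) s') (M := 2) (by omega)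
      rfl ?_ hI₂ ?_ ?_).mono le_rfl ?_
    · exact fun j s c h => h
    · intro j s' hf hj
      simp [hj]
    · intro b s₃ hb hf₃ hb₃ hI₃
      have hs₃ := hs₂.frame hf₃ rfl rfl
      have hp₃ : s₃.nat iP 0 = p := by rw [hf₃.1 iP rfl, hf₂.1 iP rfl, hp₁]
      have hq₃ : s₃.nat iQ 0 = q := by rw [hf₃.1 iQ rfl, hq₂]
      refine (buildRow_runs hs₃ hn hN' (by omega) ⟨q, hq⟩ hq₃ (by omega)).mono le_rfl ?_
      rintro s₄ ⟨h₁, h₂⟩ p' q' b' hb' hlt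
      rw [hp₃, hb₃] at h₁ h₂
      by_cases he : rowNum n p' q' b' = rowNum n p q b
      · obtain ⟨rfl, rfl, rfl⟩ := rowNum_inj (q' := ⟨q, hq⟩) hb' hb he
        rw [← target_frame hf₁ rfl rfl rfl rfl, ← target_frame hf₂ rfl rfl rfl rfl,
          ← target_frame hf₃ rfl rfl rfl rfl]
        exact h₁
      · exact h₂ _ he _ (hI₃ p' q' b' hb' (by unfold rowNum at *; omega))
    · intro s' h
      rwa [show 2 * (p * n + (q + 1)) = 2 * (p * n + q) + 2 by ring]
  · intro s' h
    rwa [show 2 * ((p + 1) * n) = 2 * (p * n + n) by ring]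

/-! ### One step of multiplicative weights, and one round -/

theorem Static.pairs (hs : Static n s) (hn : 1 ≤ n) : NExp.pairs.eval s = (n + 1) * n := by
  simp [hs.inp, hs.mul_of_le hn le_rfl]

theorem answer_real_of_ne (s : State) (m Q A a : ℕ) (h : a ≠ A) :
    (s.answer f m Q A).real a = s.real a := Function.update_of_ne h _ _

theorem answer_real_self (s : State) (m Q A i : ℕ) (h : i < m) :
    (s.answer f m Q A).real A i = f (s.row n Q i) := by
  simp [State.answer, h]

theorem computeSteps_runs (hs : Static n s) (hn : 1 ≤ n) (hN : (n + 1) * n ≤ N) :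
    Runs f N computeSteps s 0 fun s' => ∀ j < (n + 1) * n, s'.real aStep j =
      max (s.real aAns (j + j + 1) - s.real aAns (j + j) +
          s.real aPhi 0 * (1 - (s.real aCnt (j + j + 1) - s.real aCnt (j + j))))
        (-(3 * s.nat aK 0 * s.real aPhi 0)) / (288 * s.nat aK 0 ^ 4 * s.real aPhi 0) := by
  refine Runs.fillReal _ hN rfl ?_ ?_
  · intro j s' hf hj
    have := (hs.frame hf rfl rfl).pairs hn
    simp only [BExp.Holds, this]
    simp [hj]
  · intro j s' hj hf hjv _
    have e₁ : s'.real aAns = s.real aAns := hf.2 _ rfl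
    have e₂ : s'.real aCnt = s.real aCnt := hf.2 _ rfl
    have e₃ : s'.real aPhi = s.real aPhi := hf.2 _ rfl
    have e₄ : s'.nat aK = s.nat aK := hf.1 _ rfl
    have e₅ : RExp.rawGrad.eval s' = s.real aAns (j + j + 1) - s.real aAns (j + j) +
        s.real aPhi 0 * (1 - (s.real aCnt (j + j + 1) - s.real aCnt (j + j))) := by
      simp [e₁, e₂, e₃, hjv]
    have e₆ : (RExp.sub (.lit 0) .level).eval s' = -(3 * s.nat aK 0 * s.real aPhi 0) := by
      simp [e₃, e₄]
    have e₇ : RExp.scale.eval s' = 288 * s.nat aK 0 ^ 4 * s.real aPhi 0 := by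
      simp only [RExp.eval, NExp.eval, e₃, e₄]
      push_cast
      ring
    have e₈ : (NExp.var iV).eval s' = j := hjv
    refine Runs.cond (fun h => Runs.setReal ?_) fun h => Runs.setReal ?_
    · rw [BExp.Holds, e₅, e₆] at h
      rw [writeReal_self, max_eq_right h.le, RExp.eval, e₆, e₇, e₈]
    · rw [BExp.Holds, e₅, e₆, not_lt] at h
      rw [writeReal_self, max_eq_left h, RExp.eval, e₅, e₇, e₈]

theorem updateTotals_runs (hs : Static n s) (hn : 1 ≤ n) (hN : (n + 1) * n ≤ N) :
    Runs f N updateTotals s 0 fun s' => ∀ j < (n + 1) * n,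
      s'.real aTot j = s.real aTot j + s.real aStep j := by
  refine Runs.fillReal _ hN rfl ?_ ?_
  · intro j s' hf hj
    have := (hs.frame hf rfl rfl).pairs hn
    simp only [BExp.Holds, this]
    simp [hj]
  · intro j s' hj hf hjv hold
    have e₁ : s'.real aStep = s.real aStep := hf.2 _ rfl
    refine Runs.setReal ?_
    simp only [writeReal_self, RExp.eval, NExp.eval, e₁, hjv, hold]

theorem updateWeights_runs (hs : Static n s) (hn : 1 ≤ n) (hN : (n + 1) * n ≤ N) :
    Runs f N updateWeights s 0 fun s' => ∀ j < (n + 1) * n,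
      s'.real aWt j = min 1 (s.real aWt j * (1 - s.real aStep j)) := by
  refine Runs.fillReal _ hN rfl ?_ ?_
  · intro j s' hf hj
    have := (hs.frame hf rfl rfl).pairs hn
    simp only [BExp.Holds, this]
    simp [hj]
  · intro j s' hj hf hjv hold
    have e₁ : s'.real aStep = s.real aStep := hf.2 _ rfl
    refine Runs.cond (fun h => Runs.setReal ?_) fun h => Runs.setReal ?_ <;>
      simp only [BExp.Holds, RExp.eval, NExp.eval, e₁, hjv, hold, Nat.cast_one, not_lt] at h
    · simp only [writeReal_self, RExp.eval, NExp.eval, hjv, Nat.cast_one, min_eq_left h.le]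
    · simp only [writeReal_self, RExp.eval, NExp.eval, e₁, hjv, hold, Nat.cast_one,
        min_eq_right h]

/-- After `t` steps, the matrices in memory contain the weights and the totals, for the phase and
the current sets of `s₀`. -/
def AtStep (f : Finset (Fin n) → ℝ) (s₀ : State) (t : ℕ) (s : State) : Prop :=
  ∀ p ≤ n, ∀ q : Fin n,
    s.real aWt (p * n + q) = (phaseOf f s₀).weight (s₀.row n aCur p) t q ∧
      s.real aTot (p * n + q) = (phaseOf f s₀).total (s₀.row n aCur p) t q

theorem two_mul_le {N : ℕ} (h : 2 * n * (n + 1) ≤ N) : (n + 1) * n ≤ N := by nlinarith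

theorem weightStep_runs {s₀ : State} (hs : Static n s) (hn : 1 ≤ n) (hN : 2 * n * (n + 1) ≤ N)
    (hP : phaseOf f s = phaseOf f s₀) (hC : ∀ p, s.row n aCur p = s₀.row n aCur p) {t : ℕ}
    (hI : AtStep f s₀ t s) : Runs f N weightStep s 1 (AtStep f s₀ (t + 1)) := by
  have hN₁ : (n + 1) * n ≤ N := two_mul_le hN
  have hN₂ : n + 1 ≤ N := le_trans (Nat.le_mul_of_pos_right _ hn) hN₁
  have em : 2 * n * (n + 1) = (n + 1) * n + (n + 1) * n := by ring
  refine Runs.seq₀ ((buildRows_runs hs hn hN₂).imp ?_)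
  intro s₁ hf₁ hB
  have hs₁ := hs.frame hf₁ rfl rfl
  have hpairs : (NExp.add .pairs .pairs).eval s₁ = 2 * n * (n + 1) := by
    rw [NExp.eval, hs₁.pairs hn, em]
  refine Runs.seq (r₂ := 0) (Runs.query hpairs.le hN hN₂ ?_)
  rw [hpairs]
  set s₂ := s₁.answer f (2 * n * (n + 1)) aQry aAns with hs₂def
  have hs₂ : Static n s₂ := hs₁.congr rfl rfl
  refine Runs.seq₀ ((computeSteps_runs hs₂ hn hN₁).imp fun s₃ hf₃ h₃ => ?_)
  have hs₃ := hs₂.frame hf₃ rfl rfl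
  refine Runs.seq₀ ((updateTotals_runs hs₃ hn hN₁).imp fun s₄ hf₄ h₄ => ?_)
  refine (updateWeights_runs (hs₃.frame hf₄ rfl rfl) hn hN₁).imp fun s₅ hf₅ h₅ => ?_
  intro p hp q
  have hj := pair_lt hp q.2
  obtain ⟨hw, ht⟩ := hI p hp q
  have hwt : wt n s p = (phaseOf f s₀).weight (s₀.row n aCur p) t := by
    ext v; exact (hI p hp v).1
  -- the computed entry is the one of the analysis
  have hstep : s₃.real aStep (p * n + q) =
      (phaseOf f s₀).step (s₀.row n aCur p) ((phaseOf f s₀).weight (s₀.row n aCur p) t) q := by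
    have hq := fun b (hb : b < 2) => hB p q b hb (by
      have := rowNum_lt (n := n) hp q.2 hb
      rwa [show 2 * ((n + 1) * n) = 2 * n * (n + 1) by ring])
    have hans : ∀ b < 2, s₂.real aAns (rowNum n p q b) = f (target f s p q b) := fun b hb => by
      rw [hs₂def, answer_real_self _ _ _ _ _ (rowNum_lt hp q.2 hb), (hq b hb).1]
    have hcnt : ∀ b < 2, s₂.real aCnt (rowNum n p q b) = (target f s p q b).card := fun b hb => by
      rw [hs₂def, answer_real_of_ne _ _ _ _ _ (by decide), (hq b hb).2]
    have a₀ := hans 0 two_pos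
    have a₁ := hans 1 one_lt_two
    have c₀ := hcnt 0 two_pos
    have c₁ := hcnt 1 one_lt_two
    simp only [rowNum, add_zero] at a₀ a₁ c₀ c₁
    have eφ : s₂.real aPhi 0 = (phaseOf f s₀).φ := by
      rw [← hP, hs₂def, answer_real_of_ne _ _ _ _ _ (by decide), hf₁.2 aPhi rfl]; rfl
    have eK : s₂.nat aK 0 = (phaseOf f s₀).K := by
      rw [← hP]; exact congrFun (hf₁.1 aK rfl) 0
    rw [h₃ _ hj, a₀, a₁, c₀, c₁, eφ, eK]
    simp only [target, hwt, hC, hP]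
    rfl
  have w₃ : s₄.real aWt = s.real aWt :=
    (hf₄.2 _ rfl).trans ((hf₃.2 _ rfl).trans (hf₁.2 _ rfl))
  have t₃ : s₃.real aTot = s.real aTot := (hf₃.2 _ rfl).trans (hf₁.2 _ rfl)
  constructor
  · rw [h₅ _ hj, w₃, hw, hf₄.2 aStep rfl, hstep]
    rfl
  · rw [hf₅.2 aTot rfl, h₄ _ hj, t₃, ht, hstep, Phase.total, Phase.total, Finset.sum_range_succ]

theorem initWeights_runs (hs : Static n s) (hn : 1 ≤ n) (hN : (n + 1) * n ≤ N) :
    Runs f N initWeights s 0 fun s' => ∀ j < (n + 1) * n,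
      s'.real aWt j = ((1 - s.nat aCur j : ℕ) : ℝ) / n := by
  refine Runs.fillReal _ hN rfl ?_ ?_
  · intro j s' hf hj
    have := (hs.frame hf rfl rfl).pairs hn
    simp only [BExp.Holds, this]
    simp [hj]
  · intro j s' hj hf hjv _
    have e₁ : s'.nat aCur = s.nat aCur := hf.1 _ rfl
    refine Runs.setReal ?_
    simp only [writeReal_self, RExp.eval, NExp.eval, e₁, hjv, (hs.frame hf rfl rfl).inp]

theorem initTotals_runs (hs : Static n s) (hn : 1 ≤ n) (hN : (n + 1) * n ≤ N) :
    Runs f N initTotals s 0 fun s' => ∀ j < (n + 1) * n, s'.real aTot j = 0 := by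
  refine Runs.fillReal _ hN rfl ?_ ?_
  · intro j s' hf hj
    have := (hs.frame hf rfl rfl).pairs hn
    simp only [BExp.Holds, this]
    simp [hj]
  · intro j s' hj hf hjv _
    refine Runs.setReal ?_
    simp [writeReal_self, hjv]

theorem weightLoop_runs (hs : Static n s) (hn : 1 ≤ n) (hN : 2 * n * (n + 1) ≤ N)
    (hT : Phase.steps (s.nat aK 0) (s.nat aLam 0) ≤ N) (hI : AtStep f s 0 s) :
    Runs f N weightLoop s (Phase.steps (s.nat aK 0) (s.nat aLam 0))
      (AtStep f s (Phase.steps (s.nat aK 0) (s.nat aLam 0))) := by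
  have := Runs.for (f := f) (i := iT) (b := .realLt (.cast (.var iT)) .steps) (p := weightStep)
    (s := s) (r := 1) (fun j s' => AtStep f s j s') hT rfl (fun j s c h => h) hI ?_ ?_
  · rwa [mul_one] at this
  · intro j s' hf hj
    have e₁ : s'.nat aK = s.nat aK := hf.1 _ rfl
    have e₂ : s'.nat aLam = s.nat aLam := hf.1 _ rfl
    have : RExp.steps.eval s' = (Phase.steps (s.nat aK 0) (s.nat aLam 0) : ℕ) := by
      simp only [RExp.eval, NExp.eval, e₁, e₂, Phase.steps]
      push_cast
      ring
    simp only [BExp.Holds, this]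
    simp [hj]
  · intro j s' hj hf hjv hI'
    exact weightStep_runs (hs.frame hf rfl rfl) hn hN
      (phaseOf_congr (hf.2 _ rfl) (hf.1 _ rfl) (hf.1 _ rfl) (hf.1 _ rfl))
      (fun p => row_congr (hf.1 aCur rfl) p) hI'

theorem addBase_runs (hs : Static n s) (hn : 1 ≤ n) (hN : n ≤ N) (hp : s.nat iP 0 ≤ n)
    (q : Fin n) (hq : s.nat iQ 0 = q) :
    Runs f N addBase s 0 fun s' =>
      s'.row n aCur (s.nat iP 0) = s.row n aCur (s.nat iP 0) ∪ s.row n aBase (q + 1) ∧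
      ∀ p, p ≠ s.nat iP 0 → s'.row n aCur p = s.row n aCur p := by
  refine (Runs.fillNat (a := aCur) (s.nat iP 0 * n)
    (fun j => s.nat aCur (s.nat iP 0 * n + j) + s.nat aBase ((q + 1) * n + j)) hN rfl (by decide)
      ?_ ?_).mono le_rfl ?_
  · intro j s' hf hj
    have := hs.frame hf rfl rfl
    simp [hj, this.inp]
  · intro j s' hj hf hjv hold
    have hs' := hs.frame hf rfl rfl
    have e₁ : s'.nat iP = s.nat iP := hf.1 _ rfl
    have e₂ : s'.nat iQ = s.nat iQ := hf.1 _ rfl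
    have e₃ : s'.nat aBase = s.nat aBase := hf.1 _ rfl
    refine Runs.setNat ?_
    simp only [writeNat_self, NExp.eval, e₁, e₂, e₃, hjv, hq,
      hs'.mul_of_le hn (hp.trans (Nat.le_succ n)),
      hs'.mul_of_le hn (i := q + 1) (by omega), hold]
  · intro s' h
    obtain ⟨h₁, h₂⟩ := row_of_fill (g := fun j =>
      s.nat aCur (s.nat iP 0 * n + j) + s.nat aBase ((q + 1) * n + j)) h
    refine ⟨?_, h₂⟩
    ext v
    rw [h₁, Finset.mem_union, mem_row, mem_row]
    omega

theorem growRow_runs (hs : Static n s) (hn : 1 ≤ n) (hN : n ≤ N) (hp : s.nat iP 0 ≤ n)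
    {P : Phase n} (hP : phaseOf f s = P) {C : Finset (Fin n)} (hC : s.row n aCur (s.nat iP 0) = C)
    (hZ : ∀ q : Fin n, s.real aTot (s.nat iP 0 * n + q) =
      P.total C (Phase.steps P.K (s.nat aLam 0)) q) :
    Runs f N growRow s 0 fun s' =>
      P.Round (s.nat aLam 0) C (s'.row n aCur (s.nat iP 0)) ∧
      ∀ p, p ≠ s.nat iP 0 → s'.row n aCur p = s.row n aCur p := by
  set Λ := s.nat aLam 0 with hΛ
  have hK : s.nat aK 0 = P.K := by rw [← hP]; rfl
  refine Runs.seq₀ (Runs.setNat ?_)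
  refine (Runs.for₀ (fun j s' => (∀ p, p ≠ s.nat iP 0 → s'.row n aCur p = s.row n aCur p) ∧
    ((s'.nat aFound 0 = 0 ∧ s'.row n aCur (s.nat iP 0) = C ∧
        ∀ q : Fin n, (q : ℕ) < j → q ∉ C → -(6 * P.K * Λ : ℝ) ≤ P.total C (Phase.steps P.K Λ) q) ∨
      (s'.nat aFound 0 = 1 ∧ ∃ q, q ∉ C ∧ P.total C (Phase.steps P.K Λ) q < -(6 * P.K * Λ) ∧
        s'.row n aCur (s.nat iP 0) = C ∪ P.base q))) hN rfl ?_ ?_ ?_ ?_).mono le_rfl ?_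
  · exact fun j s c h => h
  · exact ⟨fun p _ => rfl, Or.inl ⟨by simp [writeNat_self], hC,
      fun q hq => absurd hq (Nat.not_lt_zero _)⟩⟩
  · intro j s' hf hj
    have : s'.nat aInp = s.nat aInp := hf.1 _ rfl
    simp [hj, this, hs.inp]
  · rintro j s' hj hf hjv ⟨hother, hI⟩
    have e₁ : s'.nat iP = s.nat iP := hf.1 _ rfl
    have e₂ : s'.nat aLam = s.nat aLam := hf.1 _ rfl
    have e₃ : s'.nat aK = s.nat aK := hf.1 _ rfl
    have e₄ : s'.real aTot = s.real aTot := hf.2 _ rfl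
    have e₅ : s'.nat aBase = s.nat aBase := hf.1 _ rfl
    have hs' : Static n s' := hs.congr (hf.1 _ rfl) (hf.1 _ rfl)
    have hmul := hs'.mul_of_le hn (hp.trans (Nat.le_succ n))
    have hcell : s'.nat aCur (s.nat iP 0 * n + j) ≠ 0 ↔
        (⟨j, hj⟩ : Fin n) ∈ s'.row n aCur (s.nat iP 0) := by rw [mem_row]
    have hb : (BExp.and (.not (.pos (.var aFound)))
          (.and (.not (.pos (.get aCur .pq)))
            (.realLt (.get aTot .pq)
              (.sub (.lit 0) (.mul (.mul (.lit 6) (.cast (.var aK))) (.cast (.var aLam))))))).Holds s' ↔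
        s'.nat aFound 0 = 0 ∧ (⟨j, hj⟩ : Fin n) ∉ s'.row n aCur (s.nat iP 0) ∧
          P.total C (Phase.steps P.K Λ) ⟨j, hj⟩ < -(6 * P.K * Λ) := by
      rw [← hcell, ← hZ ⟨j, hj⟩, ← hK]
      simp only [BExp.Holds, NExp.eval, RExp.eval, e₁, e₂, e₃, e₄, hjv, hmul, ← hΛ,
        Nat.pos_iff_ne_zero, not_not]
      push_cast
      rw [zero_sub]
    refine Runs.cond (fun h => ?_) fun h => Runs.skip ⟨hother, ?_⟩
    · obtain ⟨h₁, h₂, h₃⟩ := hb.1 h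
      rcases hI with ⟨_, hrow, _⟩ | ⟨hone, _⟩
      · refine Runs.seq₀ (Runs.setNat ?_)
        refine (addBase_runs (s := s'.writeNat aFound ((NExp.lit 0).eval s')
          ((NExp.lit 1).eval s')) (hs'.congr rfl rfl) hn hN (by rw [← e₁] at hp; exact hp) ⟨j, hj⟩
          hjv).imp ?_
        rintro s'' hf'' ⟨h₄, h₅⟩
        have e₆ : (s'.writeNat aFound ((NExp.lit 0).eval s') ((NExp.lit 1).eval s')).nat iP 0 =
          s.nat iP 0 := congrFun e₁ 0
        rw [e₆] at h₄ h₅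
        refine ⟨fun p hp => (h₅ p hp).trans (hother p hp), Or.inr ⟨?_, ⟨j, hj⟩, ?_, h₃, ?_⟩⟩
        · rw [hf''.1 aFound rfl]; simp [writeNat_self]
        · rwa [hrow] at h₂
        · rw [h₄]
          have : ∀ i, (s'.writeNat aFound ((NExp.lit 0).eval s') ((NExp.lit 1).eval s')).row n
              aCur i = s'.row n aCur i := fun i => rfl
          rw [this, hrow, ← hP]
          congr 1
          exact row_congr e₅ _
      · omega
    · rcases hI with ⟨hz, hrow, hall⟩ | hfound
      · refine Or.inl ⟨hz, hrow, fun q hq hqC => ?_⟩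
        rcases Nat.lt_succ_iff_lt_or_eq.1 hq with hq | hq
        · exact hall q hq hqC
        · subst hq
          by_contra hcon
          exact h (hb.2 ⟨hz, by rw [hrow]; exact hqC, not_le.1 hcon⟩)
      · exact Or.inr hfound
  · rintro s' ⟨h₁, ⟨_, h₂, h₃⟩ | ⟨_, h₂⟩⟩
    · exact ⟨Or.inl ⟨h₂, fun q => h₃ q q.2⟩, h₁⟩
    · exact ⟨Or.inr h₂, h₁⟩

theorem growRows_runs {s₀ : State} (hs : Static n s) (hn : 1 ≤ n) (hN : n + 1 ≤ N)
    (hP : phaseOf f s = phaseOf f s₀) (hC : ∀ p, s.row n aCur p = s₀.row n aCur p)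
    (hI : AtStep f s₀ (Phase.steps (s.nat aK 0) (s.nat aLam 0)) s) :
    Runs f N growRows s 0 fun s' => ∀ p ≤ n,
      (phaseOf f s₀).Round (s.nat aLam 0) (s₀.row n aCur p) (s'.row n aCur p) := by
  refine (Runs.for₀ (fun j s' => ∀ p ≤ n,
      (p < j → (phaseOf f s₀).Round (s.nat aLam 0) (s₀.row n aCur p) (s'.row n aCur p)) ∧
      (j ≤ p → s'.row n aCur p = s₀.row n aCur p)) hN rfl ?_ ?_ ?_ ?_).mono le_rfl ?_
  · exact fun j s c h => h
  · exact fun p _ => ⟨fun h => absurd h (Nat.not_lt_zero _), fun _ => hC p⟩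
  · intro j s' hf hj
    have := hs.frame hf rfl rfl
    simp [hj, this.inp]
  · intro j s' hj hf hjp hI'
    have hP' : phaseOf f s' = phaseOf f s₀ := by
      rw [← hP]; exact phaseOf_congr (hf.2 _ rfl) (hf.1 _ rfl) (hf.1 _ rfl) (hf.1 _ rfl)
    have eL : s'.nat aLam 0 = s.nat aLam 0 := congrFun (hf.1 aLam rfl) 0
    have eK : (phaseOf f s₀).K = s.nat aK 0 := by rw [← hP]; rfl
    refine (growRow_runs (hs.frame hf rfl rfl) hn (by omega) (by omega) hP'
      (C := s₀.row n aCur j) (by rw [hjp]; exact (hI' j (by omega)).2 le_rfl) ?_).mono le_rfl ?_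
    · intro q
      rw [hf.2 aTot rfl, hjp, eL, eK]
      exact (hI j (by omega) q).2
    · rintro s'' ⟨h₁, h₂⟩ p hp
      rw [hjp, eL] at h₁
      rw [hjp] at h₂
      constructor
      · intro hpj
        rcases Nat.lt_succ_iff_lt_or_eq.1 hpj with hpj | rfl
        · rw [h₂ p (by omega)]
          exact (hI' p hp).1 hpj
        · exact h₁
      · intro hpj
        rw [h₂ p (by omega)]
        exact (hI' p hp).2 (by omega)
  · exact fun s' h p hp => (h p hp).1 (by omega)

theorem roundProgram_runs (hs : Static n s) (hn : 1 ≤ n) (hN : 2 * n * (n + 1) ≤ N)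
    (hT : Phase.steps (s.nat aK 0) (s.nat aLam 0) ≤ N) :
    Runs f N roundProgram s (Phase.steps (s.nat aK 0) (s.nat aLam 0)) fun s' => ∀ p ≤ n,
      (phaseOf f s).Round (s.nat aLam 0) (s.row n aCur p) (s'.row n aCur p) := by
  have hN₁ : (n + 1) * n ≤ N := two_mul_le hN
  have hN₂ : n + 1 ≤ N := le_trans (Nat.le_mul_of_pos_right _ hn) hN₁
  refine Runs.seq₀ ((initWeights_runs hs hn hN₁).imp fun s₁ hf₁ h₁ => ?_)
  have hs₁ := hs.frame hf₁ rfl rfl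
  refine Runs.seq₀ ((initTotals_runs hs₁ hn hN₁).imp fun s₂ hf₂ h₂ => ?_)
  have hs₂ := hs₁.frame hf₂ rfl rfl
  have hP₂ : phaseOf f s₂ = phaseOf f s :=
    (phaseOf_congr (hf₂.2 _ rfl) (hf₂.1 _ rfl) (hf₂.1 _ rfl) (hf₂.1 _ rfl)).trans
      (phaseOf_congr (hf₁.2 _ rfl) (hf₁.1 _ rfl) (hf₁.1 _ rfl) (hf₁.1 _ rfl))
  have hC₂ : ∀ p, s₂.row n aCur p = s.row n aCur p := fun p =>
    row_congr ((hf₂.1 _ rfl).trans (hf₁.1 _ rfl)) p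
  have hK₂ : s₂.nat aK = s.nat aK := (hf₂.1 _ rfl).trans (hf₁.1 _ rfl)
  have hL₂ : s₂.nat aLam = s.nat aLam := (hf₂.1 _ rfl).trans (hf₁.1 _ rfl)
  have hI : AtStep f s₂ 0 s₂ := by
    intro p hp q
    have hj := pair_lt hp q.2
    refine ⟨?_, by rw [h₂ _ hj]; simp [Phase.total]⟩
    rw [hf₂.2 aWt rfl, h₁ _ hj, hC₂]
    change _ = if q ∈ s.row n aCur p then (0 : ℝ) else 1 / n
    by_cases hq : q ∈ s.row n aCur p
    · rw [if_pos hq]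
      rw [mem_row] at hq
      rw [show 1 - s.nat aCur (p * n + q) = 0 by omega]
      simp
    · rw [if_neg hq]
      rw [mem_row, not_not] at hq
      rw [hq]
      simp
  have hloop := weightLoop_runs (f := f) hs₂ hn hN (by rw [hK₂, hL₂]; exact hT) hI
  rw [← hK₂, ← hL₂, ← hP₂]
  refine Runs.seq (r₂ := 0) (hloop.imp fun s₃ hf₃ h₃ => ?_)
  have eK : s₃.nat aK = s₂.nat aK := hf₃.1 _ rfl
  have eL : s₃.nat aLam = s₂.nat aLam := hf₃.1 _ rfl
  refine (growRows_runs (hs₂.frame hf₃ rfl rfl) hn hN₂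
    (phaseOf_congr (hf₃.2 _ rfl) (hf₃.1 _ rfl) (hf₃.1 _ rfl) (hf₃.1 _ rfl))
    (fun p => row_congr (hf₃.1 aCur rfl) p) (by rw [eK, eL]; exact h₃)).mono le_rfl ?_
  intro s₄ h₄ p hp
  have := h₄ p hp
  rwa [eL, hC₂] at this

/-! ### One phase -/

theorem copyBase_runs (hs : Static n s) (hn : 1 ≤ n) (hN : (n + 1) * n ≤ N) :
    Runs f N copyBase s 0 fun s' => ∀ p ≤ n, s'.row n aBase p = s.row n aCur p := by
  refine (Runs.fillNat (a := aBase) 0 (s.nat aCur) hN rfl (by decide) ?_ ?_).mono le_rfl ?_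
  · intro j s' hf hj
    have := (hs.frame hf rfl rfl).pairs hn
    simp only [BExp.Holds, this]
    simp [hj]
  · intro j s' hj hf hjv _
    have e₁ : s'.nat aCur = s.nat aCur := hf.1 _ rfl
    refine Runs.setNat ?_
    simp only [writeNat_self, NExp.eval, e₁, hjv, zero_add]
  · intro s' h p hp
    ext v
    rw [mem_row, mem_row, h, if_pos ⟨Nat.zero_le _, by rw [zero_add]; exact pair_lt hp v.2⟩,
      Nat.sub_zero]

theorem kill_runs (hs : Static n s) (hN : n ≤ N) :
    Runs f N kill s 0 fun s' => ∀ q : Fin n, q ∈ s'.row n aDead 0 ↔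
      q ∈ s.row n aDead 0 ∨
        s.real aAns 0 + s.real aPhi 0 / 4 < s.real aAns (q + 1) := by
  classical
  refine (Runs.fillNat (a := aDead) 0 (fun j =>
    if s.real aAns 0 + s.real aPhi 0 / 4 < s.real aAns (j + 1) then 1 else s.nat aDead j)
      hN rfl (by decide) ?_ ?_).mono le_rfl ?_
  · intro j s' hf hj
    have := hs.frame hf rfl rfl
    simp [hj, this.inp]
  · intro j s' hj hf hjv hold
    have e₁ : s'.real aAns = s.real aAns := hf.2 _ rfl
    have e₂ : s'.real aPhi = s.real aPhi := hf.2 _ rfl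
    rw [zero_add] at hold ⊢
    refine Runs.cond (fun h => Runs.setNat ?_) fun h => Runs.skip ?_ <;>
      simp only [BExp.Holds, RExp.eval, NExp.eval, e₁, e₂, hjv, Nat.cast_ofNat] at h
    · rw [writeNat_self, if_pos h]
      simp [hjv]
    · rw [if_neg h, ← hold, Function.update_eq_self]
  · intro s' h q
    rw [mem_row, mem_row, h, if_pos ⟨Nat.zero_le _, by have := q.2; omega⟩, Nat.sub_zero, zero_mul,
      zero_add]
    split_ifs with h' <;> simp [h']

theorem phaseProgram_runs (hs : Static n s) (hn : 1 ≤ n) (hN : 2 * n * (n + 1) ≤ N)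
    (hK : s.nat aK 0 + 1 ≤ N) (hT : Phase.steps (s.nat aK 0) (s.nat aLam 0) ≤ N) :
    Runs f N phaseProgram s
      ((s.nat aK 0 + 1) * Phase.steps (s.nat aK 0) (s.nat aLam 0) + 1) fun s' =>
        s'.real aPhi 0 = s.real aPhi 0 / 2 ∧
        (∀ p ≤ n, Phase.Rounds ⟨f, s.real aPhi 0, s.nat aK 0,
          fun v => s.row n aCur (v + 1), s.row n aDead 0⟩ (s.nat aLam 0) (s.nat aK 0 + 1)
            (s.row n aCur p) (s'.row n aCur p)) ∧
        ∀ q : Fin n, q ∈ s'.row n aDead 0 ↔ q ∈ s.row n aDead 0 ∨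
          f (s'.row n aCur 0) + s.real aPhi 0 / 4 < f (s'.row n aCur (q + 1)) := by
  have hN₁ : (n + 1) * n ≤ N := two_mul_le hN
  have hN₂ : n + 1 ≤ N := le_trans (Nat.le_mul_of_pos_right _ hn) hN₁
  set P : Phase n := ⟨f, s.real aPhi 0, s.nat aK 0, fun v => s.row n aCur (v + 1),
    s.row n aDead 0⟩ with hP
  refine Runs.seq₀ ((copyBase_runs hs hn hN₁).imp fun s₁ hf₁ h₁ => ?_)
  have hs₁ := hs.frame hf₁ rfl rfl
  have hP₁ : phaseOf f s₁ = P := by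
    rw [hP, phaseOf, hf₁.2 aPhi rfl, hf₁.1 aK rfl, row_congr (hf₁.1 aDead rfl)]
    congr 1
    funext v
    exact h₁ _ (by omega)
  have eK₁ : s₁.nat aK = s.nat aK := hf₁.1 _ rfl
  have eL₁ : s₁.nat aLam = s.nat aLam := hf₁.1 _ rfl
  have hloop := Runs.for (f := f) (N := N) (i := iR)
    (b := .natLt (.var iR) (.add (.var aK) (.lit 1))) (p := roundProgram) (s := s₁)
    (r := Phase.steps (s.nat aK 0) (s.nat aLam 0)) (M := s.nat aK 0 + 1)
    (fun j s' => ∀ p ≤ n, P.Rounds (s.nat aLam 0) j (s.row n aCur p) (s'.row n aCur p)) hK rfl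
    (fun j s c h => h) (fun p _ => row_congr (hf₁.1 aCur rfl) p)
    (fun j s' hf hj => by
      have : s'.nat aK = s.nat aK := (hf.1 _ rfl).trans eK₁
      simp [hj, this])
    (fun j s' hj hf hjv hI => by
      have eK : s'.nat aK = s.nat aK := (hf.1 _ rfl).trans eK₁
      have eL : s'.nat aLam = s.nat aLam := (hf.1 _ rfl).trans eL₁
      have hP' : phaseOf f s' = P := by
        rw [← hP₁]; exact phaseOf_congr (hf.2 _ rfl) (hf.1 _ rfl) (hf.1 _ rfl) (hf.1 _ rfl)
      have := roundProgram_runs (f := f) (hs₁.frame hf rfl rfl) hn hN (by rw [eK, eL]; exact hT)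
      rw [eK, eL, hP'] at this
      exact this.mono le_rfl fun s'' h p hp => ⟨_, hI p hp, h p hp⟩)
  refine Runs.seq (hloop.imp fun s₂ hf₂ h₂ => ?_)
  have hs₂ := hs₁.frame hf₂ rfl rfl
  have hm : (NExp.add .size (.lit 1)).eval s₂ = n + 1 := by simp [hs₂.inp]
  refine Runs.seq (r₁ := 1) (r₂ := 0) (Runs.query (by rw [hm]; nlinarith) hN hN₂ ?_)
  rw [hm]
  set s₃ := s₂.answer f (n + 1) aCur aAns with hs₃def
  have hs₃ : Static n s₃ := hs₂.congr rfl rfl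
  refine Runs.seq₀ ((kill_runs hs₃ (by omega)).imp fun s₄ hf₄ h₄ => Runs.setReal ?_)
  have hφ₃ : s₃.real aPhi 0 = s.real aPhi 0 := by
    rw [hs₃def, answer_real_of_ne _ _ _ _ _ (by decide), hf₂.2 aPhi rfl, hf₁.2 aPhi rfl]
  have hC₄ : s₄.nat aCur = s₂.nat aCur := hf₄.1 aCur rfl
  have hrow : ∀ i, (s₄.writeReal aPhi ((NExp.lit 0).eval s₄)
      ((RExp.div (.var aPhi) (.lit 2)).eval s₄)).row n aCur i = s₂.row n aCur i :=
    fun i => row_congr hC₄ i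
  refine ⟨?_, fun p hp => ?_, fun q => ?_⟩
  · rw [writeReal_self]
    simp [hf₄.2 aPhi rfl, hφ₃]
  · rw [hrow]
    exact h₂ p hp
  · have hD : s₃.row n aDead 0 = s.row n aDead 0 :=
      row_congr ((hf₂.1 aDead rfl).trans (hf₁.1 aDead rfl)) 0
    have h := h₄ q
    rw [hφ₃, hD, hs₃def, answer_real_self _ _ _ _ _ (Nat.succ_pos n),
      answer_real_self _ _ _ _ _ (Nat.succ_lt_succ q.2)] at h
    rw [hrow, hrow]
    exact h

theorem Phase.Rounds.subset {P : Phase n} {Λ r : ℕ} {C C' : Finset (Fin n)}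
    (h : P.Rounds Λ r C C') : C ⊆ C' := by
  induction r generalizing C' with
  | zero => exact h.symm.subset
  | succ r ih =>
    obtain ⟨D, hD, ⟨rfl, _⟩ | ⟨q, _, _, rfl⟩⟩ := h
    · exact ih hD
    · exact (ih hD).trans Finset.subset_union_left

/-- The invariant of the phases, for a fixed sparse minimizer `S`: the set `C 0` is contained in
`S`, each element `v` of `S` forces `C (v + 1)`, and all these sets, for `v` alive, have values
within `φ` of the minimum. -/
structure Inv (f : Finset (Fin n) → ℝ) (S : Finset (Fin n)) (φ : ℝ) (C : ℕ → Finset (Fin n))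
    (dead : Finset (Fin n)) : Prop where
  bot_subset : C 0 ⊆ S
  bot_le : f (C 0) ≤ minValue f + φ
  mem : ∀ v : Fin n, v ∈ C (v + 1)
  le : ∀ v : Fin n, v ∉ dead → f (C (v + 1)) ≤ minValue f + φ
  forced : ∀ v ∈ S, v ∉ dead ∧ C (v + 1) ⊆ S

/-- A phase halves the scale.  The elements with large values are discarded: for the elements of
`S` the value is within `φ / 4` of the minimum, hence within `φ / 4` of the value of `C' 0`. -/
theorem Inv.next {S : Finset (Fin n)} {φ : ℝ} {C C' : ℕ → Finset (Fin n)}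
    {dead dead' : Finset (Fin n)} {K Λ : ℕ} (h : Inv f S φ C dead) (hf : Submodular f)
    (hn : 1 ≤ n) (hφ : 0 < φ) (hK : 1 ≤ K) (hcard : S.card ≤ K) (hmin : f S = minValue f)
    (hΛ : Real.log n + 1 ≤ Λ)
    (hr : ∀ p ≤ n, Phase.Rounds ⟨f, φ, K, fun v => C (v + 1), dead⟩ Λ (K + 1) (C p) (C' p))
    (hdead : ∀ q : Fin n, q ∈ dead' ↔ q ∈ dead ∨ f (C' 0) + φ / 4 < f (C' (q + 1))) :
    Inv f S (φ / 2) C' dead' := by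
  have hv : Phase.Valid ⟨f, φ, K, fun v => C (v + 1), dead⟩ S :=
    ⟨hf, hφ, hK, hcard, hmin, h.mem, h.le, h.forced⟩
  obtain ⟨h₁, h₂⟩ := hv.rounds hn hΛ h.bot_subset h.bot_le (hr 0 (Nat.zero_le n))
  have h₃ : f (C' 0) ≤ minValue f + φ / 4 := h₂
  refine ⟨h₁, by linarith, fun v => (hr (v + 1) v.2).subset (h.mem v), fun v hvd => ?_,
    fun v hvS => ?_⟩
  · rw [hdead, not_or, not_lt] at hvd
    linarith [hvd.2]
  · obtain ⟨h₄, h₅⟩ := h.forced v hvS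
    obtain ⟨h₆, h₇⟩ := hv.rounds hn hΛ h₅ (h.le v h₄) (hr (v + 1) v.2)
    have h₈ : f (C' (v + 1)) ≤ minValue f + φ / 4 := h₇
    refine ⟨fun hd => ?_, h₆⟩
    rcases (hdead v).1 hd with hd | hd
    · exact h₄ hd
    · linarith [minValue_le f (C' 0)]

/-! ### Initialization -/

theorem initK_runs (k : ℕ) (h₁ : s.nat aInp 0 = n) (h₂ : s.nat aInp 1 = k) :
    Runs f N initK s 0 fun s' => s'.nat aK 0 = min n k := by
  refine Runs.cond (fun h => Runs.setNat ?_) fun h => Runs.setNat ?_ <;>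
    simp only [BExp.Holds, NExp.eval, h₁, h₂] at h <;>
    simp only [writeNat_self, NExp.eval, h₁, h₂, Function.update_self] <;> omega

theorem initLam_runs (h₁ : s.nat aInp 0 = n) (hN : n ≤ N) :
    Runs f N initLam s 0 fun s' => s'.nat aLam 0 = 1 + Nat.clog 2 n := by
  refine Runs.seq₀ (Runs.setNat (Runs.seq₀ (Runs.setNat ?_)))
  have := Runs.loop (f := f) (N := N) (b := .natLt (.var aPow) .size)
    (p := .seq (.setNat aPow (.lit 0) (.add (.var aPow) (.var aPow)))
        (.setNat aLam (.lit 0) (.add (.var aLam) (.lit 1)))) (r := 0) (M := Nat.clog 2 n)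
    (s := (s.writeNat aPow ((NExp.lit 0).eval s) ((NExp.lit 1).eval s)).writeNat aLam
      ((NExp.lit 0).eval (s.writeNat aPow ((NExp.lit 0).eval s) ((NExp.lit 1).eval s)))
      ((NExp.lit 1).eval (s.writeNat aPow ((NExp.lit 0).eval s) ((NExp.lit 1).eval s))))
    (fun j s' => s'.nat aInp 0 = n ∧ s'.nat aPow 0 = 2 ^ j ∧ s'.nat aLam 0 = 1 + j) ?_ ?_ ?_ ?_
  · exact this.mono le_rfl fun s' h => h.2.2
  · exact (Nat.clog_le_of_le_pow (Nat.lt_two_pow_self.le)).trans hN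
  · exact ⟨h₁, by simp [State.writeNat], by simp [State.writeNat]⟩
  · rintro j s' _ ⟨a₁, a₂, a₃⟩
    simp only [BExp.Holds, NExp.eval, a₁, a₂]
    exact (Nat.lt_clog_iff_pow_lt one_lt_two).symm
  · rintro j s' _ ⟨a₁, a₂, a₃⟩
    refine Runs.seq₀ (Runs.setNat (Runs.setNat ⟨a₁, ?_, ?_⟩))
    · simp [State.writeNat, a₂, pow_succ]; omega
    · simp [State.writeNat, a₃]; omega

theorem initMul_runs (h₁ : s.nat aInp 0 = n) (h₂ : s.nat aMul 0 = 0)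
    (hN : 2 * n * (n + 1) ≤ N) : Runs f N initMul s 0 (Static n) := by
  refine (Runs.for₀ (fun j s' => s'.nat aInp 0 = n ∧ ∀ i ≤ j, s'.nat aMul i = i * n) hN rfl
    ?_ ?_ ?_ ?_).mono le_rfl fun s' h => ⟨h.1, h.2⟩
  · exact fun j s c h => h
  · refine ⟨h₁, fun i hi => ?_⟩
    obtain rfl : i = 0 := by omega
    rw [h₂, zero_mul]
  · intro j s' hf hj
    have e : s'.nat aInp = s.nat aInp := hf.1 _ rfl
    simp only [BExp.Holds, RExp.eval, NExp.eval, hj, e, h₁]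
    exact_mod_cast Iff.rfl
  · rintro j s' hj hf hjv ⟨a₁, a₂⟩
    refine Runs.setNat ⟨a₁, fun i hi => ?_⟩
    simp only [writeNat_self, NExp.eval, hjv, a₁, a₂ j le_rfl]
    by_cases he : i = j + 1
    · subst he; rw [Function.update_self]; ring
    · rw [Function.update_of_ne he, a₂ i (by omega)]

theorem initCur_runs (hs : Static n s) (hn : 1 ≤ n) (hN : n + 2 ≤ N) :
    Runs f N initCur s 0 fun s' => ∀ p ≤ n + 1, ∀ v : Fin n, v ∈ s'.row n aCur p ↔
      p = v + 1 ∨ p = n + 1 := by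
  refine (Runs.for₀ (fun j s' => ∀ p < j, p ≤ n + 1 → ∀ v : Fin n, v ∈ s'.row n aCur p ↔
      p = v + 1 ∨ p = n + 1) (M := n + 2) hN rfl ?_ ?_ ?_ ?_).mono le_rfl
    fun s' h p hp => h p (by omega) hp
  · exact fun j s c h => h
  · exact fun p hp => absurd hp (Nat.not_lt_zero _)
  · intro j s' hf hj
    have := hs.frame hf rfl rfl
    simp [hj, this.inp]
  · intro p s' hp hf hpv hI
    have hs' := hs.frame hf rfl rfl
    refine (Runs.fillNat (a := aCur) (p * n) (fun j => (1 - ((p - (j + 1)) + ((j + 1) - p))) +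
      (1 - (n + 1 - p))) (M := n) (by omega) rfl (by decide) ?_ ?_).mono le_rfl ?_
    · intro j s'' hf' hj
      have := hs'.frame hf' rfl rfl
      simp [hj, this.inp]
    · intro j s'' hj hf' hjv _
      have hs'' := hs'.frame hf' rfl rfl
      have e : s''.nat iP = s'.nat iP := hf'.1 _ rfl
      refine Runs.setNat ?_
      simp only [writeNat_self, NExp.eval, e, hpv, hjv, hs''.inp,
        hs''.mul_of_le hn (show p ≤ n + 1 by omega)]
    · intro s'' h p' hp' hp'n v
      obtain ⟨a₁, a₂⟩ := row_of_fill (g := fun j => (1 - ((p - (j + 1)) + ((j + 1) - p))) +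
        (1 - (n + 1 - p))) h
      by_cases he : p' = p
      · subst he
        rw [a₁]
        have := v.2
        omega
      · rw [a₂ p' he]
        exact hI p' (by omega) hp'n v

theorem initMax_runs (hs : Static n s) (hN : n + 2 ≤ N) (h₀ : s.real aMax 0 = 0) {B : ℝ}
    (hB₀ : 0 ≤ B) (hB : ∀ i < n + 2, |s.real aAns i| ≤ B) :
    Runs f N initMax s 0 fun s' => s'.real aMax 0 ≤ B ∧
      ∀ i < n + 2, |s.real aAns i| ≤ s'.real aMax 0 := by
  refine Runs.for₀ (fun j s' => s'.real aMax 0 ≤ B ∧ ∀ i < j, |s.real aAns i| ≤ s'.real aMax 0)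
    (M := n + 2) hN rfl ?_ ?_ ?_ ?_
  · exact fun j s c h => h
  · exact ⟨h₀ ▸ hB₀, fun i hi => absurd hi (Nat.not_lt_zero _)⟩
  · intro j s' hf hj
    have := hs.frame hf rfl rfl
    simp [hj, this.inp]
  · rintro j s' hj hf hjv ⟨a₁, a₂⟩
    have e₁ : s'.real aAns = s.real aAns := hf.2 _ rfl
    obtain ⟨hlo, hhi⟩ := abs_le.1 (hB j hj)
    -- after each of the two comparisons the old maximum is still a lower bound
    have first : Runs f N (.cond (.realLt (.var aMax) (.get aAns (.var iV)))
        (.setReal aMax (.lit 0) (.get aAns (.var iV))) .skip) s' 0 fun t =>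
        t.real aMax 0 ≤ B ∧ s'.real aMax 0 ≤ t.real aMax 0 ∧ s.real aAns j ≤ t.real aMax 0 := by
      refine Runs.cond (fun h => Runs.setReal ?_) fun h => Runs.skip ?_ <;>
        simp only [BExp.Holds, RExp.eval, NExp.eval, hjv, e₁] at h
      · simp only [writeReal_self, NExp.eval, RExp.eval, Function.update_self, hjv, e₁]
        exact ⟨hhi, h.le, le_rfl⟩
      · exact ⟨a₁, le_rfl, not_lt.1 h⟩
    refine Runs.seq₀ (first.imp fun t hft ht => ?_)
    obtain ⟨b₁, b₂, b₃⟩ := ht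
    have e₂ : t.real aAns = s.real aAns := by rw [← e₁]; exact hft.2 _ rfl
    have e₃ : t.nat iV 0 = j := by rw [hft.1 iV rfl, hjv]
    have fin : ∀ m : ℝ, t.real aMax 0 ≤ m → -s.real aAns j ≤ m →
        ∀ i < j + 1, |s.real aAns i| ≤ m := by
      intro m hm hm' i hi
      rcases Nat.lt_succ_iff_lt_or_eq.1 hi with hi | rfl
      · exact (a₂ i hi).trans (b₂.trans hm)
      · exact abs_le.2 ⟨by linarith, b₃.trans hm⟩
    refine Runs.cond (fun h => Runs.setReal ?_) fun h => Runs.skip ?_ <;>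
      simp only [BExp.Holds, RExp.eval, NExp.eval, e₃, e₂, Nat.cast_zero, zero_sub, not_lt] at h
    · simp only [writeReal_self, NExp.eval, RExp.eval, Function.update_self, e₃, e₂, Nat.cast_zero,
        zero_sub]
      exact ⟨by linarith, fin _ h.le le_rfl⟩
    · exact ⟨b₁, fin _ le_rfl h⟩

/-- A lower bound of the minimum from the values at `∅`, the singletons and the ground set. -/
theorem le_minValue (hf : Submodular f) {a : ℝ} (h₀ : |f ∅| ≤ a) (h₁ : ∀ v, |f {v}| ≤ a)
    (h₂ : |f Finset.univ| ≤ a) : -(2 * n + 1) * a ≤ minValue f := by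
  have ha : 0 ≤ a := (abs_nonneg _).trans h₀
  refine (Finset.le_inf'_iff _ _).2 fun S _ => ?_
  have key : ∀ D : Finset (Fin n), Disjoint D S → f (D ∪ S) ≤ f S + D.card * (2 * a) := by
    intro D
    induction D using Finset.induction_on with
    | empty => simp
    | insert v D hv ih =>
      intro hD
      rw [Finset.disjoint_insert_left] at hD
      have a₁ := hf ∅ (D ∪ S) (Finset.empty_subset _) v (by simp [hv, hD.1])
      have a₂ := ih hD.2
      have a₃ := (abs_le.1 (h₁ v)).2
      have a₄ := (abs_le.1 h₀).1
      rw [Finset.insert_union, Finset.card_insert_of_notMem hv]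
      rw [insert_empty_eq] at a₁
      push_cast
      linarith
  have h₃ := key Sᶜ disjoint_compl_left
  rw [Finset.union_comm, Finset.union_compl] at h₃
  have h₄ : (Sᶜ.card : ℝ) ≤ n := by
    exact_mod_cast (Finset.card_le_univ _).trans_eq (Fintype.card_fin n)
  have h₅ := mul_le_mul_of_nonneg_right h₄ (by linarith : 0 ≤ 2 * a)
  linarith [(abs_le.1 h₂).1]

theorem initProgram_runs {k : ℕ} {ε : ℝ} (hn : 1 ≤ n) (hN : 2 * n * (n + 1) ≤ N) (hN' : n + 2 ≤ N)
    (hf : Submodular f) (S : Finset (Fin n)) :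
    Runs f N initProgram (input n k ε) 1 fun s => Static n s ∧ s.nat aK 0 = min n k ∧
      s.nat aLam 0 = 1 + Nat.clog 2 n ∧ s.real aEps 0 = ε ∧
      s.real aPhi 0 ≤ (2 * n + 2) * absMax f ∧
      Inv f S (s.real aPhi 0) (fun p => s.row n aCur p) (s.row n aDead 0) := by
  set s₀ := input n k ε
  have i₀ : s₀.nat aInp 0 = n := rfl
  refine Runs.seq₀ ((initK_runs (k := k) i₀ rfl).imp fun s₁ hf₁ h₁ => ?_)
  refine Runs.seq₀ ((initLam_runs (n := n) (by rw [hf₁.1 aInp rfl, i₀]) (by omega)).imp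
    fun s₂ hf₂ h₂ => ?_)
  refine Runs.seq₀ ((initMul_runs (n := n) (by rw [hf₂.1 aInp rfl, hf₁.1 aInp rfl, i₀])
    (by rw [hf₂.1 aMul rfl, hf₁.1 aMul rfl]; rfl) hN).imp fun s₃ hf₃ hs₃ => ?_)
  refine Runs.seq₀ ((initCur_runs hs₃ hn hN').imp fun s₄ hf₄ h₄ => ?_)
  have hs₄ := hs₃.frame hf₄ rfl rfl
  have hm : (NExp.add .size (.lit 2)).eval s₄ = n + 2 := by simp [hs₄.inp]
  refine Runs.seq (r₁ := 1) (r₂ := 0) (Runs.query (by rw [hm]; nlinarith) hN (by omega) ?_)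
  rw [hm]
  set s₅ := s₄.answer f (n + 2) aCur aAns with hs₅def
  have hs₅ : Static n s₅ := hs₄.congr rfl rfl
  have hans : ∀ i < n + 2, s₅.real aAns i = f (s₄.row n aCur i) := fun i hi =>
    answer_real_self _ _ _ _ _ hi
  have hmax₀ : s₅.real aMax 0 = 0 := by
    rw [hs₅def, answer_real_of_ne _ _ _ _ _ (by decide), hf₄.2 aMax rfl, hf₃.2 aMax rfl,
      hf₂.2 aMax rfl, hf₁.2 aMax rfl]
    simp [s₀, input]
  refine Runs.seq₀ ((initMax_runs hs₅ hN' hmax₀ (B := absMax f)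
    ((abs_nonneg _).trans (abs_le_absMax f ∅)) fun i hi => by
      rw [hans i hi]; exact abs_le_absMax f _).imp fun s₆ hf₆ h₆ => ?_)
  have hs₆ := hs₅.frame hf₆ rfl rfl
  refine Runs.setReal ?_
  set a := s₆.real aMax 0 with ha
  have hphi : (RExp.mul (.add (.mul (.lit 2) (.cast .size)) (.lit 2)) (.var aMax)).eval s₆ =
      (2 * n + 2) * a := by
    simp [hs₆.inp, ha]
  rw [hphi]
  set s₇ := s₆.writeReal aPhi ((NExp.lit 0).eval s₆) ((2 * n + 2) * a) with hs₇def
  have hφ : s₇.real aPhi 0 = (2 * n + 2) * a := by simp [hs₇def, writeReal_self]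
  have hrow : ∀ i, s₇.row n aCur i = s₄.row n aCur i := fun i => row_congr (hf₆.1 aCur rfl) i
  have hdead : s₇.row n aDead 0 = ∅ := by
    have : s₇.nat aDead = s₀.nat aDead := (hf₆.1 aDead rfl).trans ((hf₄.1 aDead rfl).trans
      ((hf₃.1 aDead rfl).trans ((hf₂.1 aDead rfl).trans (hf₁.1 aDead rfl))))
    ext v
    rw [mem_row, this]
    simp [s₀, input]
  have hK : s₇.nat aK = s₁.nat aK := (hf₆.1 aK rfl).trans ((hf₄.1 aK rfl).trans
      ((hf₃.1 aK rfl).trans (hf₂.1 aK rfl)))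
  have hL : s₇.nat aLam = s₂.nat aLam := (hf₆.1 aLam rfl).trans ((hf₄.1 aLam rfl).trans
      (hf₃.1 aLam rfl))
  have hE : s₇.real aEps = s₀.real aEps := (hf₆.2 aEps rfl).trans ((hf₄.2 aEps rfl).trans
      ((hf₃.2 aEps rfl).trans ((hf₂.2 aEps rfl).trans (hf₁.2 aEps rfl))))
  have r₀ : s₄.row n aCur 0 = ∅ := by
    ext v
    rw [h₄ 0 (by omega)]
    simp
  have r₁ : ∀ v : Fin n, s₄.row n aCur (v + 1) = {v} := by
    intro v
    ext w
    rw [h₄ _ (by omega), Finset.mem_singleton, Fin.ext_iff]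
    have := v.2
    omega
  have r₂ : s₄.row n aCur (n + 1) = Finset.univ := by
    ext v
    rw [h₄ _ le_rfl]
    simp
  have hval : ∀ i < n + 2, |f (s₄.row n aCur i)| ≤ a := fun i hi => by
    rw [← hans i hi]; exact h₆.2 i hi
  have v₀ : |f ∅| ≤ a := r₀ ▸ hval 0 (by omega)
  have v₁ : ∀ v : Fin n, |f {v}| ≤ a := fun v => r₁ v ▸ hval (v + 1) (by omega)
  have v₂ : |f Finset.univ| ≤ a := r₂ ▸ hval (n + 1) (by omega)
  have hlow := le_minValue hf v₀ v₁ v₂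
  refine ⟨hs₆.congr rfl rfl, by rw [hK, h₁], by rw [hL, h₂], by rw [hE]; rfl, ?_, ?_⟩
  · rw [hφ]
    exact mul_le_mul_of_nonneg_left h₆.1 (by positivity)
  · simp only [hφ, hrow, hdead]
    refine ⟨?_, ?_, ?_, ?_, ?_⟩
    · simp [r₀]
    · rw [r₀]; linarith [(abs_le.1 v₀).2]
    · simp [r₁]
    · intro v _; rw [r₁]; linarith [(abs_le.1 (v₁ v)).2]
    · intro v hv; simp [r₁, hv]

end Program

/-! ### Resources -/

/-- The number of phases, starting from the scale `φ`. -/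
noncomputable def phases (φ ε : ℝ) : ℕ := ⌈Real.logb 2 (φ / ε)⌉₊

theorem lt_phases_iff {φ ε : ℝ} (hφ : 0 ≤ φ) (hε : 0 < ε) (j : ℕ) :
    j < phases φ ε ↔ ε < φ / 2 ^ j := by
  rcases hφ.eq_or_lt with rfl | hφ
  · simp [phases, hε.le]
  · rw [phases, Nat.lt_ceil, Real.lt_logb_iff_rpow_lt one_lt_two (div_pos hφ hε),
      Real.rpow_natCast, lt_div_iff₀ hε, lt_div_iff₀ (by positivity), mul_comm]

theorem half_le_log_two : (1 : ℝ) / 2 ≤ Real.log 2 := by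
  have := Real.log_two_gt_d9
  linarith

theorem half_le_log_succ (hn : 1 ≤ n) : (1 : ℝ) / 2 ≤ Real.log (n + 1) := by
  have : (1 : ℝ) ≤ n := by exact_mod_cast hn
  exact half_le_log_two.trans (Real.log_le_log two_pos (by linarith))

theorem half_le_log_two_add {x : ℝ} (hx : 0 ≤ x) : (1 : ℝ) / 2 ≤ Real.log (2 + x) :=
  half_le_log_two.trans (Real.log_le_log two_pos (by linarith))

/-- Any scale that is at most `(2 n + 2) A` leads to `O(log n · log (2 + A / ε))` phases. -/
theorem phases_le (hn : 1 ≤ n) {φ ε A : ℝ} (hφ : 0 ≤ φ) (hε : 0 < ε) (hA : 0 ≤ A)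
    (h : φ ≤ (2 * n + 2) * A) :
    (phases φ ε : ℝ) ≤ 16 * (Real.log (n + 1) * Real.log (2 + A / ε)) := by
  have hx : 0 ≤ A / ε := by positivity
  have hu := half_le_log_succ hn
  have hL := half_le_log_two_add hx
  have h2 := half_le_log_two
  set u := Real.log (n + 1)
  set L := Real.log (2 + A / ε)
  have hn0 : (0 : ℝ) < n + 1 := by positivity
  rcases hφ.eq_or_lt with rfl | hφ
  · simp only [phases, zero_div, Real.logb_zero, Nat.ceil_zero, Nat.cast_zero]
    positivity
  have h₁ : φ / ε ≤ 2 * ((n + 1) * (2 + A / ε)) := by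
    rw [div_le_iff₀ hε]
    have : A / ε * ε = A := div_mul_cancel₀ A hε.ne'
    nlinarith
  have h₂ : Real.log (φ / ε) ≤ Real.log 2 + (u + L) := by
    refine (Real.log_le_log (div_pos hφ hε) h₁).trans_eq ?_
    rw [Real.log_mul two_ne_zero (by positivity), Real.log_mul hn0.ne' (by positivity)]
  have h₃ : Real.logb 2 (φ / ε) ≤ 1 + 2 * (u + L) := by
    rw [Real.logb, div_le_iff₀ (by linarith)]
    nlinarith
  have h₄ : (phases φ ε : ℝ) ≤ 1 + 2 * (u + L) + 1 := by
    have hc : phases φ ε ≤ ⌈1 + 2 * (u + L)⌉₊ := Nat.ceil_mono h₃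
    have := (Nat.ceil_lt_add_one (by linarith : 0 ≤ 1 + 2 * (u + L))).le
    exact (Nat.cast_le.2 hc).trans this
  nlinarith [mul_nonneg (sub_nonneg.2 hu) (sub_nonneg.2 hL)]

theorem clog_le (hn : 1 ≤ n) : ((1 + Nat.clog 2 n : ℕ) : ℝ) ≤ 6 * Real.log (n + 1) := by
  have hu := half_le_log_succ hn
  rcases hn.eq_or_lt with rfl | hn
  · norm_num at hu ⊢
    linarith
  · have h₁ := Nat.pow_pred_clog_lt_self one_lt_two hn
    have hpos := Nat.clog_pos one_lt_two hn
    obtain ⟨m, hm⟩ : ∃ m, Nat.clog 2 n = m + 1 := ⟨_, (Nat.succ_pred_eq_of_pos hpos).symm⟩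
    rw [hm] at h₁ ⊢
    have h₂ : (2 : ℝ) ^ m ≤ n + 1 := by
      have : 2 ^ m < n := h₁
      exact_mod_cast this.le.trans (Nat.le_succ n)
    have h₃ := Real.log_le_log (by positivity) h₂
    rw [Real.log_pow] at h₃
    have h₄ := mul_le_mul_of_nonneg_left half_le_log_two (Nat.cast_nonneg (α := ℝ) m)
    push_cast
    linarith

theorem log_le_clog (hn : 1 ≤ n) : Real.log n + 1 ≤ ((1 + Nat.clog 2 n : ℕ) : ℝ) := by
  have h₁ : (n : ℝ) ≤ 2 ^ Nat.clog 2 n := by exact_mod_cast Nat.le_pow_clog one_lt_two n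
  have h₂ := Real.log_le_log (by exact_mod_cast hn) h₁
  rw [Real.log_pow] at h₂
  have h₃ : Real.log 2 ≤ 1 := by have := Real.log_two_lt_d9; linarith
  have := mul_le_mul_of_nonneg_left h₃ (Nat.cast_nonneg (α := ℝ) (Nat.clog 2 n))
  push_cast
  linarith

/-- The iteration bound for all loops inside a phase. -/
def loopBound (n : ℕ) : ℕ := 13824 * n ^ 7

theorem le_loopBound (hn : 1 ≤ n) {K : ℕ} (hK : K ≤ n) :
    2 * n * (n + 1) ≤ loopBound n ∧ n + 2 ≤ loopBound n ∧ K + 1 ≤ loopBound n ∧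
      Phase.steps K (1 + Nat.clog 2 n) ≤ loopBound n := by
  have h₁ : n ≤ n ^ 7 := Nat.le_self_pow (by norm_num) n
  have h₂ : n * n ≤ n ^ 7 := by
    rw [← sq]; exact Nat.pow_le_pow_right hn (by norm_num)
  have h₃ : Nat.clog 2 n ≤ n := Nat.clog_le_of_le_pow Nat.lt_two_pow_self.le
  unfold loopBound
  refine ⟨by nlinarith, by omega, by omega, ?_⟩
  calc Phase.steps K (1 + Nat.clog 2 n) ≤ 6912 * n ^ 6 * (n + n) :=
        Nat.mul_le_mul (Nat.mul_le_mul_left _ (Nat.pow_le_pow_left hK 6)) (by omega)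
    _ = 13824 * n ^ 7 := by ring

/-- One run of the algorithm, with the resources expressed by the number of phases. -/
theorem sparseMinimizer_exec {k : ℕ} {f : Finset (Fin n) → ℝ} {ε : ℝ} (hn : 1 ≤ n) (hk : 1 ≤ k)
    (hf : Submodular f) (hsp : HasSparseMinimizer f k) (hε : 0 < ε) :
    ∃ (φ : ℝ) (c : Cost) (s : State), 0 ≤ φ ∧ φ ≤ (2 * n + 2) * absMax f ∧
      Exec f sparseMinimizer (input n k ε) c s ∧ IsApproxMinimizer f ε (output n s) ∧
      c.depth ≤ 1 + phases φ ε *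
        ((min n k + 1) * Phase.steps (min n k) (1 + Nat.clog 2 n) + 1) ∧
      c.steps ≤ initProgram.bound (loopBound n) + (phases φ ε * (BExp.cost
        (.realLt (.var aEps) (.var aPhi)) + 1 + phaseProgram.bound (loopBound n)) +
          (BExp.cost (.realLt (.var aEps) (.var aPhi)) + 1)) ∧
      ∀ m ∈ c.rounds, m ≤ 2 * n * (n + 1) := by
  obtain ⟨S, hSk, hS⟩ := hsp
  set K := min n k with hK
  have hSK : S.card ≤ K := le_min (by simpa using Finset.card_le_univ S) hSk
  have hK1 : 1 ≤ K := le_min hn hk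
  obtain ⟨hN, hN₂, hNK, hNT⟩ := le_loopBound hn (min_le_left n k)
  obtain ⟨c₁, s₁, hE₁, ⟨hst, hs₁K, hs₁L, hs₁ε, hs₁φ, hinv⟩, ht₁, hr₁, hm₁⟩ :=
    initProgram_runs (k := k) (ε := ε) hn hN hN₂ hf S
  set φ := s₁.real aPhi 0 with hφ
  have hφ₀ : 0 ≤ φ := by
    have h₁ := hinv.bot_le
    have h₂ := minValue_le f (s₁.row n aCur 0)
    linarith
  obtain ⟨c₂, s₂, hE₂, hI₂, ht₂, hr₂, hm₂⟩ := exec_loop (f := f) (N := loopBound n) (s := s₁)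
    (b := .realLt (.var aEps) (.var aPhi)) (p := phaseProgram) (M := phases φ ε)
    (r := (K + 1) * Phase.steps K (1 + Nat.clog 2 n) + 1)
    (fun j s => Static n s ∧ s.nat aK 0 = K ∧ s.nat aLam 0 = 1 + Nat.clog 2 n ∧
      s.real aEps 0 = ε ∧ s.real aPhi 0 = φ / 2 ^ j ∧
      Inv f S (s.real aPhi 0) (fun p => s.row n aCur p) (s.row n aDead 0))
    ⟨hst, hs₁K, hs₁L, hs₁ε, by simp [hφ], hinv⟩
    (by
      rintro j s _ ⟨_, _, _, h₁, h₂, _⟩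
      rw [lt_phases_iff hφ₀ hε]
      simp only [BExp.Holds, RExp.eval, NExp.eval, h₁, h₂])
    (by
      rintro j s hj ⟨a₁, a₂, a₃, a₄, a₅, a₆⟩
      have hpos : 0 < s.real aPhi 0 := by
        rw [a₅]; exact hε.trans ((lt_phases_iff hφ₀ hε j).1 hj)
      have := phaseProgram_runs (f := f) a₁ hn hN (by rw [a₂]; exact hNK)
        (by rw [a₂, a₃]; exact hNT)
      rw [a₂, a₃] at this
      refine this.imp fun s' hf' ⟨h₁, h₂, h₃⟩ => ?_
      refine ⟨a₁.frame hf' rfl rfl, by rw [hf'.1 aK rfl, a₂], by rw [hf'.1 aLam rfl, a₃],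
        by rw [hf'.2 aEps rfl, a₄], by rw [h₁, a₅, pow_succ]; ring, ?_⟩
      rw [h₁]
      exact a₆.next hf hn hpos hK1 hSK hS (log_le_clog hn) h₂ h₃)
  obtain ⟨_, _, _, _, hφ₂, hinv₂⟩ := hI₂
  refine ⟨φ, c₁.append c₂, s₂, hφ₀, hs₁φ, .seq hE₁ hE₂, ?_, ?_, ?_, ?_⟩
  · have hle : φ / 2 ^ phases φ ε ≤ ε :=
      not_lt.1 fun h => lt_irrefl _ ((lt_phases_iff hφ₀ hε _).2 h)
    have h₁ : f (s₂.row n aCur 0) ≤ minValue f + s₂.real aPhi 0 := hinv₂.bot_le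
    rw [hφ₂] at h₁
    exact h₁.trans (by linarith)
  · rw [Cost.depth, Cost.append, List.length_append]
    exact add_le_add hr₁ hr₂
  · exact add_le_add ht₁ ht₂
  · intro m hm
    rcases List.mem_append.1 hm with hm | hm
    exacts [hm₁ m hm, hm₂ m hm]

theorem sum_le_length_mul {l : List ℕ} {B : ℕ} (h : ∀ m ∈ l, m ≤ B) : l.sum ≤ l.length * B := by
  simpa using List.sum_le_card_nsmul l B h

theorem depth_le (hn : 1 ≤ n) {k : ℕ} (hk : 1 ≤ k) {x : ℝ} (hx : 0 ≤ x) {p : ℕ}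
    (hp : (p : ℝ) ≤ 16 * (Real.log (n + 1) * Real.log (2 + x))) :
    ((1 + p * ((min n k + 1) * Phase.steps (min n k) (1 + Nat.clog 2 n) + 1) : ℕ) : ℝ) ≤
      2000000 * Real.log (n + 1) ^ 2 * ((k : ℝ) ^ 7 * Real.log (2 + x)) := by
  have hu := half_le_log_succ hn
  have hL := half_le_log_two_add hx
  have hΛ := clog_le hn
  set u := Real.log (n + 1)
  set L := Real.log (2 + x)
  set Λ := 1 + Nat.clog 2 n
  have hk' : (1 : ℝ) ≤ k := by exact_mod_cast hk
  have hk7 : (1 : ℝ) ≤ (k : ℝ) ^ 7 := one_le_pow₀ hk'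
  have h₁ : ((min n k + 1) * Phase.steps (min n k) Λ + 1 : ℕ) ≤
      (k + k) * (6912 * k ^ 6 * Λ) + 1 := by
    refine Nat.add_le_add_right (Nat.mul_le_mul ?_ ?_) 1
    · have := min_le_right n k; omega
    · exact Nat.mul_le_mul_right _ (Nat.mul_le_mul_left _
        (Nat.pow_le_pow_left (min_le_right n k) 6))
  have h₂ : (((min n k + 1) * Phase.steps (min n k) Λ + 1 : ℕ) : ℝ) ≤
      82946 * ((k : ℝ) ^ 7 * u) := by
    refine (Nat.cast_le.2 h₁).trans ?_
    push_cast
    have h₃ : (k : ℝ) ^ 7 * Λ ≤ k ^ 7 * (6 * u) := mul_le_mul_of_nonneg_left hΛ (by positivity)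
    have h₄ : (1 : ℝ) / 2 ≤ k ^ 7 * u := by nlinarith
    calc ((k : ℝ) + k) * (6912 * k ^ 6 * Λ) + 1 = 13824 * (k ^ 7 * Λ) + 1 := by ring
      _ ≤ 82946 * ((k : ℝ) ^ 7 * u) := by linarith
  have h₅ := mul_le_mul hp h₂ (Nat.cast_nonneg _) (by positivity)
  have h₆ : (1 : ℝ) ≤ 8 * (u ^ 2 * ((k : ℝ) ^ 7 * L)) := by
    have a₁ : (1 : ℝ) / 4 ≤ u ^ 2 := by nlinarith
    have a₂ : (1 : ℝ) / 2 ≤ (k : ℝ) ^ 7 * L := by nlinarith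
    nlinarith
  rw [Nat.cast_add, Nat.cast_mul, Nat.cast_one]
  nlinarith

end SparseSFM

open SparseSFM in
theorem theorem1p1 :
    ∃ (P : SparseSFM.Program) (C : ℝ) (a d : ℕ),
      ∀ (n k : ℕ), 1 ≤ n → 1 ≤ k →
      ∀ (f : Finset (Fin n) → ℝ), SparseSFM.Submodular f → SparseSFM.HasSparseMinimizer f k →
      ∀ ε : ℝ, 0 < ε →
      ∃ (c : SparseSFM.Cost) (s : SparseSFM.State),
        SparseSFM.Exec f P (SparseSFM.input n k ε) c s ∧
        SparseSFM.IsApproxMinimizer f ε (SparseSFM.output n s) ∧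
        (c.depth : ℝ) ≤ C * Real.log (n + 1) ^ a *
          ((k : ℝ) ^ 7 * Real.log (2 + SparseSFM.absMax f / ε)) ∧
        (∀ EO : ℝ, 0 ≤ EO →
          c.time EO ≤ C * Real.log (n + 1) ^ a *
            ((n : ℝ) ^ 2 * (k : ℝ) ^ 7 * Real.log (2 + SparseSFM.absMax f / ε) * EO +
              (n : ℝ) ^ d * Real.log (2 + SparseSFM.absMax f / ε))) ∧
        (∀ m ∈ c.rounds,
          (m : ℝ) ≤ C * (n : ℝ) ^ d * Real.log (2 + SparseSFM.absMax f / ε) ^ d) := by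
  obtain ⟨c₁, d₁, hb₁⟩ := Program.exists_bound_le initProgram
  obtain ⟨c₂, d₂, hb₂⟩ := Program.exists_bound_le phaseProgram
  set g : ℕ := BExp.cost (.realLt (.var aEps) (.var aPhi)) + 1 with hg
  set d := 7 * (d₁ + d₂) + 2 with hd
  set C₀ : ℝ := 40 * ((c₁ + c₂ + 2 * g : ℕ) * 13824 ^ (d₁ + d₂)) with hC₀
  have hC₀0 : 0 ≤ C₀ := by positivity
  refine ⟨sparseMinimizer, 8000000 + C₀ + 4 * 2 ^ d, 2, d,
    fun n k hn hk f hf hsp ε hε => ?_⟩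
  obtain ⟨φ, c, s, hφ₀, hφ, hE, happ, hdep, hsteps, hm⟩ :=
    sparseMinimizer_exec hn hk hf hsp hε
  have hA : 0 ≤ absMax f := (abs_nonneg _).trans (abs_le_absMax f ∅)
  have hx : 0 ≤ absMax f / ε := by positivity
  have hph := phases_le hn hφ₀ hε hA hφ
  have hdepth : (c.depth : ℝ) ≤ _ := (Nat.cast_le.2 hdep).trans (depth_le hn hk hx hph)
  have hu := half_le_log_succ hn
  have hL := half_le_log_two_add hx
  set u := Real.log (n + 1)
  set L := Real.log (2 + absMax f / ε)
  have hn' : (1 : ℝ) ≤ n := by exact_mod_cast hn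
  have hk' : (1 : ℝ) ≤ k := by exact_mod_cast hk
  have hmain : 0 ≤ u ^ 2 * ((k : ℝ) ^ 7 * L) := by positivity
  have h2d : (0 : ℝ) < 4 * 2 ^ d := by positivity
  have hm2 : 2 * n * (n + 1) ≤ 4 * n ^ 2 := by nlinarith
  refine ⟨c, s, hE, happ, ?_, fun EO hEO => ?_, fun m hmem => ?_⟩
  · rw [mul_assoc] at hdepth ⊢
    refine hdepth.trans (mul_le_mul_of_nonneg_right ?_ hmain)
    linarith
  · have hq : (c.queries : ℝ) ≤ 8000000 * (u ^ 2 * (n ^ 2 * k ^ 7 * L)) := by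
      have h₁ : c.queries ≤ c.depth * (4 * n ^ 2) := sum_le_length_mul fun m h => (hm m h).trans hm2
      have h₂ : (c.queries : ℝ) ≤ c.depth * (4 * n ^ 2) := by exact_mod_cast h₁
      refine h₂.trans ((mul_le_mul_of_nonneg_right hdepth (by positivity)).trans_eq ?_)
      ring
    have hN1 : 1 ≤ loopBound n := by
      have := (le_loopBound hn le_rfl).2.1
      omega
    have hst : (c.steps : ℝ) ≤ C₀ * (u ^ 2 * (n ^ d * L)) := by
      -- `D` bounds the steps of one phase, up to a constant, and is polynomial in `n`
      set D := loopBound n ^ (d₁ + d₂) with hD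
      have e₁ : initProgram.bound (loopBound n) ≤ c₁ * D :=
        (hb₁ _ hN1).trans (Nat.mul_le_mul_left _ (Nat.pow_le_pow_right hN1 (by omega)))
      have e₂ : phaseProgram.bound (loopBound n) ≤ c₂ * D :=
        (hb₂ _ hN1).trans (Nat.mul_le_mul_left _ (Nat.pow_le_pow_right hN1 (by omega)))
      have e₃ : g ≤ g * D := Nat.le_mul_of_pos_right _ (pow_pos hN1 _)
      have e₄ : c.steps ≤ (phases φ ε + 1) * ((c₁ + c₂ + 2 * g) * D) := by
        refine hsteps.trans ?_
        calc initProgram.bound (loopBound n) +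
              (phases φ ε * (g + phaseProgram.bound (loopBound n)) + g)
            ≤ c₁ * D + (phases φ ε * (g * D + c₂ * D) + g * D) :=
              add_le_add e₁ (add_le_add (Nat.mul_le_mul_left _ (add_le_add e₃ e₂)) e₃)
          _ ≤ (phases φ ε + 1) * ((c₁ + c₂ + 2 * g) * D) := by
              have := Nat.zero_le (phases φ ε * (c₁ * D) + phases φ ε * (g * D) + c₂ * D + g * D)
              nlinarith
      have e₅ : ((phases φ ε : ℝ) + 1) ≤ 40 * (u ^ 2 * L) := by
        have a₁ : (1 : ℝ) / 4 ≤ u * L := by nlinarith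
        have a₂ := mul_le_mul_of_nonneg_right hu (by linarith : 0 ≤ u * L)
        linear_combination hph + 4 * a₁ + 40 * a₂
      have e₆ : (D : ℝ) ≤ 13824 ^ (d₁ + d₂) * n ^ d := by
        rw [hD, loopBound]
        push_cast
        rw [mul_pow, ← pow_mul]
        exact mul_le_mul_of_nonneg_left (pow_le_pow_right₀ hn' (by omega)) (by positivity)
      calc (c.steps : ℝ) ≤ ((phases φ ε + 1) * ((c₁ + c₂ + 2 * g) * D) : ℕ) := Nat.cast_le.2 e₄
        _ = ((phases φ ε : ℝ) + 1) * (((c₁ + c₂ + 2 * g : ℕ) : ℝ) * D) := by push_cast; ring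
        _ ≤ 40 * (u ^ 2 * L) * (((c₁ + c₂ + 2 * g : ℕ) : ℝ) * (13824 ^ (d₁ + d₂) * n ^ d)) :=
            mul_le_mul e₅ (mul_le_mul_of_nonneg_left e₆ (by positivity)) (by positivity)
              (by positivity)
        _ = C₀ * (u ^ 2 * (n ^ d * L)) := by rw [hC₀]; ring
    have h₁ := mul_le_mul_of_nonneg_right hq hEO
    have h₂ : 0 ≤ u ^ 2 * (n ^ 2 * k ^ 7 * L) * EO := by positivity
    have h₃ : 0 ≤ u ^ 2 * ((n : ℝ) ^ d * L) := by positivity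
    have h₄ := mul_nonneg (by linarith : 0 ≤ C₀ + 4 * 2 ^ d) h₂
    have h₅ := mul_nonneg (by linarith : 0 ≤ 8000000 + 4 * (2 : ℝ) ^ d) h₃
    rw [Cost.time]
    linear_combination h₁ + hst + h₄ + h₅
  · have h₁ : (m : ℝ) ≤ 4 * n ^ 2 := by exact_mod_cast (hm m hmem).trans hm2
    have h₂ : (n : ℝ) ^ 2 ≤ n ^ d := pow_le_pow_right₀ hn' (by omega)
    have h₃ : (1 : ℝ) ≤ 2 ^ d * L ^ d := by
      rw [← mul_pow]; exact one_le_pow₀ (by linarith)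
    calc (m : ℝ) ≤ 4 * n ^ 2 := h₁
      _ ≤ 4 * n ^ d := by linarith
      _ ≤ 4 * n ^ d * (2 ^ d * L ^ d) := le_mul_of_one_le_right (by positivity) h₃
      _ = 4 * 2 ^ d * (n ^ d * L ^ d) := by ring
      _ ≤ (8000000 + C₀ + 4 * 2 ^ d) * (n ^ d * L ^ d) :=
          mul_le_mul_of_nonneg_right (by linarith) (by positivity)
      _ = (8000000 + C₀ + 4 * 2 ^ d) * n ^ d * L ^ d := by ring
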